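/- **Setting.** Let $X\subset\mathbb R^d$ be a non-empty compact connected set, $\Psi_1,\dots,\Psi_N$ strictly contractive similitudes of $\mathbb R^d$ with distinct fixed points such that $X=\bigcup_i\Psi_i(X)$, and $F$ a subset of the set of their fixed points such that $\Psi_i(X)\cap\Psi_j(X)=\Psi_i(F)\cap\Psi_j(F)$ for $i\neq j$. Let $\alpha_i,\beta_i\in(0,1)$ with $\sum_i\beta_i=1$ and $\alpha_i\beta_i$ independent of $i$. Fix a blow-up $\omega\in\{1,\dots,N\}^{\mathbb N}$ and put $$\phi_n=\Psi_{\omega_1}^{-1}\circ\dots\circ\Psi_{\omega_n}^{-1},\quad X_{<n>}=\phi_n(X),\quad \partial X_{<n>}=\partial F_{<n>}=\phi_n(F),\quad X_{<\infty>}=\bigcup_nX_{<n>},$$ $$F_{<n>}=\bigcup_{i_1,\dots,i_n}\phi_n\Psi_{i_1}\cdots\Psi_{i_n}(F),\quad F_{<\infty>}=\bigcup_nF_{<n>},\quad \partial X_{<\infty>}=\partial F_{<\infty>}=\bigcap_n\bigcup_{m\ge n}\partial F_{<m>}.$$ *Lattice case.* Let $Af(x)=-\sum_{y\ne x}a_{x,y}(f(y)-f(x))$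 on $\mathbb R^F$ with $a_{x,y}=a_{y,x}\ge0$ and such that the graph $\{a_{x,y}>0\}$ on $F$ is connected, and let $b$ be a strictly positive measure on $F$. With $\psi_{n,i}=\phi_n\Psi_{i_1}\cdots\Psi_{i_n}$ for $i=(i_1,\dots,i_n)$, set $$\langle A_{<n>}f,g\rangle=\sum_{i_1,\dots,i_n}\alpha_{\omega_1}\cdots\alpha_{\omega_n}\,\alpha_{i_1}^{-1}\cdots\alpha_{i_n}^{-1}\langle A(f\circ\psi_{n,i}),g\circ\psi_{n,i}\rangle,$$ $$b_{<n>}=\sum_{i_1,\dots,i_n}\beta_{\omega_1}^{-1}\cdots\beta_{\omega_n}^{-1}\,\beta_{i_1}\cdots\beta_{i_n}\,(\psi_{n,i})_*b,$$ and let $b_{<\infty>}$ and $\langle A_{<\infty>}\cdot,\cdot\rangle$ be their limits as $n\to\infty$. For $n\in\mathbb N\cup\{\infty\}$ let $H^+_{<n>}$ be the operator of the form $\langle A_{<n>}f,g\rangle=-\int H^+_{<n>}f\,g\,db_{<n>}$ on $L^2(F_{<n>},b_{<n>})$ (Neumann), and $H^-_{<n>}$ the operator of the same form on the subspace of functions vanishing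 on $\partial F_{<n>}$ (Dirichlet). *Continuous case.* Let $m$ be the self-similar probability measure on $X$, $\int f\,dm=\sum_i\beta_i\int f\circ\Psi_i\,dm$, and let $(a,\mathcal D)$ be a local, regular, conservative Dirichlet form on $L^2(X,m)$, with $\mathcal D\subset C(X)$, that is self-similar: a continuous $f$ is in $\mathcal D$ if and only if all $f\circ\Psi_i$ are, and $a(f,f)=\sum_i\alpha_i^{-1}a(f\circ\Psi_i,f\circ\Psi_i)$ for $f\in\mathcal D$. Set $m_{<n>}=\beta_{\omega_1}^{-1}\cdots\beta_{\omega_n}^{-1}(\phi_n)_*m$, $\mathcal D_{<n>}^+=\{f\in L^2(m_{<n>}):f\circ\phi_n\in\mathcal D\}$, $a_{<n>}(f,g)=\alpha_{\omega_1}\cdots\alpha_{\omega_n}\,a(f\circ\phi_n,g\circ\phi_n)$, $m_{<\infty>}=\lim_n m_{<n>}$, $$\mathcal D_{<\infty>}^+=\{f\in L^2(m_{<\infty>}):f_{|X_{<n>}}\in\mathcal D^+_{<n>}\ \forall n,\ \sup_na_{<n>}(f_{|X_{<n>}},f_{|X_{<n>}})<\infty\},$$ $a_{<\infty>}=\lim_na_{<n>}$.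 For $n\in\mathbb N\cup\{\infty\}$ let $\mathcal D_{<n>}^-$ be the set of $f\in\mathcal D^+_{<n>}$ vanishing on $\partial X_{<n>}$, and let $H^\pm_{<n>}\le 0$ be the generator of $(a_{<n>},\mathcal D^\pm_{<n>})$. In both cases let $\nu^\pm_{<n>}$ ($n<\infty$) be the counting measure, with multiplicity, of the eigenvalues of $H^\pm_{<n>}$, and suppose that the density of states exists: $N^{-n}\nu^+_{<n>}$ and $N^{-n}\nu^-_{<n>}$ converge vaguely to the same measure $\mu$, finite on compact sets. Let $\Sigma^\pm$ be the spectrum of $H^\pm_{<\infty>}$, and $\Sigma^\pm_{ess}$ the spectrum without its isolated points that are eigenvalues of finite multiplicity. **Proposition 1.** In both the lattice and the continuous case: i) If $\partial X_{<\infty>}=\partial F_{<\infty>}$ is empty, then $H^+_{<\infty>}=H^-_{<\infty>}$, so that $\Sigma^+=\Sigma^-=:\Sigma$ and $\Sigma^+_{ess}=\Sigma^-_{ess}=:\Sigma_{ess}$, and $$\operatorname{supp}\mu=\Sigma=\Sigma_{ess}.$$ ii) Otherwise $\operatorname{supp}\mu=\Sigma^+_{ess}=\Sigma^-_{ess}$,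 and every eigenvalue of $H^\pm_{<\infty>}$ lying in $\Sigma^\pm\setminus\operatorname{supp}\mu$ has multiplicity $1$. -/

import Mathlib

open MeasureTheory Filter Topology
open scoped ENNReal

noncomputable section

namespace FractalBlowUp

/-! ### Energy forms and the operators they generate -/

/-- A symmetric form on real functions on `E`: a reference measure, a domain of functions and an
energy.  Functions of the domain count as elements of `L²(ref)`. -/
structure EnergyForm (E : Type*) [MeasurableSpace E] where
  ref : Measure E
  dom : Set (E → ℝ)
  energy : (E → ℝ) → (E → ℝ) → ℝ

namespace EnergyForm

variable {E : Type*} [MeasurableSpace E] (Q : EnergyForm E)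

/-- The Hilbert space on which the operator acts: the closure in `L²(ref)` of the domain
(all of `L²(ref)` when the domain is dense). -/
def space : Submodule ℝ (Lp ℝ 2 Q.ref) :=
  (Submodule.span ℝ {f : Lp ℝ 2 Q.ref | ∃ u ∈ Q.dom, f =ᵐ[Q.ref] u}).topologicalClosure

/-- The graph of the operator `H` of the form, with the sign convention
`energy f v = - ∫ (H f) v`, so that `H ≤ 0`: `Q.IsGenerator f h` means that `f` is in the domain of
`H` and `H f = h`. -/
def IsGenerator (f h : Lp ℝ 2 Q.ref) : Prop :=
  h ∈ Q.space ∧ ∃ u ∈ Q.dom, f =ᵐ[Q.ref] u ∧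
    ∀ v ∈ Q.dom, Q.energy u v = - ∫ x, h x * v x ∂Q.ref

/-- The spectrum of `H`: all real `l` for which `H - l`, from the domain of `H` to the Hilbert
space, is not bijective.  (`H` is closed and self-adjoint, so that the inverse is automatically
bounded and the spectrum is real.) -/
def spectrum : Set ℝ :=
  {l | ¬ ∀ k ∈ Q.space, ∃! f : Lp ℝ 2 Q.ref, ∃ h, Q.IsGenerator f h ∧ h - l • f = k}

/-- The space generated by the solutions of `H f = l f`. -/
def eigenspace (l : ℝ) : Submodule ℝ (Lp ℝ 2 Q.ref) :=
  Submodule.span ℝ {f | Q.IsGenerator f (l • f)}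

def IsEigenvalue (l : ℝ) : Prop := ∃ f, f ≠ 0 ∧ Q.IsGenerator f (l • f)

/-- The essential spectrum: the spectrum without its isolated points that are eigenvalues of finite
multiplicity. -/
def essSpectrum : Set ℝ :=
  {l ∈ Q.spectrum |
    ¬ ((∃ ε > 0, ∀ l' ∈ Q.spectrum, |l' - l| < ε → l' = l) ∧
      Q.IsEigenvalue l ∧ FiniteDimensional ℝ (Q.eigenspace l))}

/-- The counting measure of the eigenvalues of `H`, with multiplicity. -/
def countingMeasure : Measure ℝ :=
  Measure.sum fun l : ℝ =>
    ((Cardinal.toENat (Module.rank ℝ (Q.eigenspace l)) : ℕ∞) : ℝ≥0∞) • Measure.dirac l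

end EnergyForm

/-- `+` is `neumann`, `-` is `dirichlet`. -/
inductive BoundaryCondition
  | neumann
  | dirichlet

/-- The functions allowed by a boundary condition on the set `B`. -/
def BoundaryCondition.Holds {E : Type*} :
    BoundaryCondition → Set E → (E → ℝ) → Prop
  | .neumann, _, _ => True
  | .dirichlet, B, u => ∀ x ∈ B, u x = 0

/-- `μ` is the density of states of a sequence of operators `H_n^±`: it is a measure, finite on
compact sets, which is the vague limit of `N⁻ⁿ` times the counting measure of the
eigenvalues of `H_n^+`, and also of that of `H_n^-`. -/
def IsDensityOfStates {E : Type*} [MeasurableSpace E] (N : ℕ)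
    (H : ℕ → BoundaryCondition → EnergyForm E) (μ : Measure ℝ) : Prop :=
  IsFiniteMeasureOnCompacts μ ∧
  ∀ (c : BoundaryCondition) (φ : ℝ → ℝ), Continuous φ → HasCompactSupport φ →
    Tendsto (fun n : ℕ => ((N : ℝ) ^ n)⁻¹ * ∫ l, φ l ∂(H n c).countingMeasure) atTop
      (𝓝 (∫ l, φ l ∂μ))

/-! ### Finitely ramified self-similar sets and their blow-ups -/

/-- A finitely ramified self-similar set `X` in `ℝ^d`, given by `N` strictly contracting
similitudes `Ψ i` (indices run through `Fin N`) with distinct fixed points, and a set `F` of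
fixed points through which the cells `Ψ i (X)` meet. -/
structure SelfSimilarSet (d N : ℕ) where
  Ψ : Fin N → (EuclideanSpace ℝ (Fin d) ≃ᵈ EuclideanSpace ℝ (Fin d))
  contracting : ∀ i, ∃ r : ℝ, r < 1 ∧ ∀ x y, dist (Ψ i x) (Ψ i y) = r * dist x y
  distinct_fixed : ∀ i j x, Ψ i x = x → Ψ j x = x → i = j
  X : Set (EuclideanSpace ℝ (Fin d))
  isCompact : IsCompact X
  isConnected : IsConnected X
  self_similar : X = ⋃ i, Ψ i '' X
  F : Finset (EuclideanSpace ℝ (Fin d))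
  fixed_of_mem : ∀ p ∈ F, ∃ i, Ψ i p = p
  inter_cells : ∀ i j, i ≠ j → Ψ i '' X ∩ Ψ j '' X = Ψ i '' (F : Set _) ∩ Ψ j '' (F : Set _)

namespace SelfSimilarSet

variable {d N : ℕ} (S : SelfSimilarSet d N)

/-- `Ψ_{w_1} ∘ ⋯ ∘ Ψ_{w_n}`. -/
def wordMap {n : ℕ} (w : Fin n → Fin N) :
    EuclideanSpace ℝ (Fin d) ≃ᵈ EuclideanSpace ℝ (Fin d) :=
  (List.ofFn fun k => S.Ψ (w k)).prod

/-- `Ψ_{ω_1}⁻¹ ∘ ⋯ ∘ Ψ_{ω_n}⁻¹` (the first letter of the blow-up is `ω 0`). -/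
def blowUp (ω : ℕ → Fin N) (n : ℕ) :
    EuclideanSpace ℝ (Fin d) ≃ᵈ EuclideanSpace ℝ (Fin d) :=
  (List.ofFn fun k : Fin n => (S.Ψ (ω k))⁻¹).prod

/-- The boundary `∂X_n = ∂F_n`. -/
def boundary (ω : ℕ → Fin N) (n : ℕ) : Set (EuclideanSpace ℝ (Fin d)) :=
  S.blowUp ω n '' (S.F : Set _)

/-- The boundary `∂X_∞ = ∂F_∞`. -/
def boundaryInfty (ω : ℕ → Fin N) : Set (EuclideanSpace ℝ (Fin d)) :=
  ⋂ n, ⋃ m ≥ n, S.boundary ω m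

theorem map_mem (i : Fin N) {x : EuclideanSpace ℝ (Fin d)} (hx : x ∈ S.X) : S.Ψ i x ∈ S.X := by
  rw [S.self_similar]
  exact Set.mem_iUnion.2 ⟨i, x, hx, rfl⟩

/-- `Ψ i` as a map from `X` to itself. -/
def cellMap (i : Fin N) (x : S.X) : S.X := ⟨S.Ψ i x, S.map_mem i x.2⟩

/-- For `u` on `ℝ^d`, the function `(u restricted to X_n) ∘ Ψ_{ω_1}⁻¹ ∘ ⋯ ∘ Ψ_{ω_n}⁻¹` on `X`. -/
def pull (ω : ℕ → Fin N) (n : ℕ) (u : EuclideanSpace ℝ (Fin d) → ℝ) (x : S.X) : ℝ :=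
  u (S.blowUp ω n x)

end SelfSimilarSet

/-- The scaling weights: `α` in energy, `β` in measure, with `γ_i = (α_i β_i)⁻¹` constant. -/
structure Weights (N : ℕ) where
  α : Fin N → ℝ
  β : Fin N → ℝ
  α_mem : ∀ i, α i ∈ Set.Ioo (0 : ℝ) 1
  β_mem : ∀ i, β i ∈ Set.Ioo (0 : ℝ) 1
  sum_β : ∑ i, β i = 1
  proportional : ∃ γ : ℝ, ∀ i, (α i * β i)⁻¹ = γ

/-! ### The lattice case -/

/-- The data of the lattice case: conductances of an irreducible Laplacian on `F` and a strictly
positive measure `b` on `F`. -/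
structure LatticeData {d N : ℕ} (S : SelfSimilarSet d N) where
  a : S.F → S.F → ℝ
  a_symm : ∀ x y, a x y = a y x
  a_nonneg : ∀ x y, 0 ≤ a x y
  irreducible : (SimpleGraph.fromRel fun x y => 0 < a x y).Connected
  b : S.F → ℝ
  b_pos : ∀ x, 0 < b x

namespace LatticeData

variable {d N : ℕ} {S : SelfSimilarSet d N} (L : LatticeData S)

/-- `A f (x) = - ∑_{y ≠ x} a_{x,y} (f y - f x)` (the term `y = x` vanishes). -/
def A (f : S.F → ℝ) (x : S.F) : ℝ := - ∑ y, L.a x y * (f y - f x)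

/-- The measure `b_n` on `F_n`: the sum over the words `w` of length `n` of the copy of `b` on the
cell of `w`, with weight `β_{ω_1}⁻¹ ⋯ β_{ω_n}⁻¹ β_{w_1} ⋯ β_{w_n}`. -/
def measure (W : Weights N) (ω : ℕ → Fin N) (n : ℕ) : Measure (EuclideanSpace ℝ (Fin d)) :=
  ∑ w : Fin n → Fin N, ∑ p : S.F,
    ENNReal.ofReal ((∏ k : Fin n, (W.β (ω k))⁻¹) * (∏ k, W.β (w k)) * L.b p) •
      Measure.dirac (S.blowUp ω n (S.wordMap w p))

/-- The form `⟨A_n u, v⟩`: the sum over the words `w` of length `n` of the copy of `⟨A ·, ·⟩` on the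
cell of `w`, with weight `α_{ω_1} ⋯ α_{ω_n} α_{w_1}⁻¹ ⋯ α_{w_n}⁻¹`. -/
def energy (W : Weights N) (ω : ℕ → Fin N) (n : ℕ) (u v : EuclideanSpace ℝ (Fin d) → ℝ) : ℝ :=
  ∑ w : Fin n → Fin N, (∏ k : Fin n, W.α (ω k)) * (∏ k, (W.α (w k))⁻¹) *
    ∑ p : S.F, L.A (fun q => u (S.blowUp ω n (S.wordMap w q))) p *
      v (S.blowUp ω n (S.wordMap w p))

/-- The measure `b_∞` on `F_∞`, the limit of the increasing sequence `b_n`. -/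
def measureInfty (W : Weights N) (ω : ℕ → Fin N) : Measure (EuclideanSpace ℝ (Fin d)) :=
  ⨆ n, L.measure W ω n

/-- The form of `H_n^±` on `L²(b_n)`, that is, on functions on `F_n`, which vanish on `∂F_n` for the
Dirichlet condition. -/
def form (W : Weights N) (ω : ℕ → Fin N) (n : ℕ) (c : BoundaryCondition) :
    EnergyForm (EuclideanSpace ℝ (Fin d)) where
  ref := L.measure W ω n
  dom := {u | MemLp u 2 (L.measure W ω n) ∧ c.Holds (S.boundary ω n) u}
  energy := L.energy W ω n

/-- The form of `H_∞^±` on `L²(b_∞)`. -/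
def formInfty (W : Weights N) (ω : ℕ → Fin N) (c : BoundaryCondition) :
    EnergyForm (EuclideanSpace ℝ (Fin d)) where
  ref := L.measureInfty W ω
  dom := {u | MemLp u 2 (L.measureInfty W ω) ∧ c.Holds (S.boundaryInfty ω) u}
  energy u v := limUnder atTop fun n => L.energy W ω n u v

end LatticeData

/-! ### The continuous case -/

/-- The data of the continuous case: the self-similar probability measure `m` on `X` with weights
`β`, and a local, regular, conservative Dirichlet form `a` on `L²(X, m)`, self-similar with weights
`α`, whose domain consists of continuous functions (only the values of `a` on the domain matter). -/
structure SelfSimilarDirichletForm {d N : ℕ} (S : SelfSimilarSet d N) (W : Weights N) where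
  m : Measure S.X
  m_prob : IsProbabilityMeasure m
  m_self_similar : m = ∑ i, ENNReal.ofReal (W.β i) • m.map (S.cellMap i)
  dom : Submodule ℝ (S.X → ℝ)
  continuous_of_mem : ∀ f ∈ dom, Continuous f
  a : (S.X → ℝ) → (S.X → ℝ) → ℝ
  a_add : ∀ f ∈ dom, ∀ g ∈ dom, ∀ h ∈ dom, a (f + g) h = a f h + a g h
  a_smul : ∀ (t : ℝ), ∀ f ∈ dom, ∀ g ∈ dom, a (t • f) g = t * a f g
  a_symm : ∀ f ∈ dom, ∀ g ∈ dom, a f g = a g f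
  a_nonneg : ∀ f ∈ dom, 0 ≤ a f f
  closed : ∀ f : ℕ → S.X → ℝ, (∀ k, f k ∈ dom) →
    (∀ ε > 0, ∃ K, ∀ j ≥ K, ∀ k ≥ K,
      a (f j - f k) (f j - f k) + ∫ x, (f j x - f k x) ^ 2 ∂m < ε) →
    ∃ g ∈ dom, Tendsto (fun k => a (f k - g) (f k - g) + ∫ x, (f k x - g x) ^ 2 ∂m) atTop (𝓝 0)
  markov : ∀ f ∈ dom, (fun x => max 0 (min (f x) 1)) ∈ dom ∧
    a (fun x => max 0 (min (f x) 1)) (fun x => max 0 (min (f x) 1)) ≤ a f f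
  regular : ∀ g : S.X → ℝ, Continuous g → ∀ ε > 0, ∃ f ∈ dom, ∀ x, |f x - g x| < ε
  is_local : ∀ f ∈ dom, ∀ g ∈ dom, Disjoint (tsupport f) (tsupport g) → a f g = 0
  conservative : (fun _ => (1 : ℝ)) ∈ dom ∧ a (fun _ => 1) (fun _ => 1) = 0
  mem_dom_iff : ∀ f : S.X → ℝ, Continuous f → (f ∈ dom ↔ ∀ i, f ∘ S.cellMap i ∈ dom)
  a_self_similar : ∀ f ∈ dom,
    a f f = ∑ i, (W.α i)⁻¹ * a (f ∘ S.cellMap i) (f ∘ S.cellMap i)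

namespace SelfSimilarDirichletForm

variable {d N : ℕ} {S : SelfSimilarSet d N} {W : Weights N} (D : SelfSimilarDirichletForm S W)

/-- The measure `m_n` on `X_n`. -/
def measure (ω : ℕ → Fin N) (n : ℕ) : Measure (EuclideanSpace ℝ (Fin d)) :=
  ENNReal.ofReal (∏ k : Fin n, (W.β (ω k))⁻¹) • D.m.map fun x : S.X => S.blowUp ω n x

/-- The form `a_n` on `X_n`. -/
def energy (ω : ℕ → Fin N) (n : ℕ) (u v : EuclideanSpace ℝ (Fin d) → ℝ) : ℝ :=
  (∏ k : Fin n, W.α (ω k)) * D.a (S.pull ω n u) (S.pull ω n v)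

/-- The measure `m_∞` on `X_∞`, the limit of the increasing sequence `m_n`. -/
def measureInfty (ω : ℕ → Fin N) : Measure (EuclideanSpace ℝ (Fin d)) :=
  ⨆ n, D.measure ω n

/-- The form `(a_n, 𝒟_n^±)`, whose generator is `H_n^±`. -/
def form (ω : ℕ → Fin N) (n : ℕ) (c : BoundaryCondition) :
    EnergyForm (EuclideanSpace ℝ (Fin d)) where
  ref := D.measure ω n
  dom := {u | MemLp u 2 (D.measure ω n) ∧ S.pull ω n u ∈ D.dom ∧ c.Holds (S.boundary ω n) u}
  energy := D.energy ω n

/-- The form `(a_∞, 𝒟_∞^±)`, whose generator is `H_∞^±`. -/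
def formInfty (ω : ℕ → Fin N) (c : BoundaryCondition) :
    EnergyForm (EuclideanSpace ℝ (Fin d)) where
  ref := D.measureInfty ω
  dom := {u | MemLp u 2 (D.measureInfty ω) ∧ (∀ n, S.pull ω n u ∈ D.dom) ∧
    BddAbove (Set.range fun n => D.energy ω n u u) ∧ c.Holds (S.boundaryInfty ω) u}
  energy u v := limUnder atTop fun n => D.energy ω n u v

end SelfSimilarDirichletForm

end FractalBlowUp

end

open FractalBlowUp

/-! Since `α i * β i` is constant, energy and measure of a cell scale by the same weight. A function
on a union of cells is therefore coded by a family of functions on one reference cell, each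
multiplied by the square root of the weight of its cell, and energy plus squared `L²` norm becomes
the squared norm of an `ℓ²` sum. Functions on a stage or on the blow-up, with either boundary
condition, form closed subspaces `V` of one Hilbert space `Fam ω D`, cut out by matching values
where cells meet and by zeros on the boundary. The lattice and the continuous case differ only in
the reference cell (`CellModel`). On `V` the `L²` inner product is given by a bounded symmetric
operator `T`, which is `(1 - H)⁻¹` on the form domain, and the spectrum of `H` is read off the
pencil `1 - (1 - l) T`. By Weyl's criterion (`mem_pencilEssSpectrum_iff`), `l` is in the essential
spectrum iff there are spaces of quasi-modes of every dimension with every positive error.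

Stages and blow-up are linked by free quasi-modes (`CellModel.HasFreeQuasimodes`): functions
vanishing on the boundary of a stage which almost solve the eigenvalue equation even when tested on
functions that do not vanish there. Extended by zero they are quasi-modes on the blow-up, and a
single one can be copied into all `N ^ m` copies of the stage `n` in the stage `n + m`. A stage has
at most `|F|` boundary points, so imposing boundary conditions costs at most `|F|` dimensions.

If `l` is in the support of `μ`, the number of Dirichlet eigenvalues near `l` grows like `N ^ n`; up
to `|F|` dimensions their eigenfunctions give free quasi-modes (`hasFreeQuasimodes_of_le_finrank`),
so `l` is in the essential spectrum. Conversely, quasi-modes on the blow-up are truncated to a stage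
and give Dirichlet eigenvalues near `l`, hence a free quasi-mode (`exists_hasFreeQuasimodes`); its
copies are a positive proportion `N ^ (-n)` of all states, so `l` is in the support
(`mem_support_of_hasFreeQuasimodes`).

A point of the spectrum off the support is then an eigenvalue. Every fixed cell eventually leaves
the boundary of the stages, except at the points of the boundary of the blow-up, of which there is
at most one. Without such a point, an eigenfunction, truncated and corrected by bumps, is itself a
free quasi-mode, so no such eigenvalue exists. With one point, a two-dimensional eigenspace contains
an eigenfunction satisfying one more linear condition there, which plays the part of having both
boundary value and normal derivative zero, and this again yields a free quasi-mode
(`exists_hasFreeQuasimodes_of_two_le_finrank`, `exists_hasFreeQuasimodes_of_neumann`). Hence the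
multiplicity is one. -/

namespace FractalBlowUp

/-! ### Bounded symmetric operators with a gap in the spectrum -/

section SelfAdjoint

variable {V : Type*} [NormedAddCommGroup V] [InnerProductSpace ℝ V]

theorem inner_sq_le_of_nonneg {S : V →ₗ[ℝ] V} (hS : S.IsSymmetric)
    (h0 : ∀ x, 0 ≤ inner ℝ (S x) x) (x y : V) :
    inner ℝ (S x) y ^ 2 ≤ inner ℝ (S x) x * inner ℝ (S y) y := by
  have key : ∀ t : ℝ, 0 ≤ inner ℝ (S y) y * (t * t) + 2 * inner ℝ (S x) y * t + inner ℝ (S x) x := by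
    intro t
    have h1 := h0 (x + t • y)
    have h2 : inner ℝ (S y) x = inner ℝ (S x) y := by
      rw [hS, real_inner_comm]
    simp only [map_add, map_smul, inner_add_left, inner_add_right, inner_smul_left,
      inner_smul_right, h2] at h1
    simp only [conj_trivial] at h1
    linarith
  have := discrim_le_zero key
  unfold discrim at this
  linarith

/-- Cauchy–Schwarz for the form of `S`, with second vector `S x`. Vectors on which the quadratic
form is small are approximate kernel vectors. -/
theorem norm_sq_le_of_nonneg {S : V →L[ℝ] V} (hS : (S : V →ₗ[ℝ] V).IsSymmetric)
    (h0 : ∀ x, 0 ≤ inner ℝ (S x) x) (x : V) : ‖S x‖ ^ 2 ≤ ‖S‖ * inner ℝ (S x) x := by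
  have h1 := inner_sq_le_of_nonneg hS h0 x (S x)
  simp only [ContinuousLinearMap.coe_coe, real_inner_self_eq_norm_sq] at h1
  have h2 : inner ℝ (S (S x)) (S x) ≤ ‖S‖ * ‖S x‖ ^ 2 :=
    (real_inner_le_norm _ _).trans (by
      have := S.le_opNorm (S x)
      nlinarith [norm_nonneg (S x)])
  by_cases hx : ‖S x‖ = 0
  · rw [hx, zero_pow two_ne_zero]
    exact mul_nonneg (norm_nonneg _) (h0 x)
  · have hx' : 0 < ‖S x‖ ^ 2 := by positivity
    have h3 : (‖S x‖ ^ 2) * ‖S x‖ ^ 2 ≤ (‖S‖ * inner ℝ (S x) x) * ‖S x‖ ^ 2 := by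
      have := mul_le_mul_of_nonneg_left h2 (h0 x)
      nlinarith
    exact le_of_mul_le_mul_right h3 hx'

variable [CompleteSpace V]

/-- By symmetry the orthogonal complement of the range is the kernel, which the lower bound makes
trivial. -/
theorem bijective_of_bounded_below {A : V →L[ℝ] V} (hA : (A : V →ₗ[ℝ] V).IsSymmetric) {c : ℝ}
    (hc : 0 < c) (h : ∀ x, c * ‖x‖ ≤ ‖A x‖) : Function.Bijective A := by
  rw [ContinuousLinearMap.bijective_iff_dense_range_and_antilipschitz]
  constructor
  · rw [Submodule.topologicalClosure_eq_top_iff, Submodule.eq_bot_iff]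
    intro x hx
    rw [Submodule.mem_orthogonal] at hx
    have h1 : inner ℝ (A x) (A x) = 0 := by
      have := hx (A (A x)) ⟨A x, rfl⟩
      rw [← this]
      exact (hA (A x) x).symm
    have h2 := h x
    rw [inner_self_eq_zero.1 h1, norm_zero] at h2
    exact norm_le_zero_iff.1 (by nlinarith [norm_nonneg x])
  · refine ⟨⟨c⁻¹, by positivity⟩, ?_⟩
    refine ContinuousLinearMap.antilipschitz_of_bound A fun x => ?_
    change ‖x‖ ≤ c⁻¹ * ‖A x‖
    rw [inv_mul_eq_div, le_div_iff₀ hc]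
    linarith [h x]

theorem exists_bounded_below {A : V →L[ℝ] V} (h : Function.Bijective A) :
    ∃ c > 0, ∀ x, c * ‖x‖ ≤ ‖A x‖ := by
  rw [ContinuousLinearMap.bijective_iff_dense_range_and_antilipschitz] at h
  obtain ⟨-, K, hK⟩ := h
  refine ⟨((K : ℝ) + 1)⁻¹, by positivity, fun x => ?_⟩
  rw [inv_mul_le_iff₀ (by positivity)]
  have := hK.le_mul_dist x 0
  simp only [dist_zero_right, map_zero] at this
  nlinarith [norm_nonneg (A x)]

/-- A symmetric operator whose spectrum avoids `(0, 2r)` is at distance at least `r` from `r`. -/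
theorem le_norm_sub_smul_of_gap {P : V →L[ℝ] V} (hP : (P : V →ₗ[ℝ] V).IsSymmetric) {r : ℝ}
    (hr : 0 < r)
    (h : ∀ t ∈ Set.Ioo 0 (2 * r), Function.Bijective (P - t • (1 : V →L[ℝ] V))) (x : V) :
    r * ‖x‖ ≤ ‖P x - r • x‖ := by
  by_contra! hx
  have hx0 : x ≠ 0 := by rintro rfl; simp at hx
  set C : V →L[ℝ] V := P - r • 1 with hC
  have hCs : (C : V →ₗ[ℝ] V).IsSymmetric := by
    intro y z
    have := hP y z
    simp only [ContinuousLinearMap.coe_coe] at this ⊢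
    simp [hC, inner_sub_left, inner_sub_right, inner_smul_left, inner_smul_right, this]
  obtain ⟨c₀, hc₀, hb⟩ := exists_bounded_below (h r ⟨hr, by linarith⟩)
  set s : Set ℝ := (fun y => ‖C y‖) '' {y | ‖y‖ = 1} with hs
  have hbdd : BddBelow s := ⟨0, by rintro _ ⟨y, -, rfl⟩; exact norm_nonneg _⟩
  have hmem : ‖x‖⁻¹ * ‖C x‖ ∈ s :=
    ⟨‖x‖⁻¹ • x, by simp [norm_smul, hx0], by simp [norm_smul]⟩
  -- The offending `x` gives `c < r`, and bijectivity at the centre `r` of the gap gives `c > 0`; so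
  -- both `r + c` and `r - c` lie in the gap.
  set c := sInf s with hcdef
  have hcr : c < r := by
    refine (csInf_le hbdd hmem).trans_lt ?_
    rw [inv_mul_lt_iff₀ (norm_pos_iff.2 hx0), mul_comm]
    simpa [hC] using hx
  have hcpos : 0 < c := hc₀.trans_le (le_csInf ⟨_, hmem⟩ (by
    rintro _ ⟨y, hy, rfl⟩
    have h1 := hb y
    rw [show ‖y‖ = 1 from hy, mul_one] at h1
    exact h1))
  have hcle : ∀ y, c * ‖y‖ ≤ ‖C y‖ := by
    intro y
    by_cases hy : y = 0
    · simp [hy]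
    · have h1 : ‖y‖⁻¹ * ‖C y‖ ∈ s :=
        ⟨‖y‖⁻¹ • y, by simp [norm_smul, hy], by simp [norm_smul]⟩
      have h2 := csInf_le hbdd h1
      rwa [inv_mul_eq_div, le_div_iff₀ (norm_pos_iff.2 hy)] at h2
  -- `S = C ^ 2 - c ^ 2` is nonnegative by the choice of `c`, and bijective as a product of
  -- bijections. Its lower bound and `norm_sq_le_of_nonneg` keep `‖C y‖ ^ 2 - c ^ 2` away from zero
  -- on the unit sphere, against the definition of `c`.
  set S : V →L[ℝ] V := (P - (r + c) • 1) * (P - (r - c) • 1) with hS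
  have hSeq : ∀ y, S y = C (C y) - c ^ 2 • y := by
    intro y
    simp only [hS, hC, mul_apply_eq_comp, sub_apply,
      smul_apply, one_apply_eq_self, map_sub, map_smul]
    module
  have hSin : ∀ y, inner ℝ (S y) y = ‖C y‖ ^ 2 - c ^ 2 * ‖y‖ ^ 2 := by
    intro y
    have h1 := hCs (C y) y
    simp only [ContinuousLinearMap.coe_coe] at h1
    rw [hSeq, inner_sub_left, h1, inner_smul_left, real_inner_self_eq_norm_sq,
      real_inner_self_eq_norm_sq]
    simp
  have hSs : (S : V →ₗ[ℝ] V).IsSymmetric := by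
    intro y z
    have h1 := hCs (C y) z
    have h2 := hCs y (C z)
    simp only [ContinuousLinearMap.coe_coe] at h1 h2 ⊢
    rw [hSeq, hSeq, inner_sub_left, inner_sub_right, h1, h2, inner_smul_left, inner_smul_right]
    simp
  have hS0 : ∀ y, 0 ≤ inner ℝ (S y) y := by
    intro y
    rw [hSin]
    have := hcle y
    have h3 : (c * ‖y‖) ^ 2 ≤ ‖C y‖ ^ 2 := pow_le_pow_left₀ (by positivity) this 2
    nlinarith
  have hSbij : Function.Bijective S :=
    (h (r + c) ⟨by linarith, by linarith⟩).comp (h (r - c) ⟨by linarith, by linarith⟩)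
  obtain ⟨d, hd, hdb⟩ := exists_bounded_below hSbij
  have hlow : ∀ y, ‖y‖ = 1 → d ^ 2 ≤ (‖S‖ + 1) * (‖C y‖ ^ 2 - c ^ 2) := by
    intro y hy
    have h1 := hdb y
    have h2 := norm_sq_le_of_nonneg hSs hS0 y
    have h3 := hS0 y
    rw [hSin, hy] at h2 h3
    rw [hy] at h1
    have h4 : d ^ 2 ≤ ‖S y‖ ^ 2 := pow_le_pow_left₀ hd.le (by linarith) 2
    nlinarith
  set q := d ^ 2 / (‖S‖ + 1) with hq
  have hqpos : 0 < q := by positivity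
  have hlt : c < √(c ^ 2 + q) := by
    rw [Real.lt_sqrt hcpos.le]; linarith
  obtain ⟨_, ⟨y, hy, rfl⟩, hylt⟩ := exists_lt_of_csInf_lt ⟨_, hmem⟩ hlt
  have h1 := hlow y hy
  have h2 : q ≤ ‖C y‖ ^ 2 - c ^ 2 := by
    rw [hq, div_le_iff₀ (by positivity)]; linarith
  have h3 : ‖C y‖ ^ 2 < c ^ 2 + q := by
    simp only [] at hylt
    exact (Real.lt_sqrt (norm_nonneg _)).1 hylt
  linarith

/-- Squaring turns the punctured interval around `0` into the gap `(0, δ ^ 2)` of `A ^ 2`. The gap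
lemma at its midpoint gives the bound on the range of `A`, which is dense because `A` is symmetric
and injective. -/
theorem bijective_of_isolated {A : V →L[ℝ] V} (hA : (A : V →ₗ[ℝ] V).IsSymmetric)
    (hinj : Function.Injective A) {δ : ℝ} (hδ : 0 < δ)
    (h : ∀ t : ℝ, t ≠ 0 → |t| < δ → Function.Bijective (A - t • (1 : V →L[ℝ] V))) (x : V) :
    δ * ‖x‖ ≤ ‖A x‖ := by
  have hPs : ((A * A : V →L[ℝ] V) : V →ₗ[ℝ] V).IsSymmetric := by
    intro y z
    have h1 := hA (A y) z
    have h2 := hA y (A z)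
    simp only [ContinuousLinearMap.coe_coe] at h1 h2 ⊢
    simp [h1, h2]
  have hgap : ∀ t ∈ Set.Ioo 0 (2 * (δ ^ 2 / 2)),
      Function.Bijective (A * A - t • 1 : V →L[ℝ] V) := by
    rintro t ⟨ht0, ht⟩
    have hsq : √t * √t = t := Real.mul_self_sqrt ht0.le
    have hs0 : 0 < √t := Real.sqrt_pos.2 ht0
    have hsδ : √t < δ := by
      rw [Real.sqrt_lt' hδ]; linarith
    have e : (A * A - t • 1 : V →L[ℝ] V) = (A - √t • 1) * (A - (-√t) • 1) := by
      ext y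
      simp only [mul_apply_eq_comp, sub_apply,
        smul_apply, one_apply_eq_self, map_sub, map_smul]
      rw [show t • y = √t • √t • y by rw [smul_smul, hsq]]
      module
    rw [e]
    exact (h _ hs0.ne' (by rwa [abs_of_pos hs0])).comp
      (h _ (neg_ne_zero.2 hs0.ne') (by rwa [abs_neg, abs_of_pos hs0]))
  have hrange : ∀ y, δ * ‖A y‖ ≤ ‖A (A y)‖ := by
    intro y
    have h1 := le_norm_sub_smul_of_gap hPs (by positivity : 0 < δ ^ 2 / 2) hgap y
    have h2 : (δ ^ 2 / 2 * ‖y‖) ^ 2 ≤ ‖A (A y) - (δ ^ 2 / 2) • y‖ ^ 2 :=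
      pow_le_pow_left₀ (by positivity) h1 2
    have h3 := hA (A y) y
    simp only [ContinuousLinearMap.coe_coe] at h3
    -- With `r = δ ^ 2 / 2`, the terms `r ^ 2 ‖y‖ ^ 2` on the two sides cancel, and what is left is
    -- `2 r ‖A y‖ ^ 2 ≤ ‖A (A y)‖ ^ 2`.
    rw [norm_sub_sq_real, inner_smul_right, h3, real_inner_self_eq_norm_sq, norm_smul,
      Real.norm_of_nonneg (by positivity)] at h2
    refine le_of_sq_le_sq ?_ (norm_nonneg _)
    nlinarith
  have hdense : DenseRange A := by
    have : (A : V →ₗ[ℝ] V).range.topologicalClosure = ⊤ := by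
      rw [Submodule.topologicalClosure_eq_top_iff, Submodule.eq_bot_iff]
      intro y hy
      rw [Submodule.mem_orthogonal] at hy
      have h1 : inner ℝ (A y) (A y) = 0 := by
        rw [← hy (A (A y)) ⟨A y, rfl⟩]
        exact (hA (A y) y).symm
      exact hinj (by rw [inner_self_eq_zero.1 h1, map_zero])
    have h2 := Submodule.dense_iff_topologicalClosure_eq_top.2 this
    exact h2
  exact isClosed_property (p := fun y => δ * ‖y‖ ≤ ‖A y‖) hdense
    (isClosed_le (by fun_prop) (by fun_prop)) hrange x

end SelfAdjoint

/-! ### The pencil of a resolvent and its quasi-modes -/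

section Pencil

variable {V : Type*} [NormedAddCommGroup V] [InnerProductSpace ℝ V]

/-- The pencil `1 - (1 - l) T`; if `T` is the resolvent `(1 - H)⁻¹` this is `(l - H) T`. -/
def pencil (T : V →L[ℝ] V) (l : ℝ) : V →L[ℝ] V := 1 - (1 - l) • T

theorem pencil_apply (T : V →L[ℝ] V) (l : ℝ) (x : V) : pencil T l x = x - (1 - l) • T x := rfl

theorem pencil_symm {T : V →L[ℝ] V} (hT : (T : V →ₗ[ℝ] V).IsSymmetric) (l : ℝ) :
    (pencil T l : V →ₗ[ℝ] V).IsSymmetric := by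
  intro y z
  have := hT y z
  simp only [ContinuousLinearMap.coe_coe] at this ⊢
  simp [pencil_apply, inner_sub_left, inner_sub_right, inner_smul_left, inner_smul_right, this]

/-- The kernel of the pencil. -/
def pencilKer (T : V →L[ℝ] V) (l : ℝ) : Submodule ℝ V := LinearMap.ker (pencil T l : V →ₗ[ℝ] V)

theorem mem_pencilKer {T : V →L[ℝ] V} {l : ℝ} {x : V} :
    x ∈ pencilKer T l ↔ x = (1 - l) • T x := by
  rw [pencilKer, LinearMap.mem_ker, ContinuousLinearMap.coe_coe, pencil_apply, sub_eq_zero]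

def pencilSpectrum (T : V →L[ℝ] V) : Set ℝ := {l | ¬ Function.Bijective (pencil T l)}

def pencilEssSpectrum (T : V →L[ℝ] V) : Set ℝ :=
  {l ∈ pencilSpectrum T |
    ¬ ((∃ ε > 0, ∀ l' ∈ pencilSpectrum T, |l' - l| < ε → l' = l) ∧
      pencilKer T l ≠ ⊥ ∧ FiniteDimensional ℝ (pencilKer T l))}

/-- There is a `k`-dimensional space on which the pencil is at most `ε`. -/
def HasQuasimodes (T : V →L[ℝ] V) (l ε : ℝ) (k : ℕ) : Prop :=
  ∃ X : Submodule ℝ V, FiniteDimensional ℝ X ∧ k ≤ Module.finrank ℝ X ∧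
    ∀ x ∈ X, ‖pencil T l x‖ ≤ ε * ‖x‖

theorem norm_le_norm_add_left {x y : V} (h : inner ℝ x y = 0) : ‖x‖ ≤ ‖x + y‖ := by
  have := norm_add_sq_real x y
  rw [h] at this
  exact le_of_sq_le_sq (by nlinarith [sq_nonneg ‖y‖]) (norm_nonneg _)

theorem norm_le_norm_add_right {x y : V} (h : inner ℝ x y = 0) : ‖y‖ ≤ ‖x + y‖ := by
  rw [add_comm]
  exact norm_le_norm_add_left (by rwa [real_inner_comm])

/-- Induction on the dimension: a vector orthogonal to the space found so far is adjoined.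
Orthogonality bounds both components of a vector by its norm, so two errors `ε / 2` add up to `ε`.
-/
theorem hasQuasimodes_of_weyl {T : V →L[ℝ] V} {l : ℝ}
    (h : ∀ Y : Submodule ℝ V, FiniteDimensional ℝ Y → ∀ δ > 0,
      ∃ g ∈ Yᗮ, g ≠ 0 ∧ ‖pencil T l g‖ ≤ δ * ‖g‖) :
    ∀ (k : ℕ) (ε : ℝ), 0 < ε → HasQuasimodes T l ε k := by
  intro k
  induction k with
  | zero => intro ε _; exact ⟨⊥, inferInstance, by simp, by simp⟩
  | succ k ih =>
    intro ε hε
    obtain ⟨X, hX, hk, hXb⟩ := ih (ε / 2) (by positivity)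
    obtain ⟨g, hg, hg0, hgb⟩ := h X hX (ε / 2) (by positivity)
    refine ⟨X ⊔ Submodule.span ℝ {g}, inferInstance, ?_, ?_⟩
    · have hd : X ⊓ Submodule.span ℝ {g} = ⊥ := by
        rw [Submodule.eq_bot_iff]
        rintro x ⟨hx, hxg⟩
        obtain ⟨t, rfl⟩ := Submodule.mem_span_singleton.1 hxg
        have h1 := (Submodule.mem_orthogonal _ _).1 hg _ hx
        rw [inner_smul_left, real_inner_self_eq_norm_sq] at h1
        have : t = 0 := by
          rcases mul_eq_zero.1 h1 with h1 | h1
          · simpa using h1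
          · exact absurd (norm_eq_zero.1 (pow_eq_zero_iff two_ne_zero |>.1 h1)) hg0
        simp [this]
      have h2 := Submodule.finrank_sup_add_finrank_inf_eq X (Submodule.span ℝ {g})
      rw [hd, finrank_bot, finrank_span_singleton hg0] at h2
      omega
    · intro z hz
      obtain ⟨x, hx, y, hy, rfl⟩ := Submodule.mem_sup.1 hz
      obtain ⟨t, rfl⟩ := Submodule.mem_span_singleton.1 hy
      have hin : inner ℝ x (t • g) = 0 := by
        rw [inner_smul_right, (Submodule.mem_orthogonal _ _).1 hg _ hx, mul_zero]
      have h1 := hXb x hx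
      have h2 : ‖pencil T l (t • g)‖ ≤ ε / 2 * ‖t • g‖ := by
        rw [map_smul, norm_smul, norm_smul]
        nlinarith [norm_nonneg t]
      have h3 := norm_le_norm_add_left hin
      have h4 := norm_le_norm_add_right hin
      rw [map_add]
      refine (norm_add_le _ _).trans ?_
      nlinarith

variable [CompleteSpace V]

/-- If `0` is isolated in the spectrum of `A`, then `A` is bounded below on the orthogonal
complement of its kernel. -/
theorem bounded_below_of_isolated {A : V →L[ℝ] V} (hA : (A : V →ₗ[ℝ] V).IsSymmetric)
    {δ : ℝ} (hδ : 0 < δ)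
    (h : ∀ t : ℝ, t ≠ 0 → |t| < δ → Function.Bijective (A - t • (1 : V →L[ℝ] V))) :
    ∃ c > 0, ∀ x ∈ (LinearMap.ker (A : V →ₗ[ℝ] V))ᗮ, c * ‖x‖ ≤ ‖A x‖ := by
  set E := LinearMap.ker (A : V →ₗ[ℝ] V) with hE
  have : CompleteSpace E := by
    have : IsClosed (E : Set V) := ContinuousLinearMap.isClosed_ker A
    exact this.completeSpace_coe
  have hAE : ∀ e ∈ E, A e = 0 := fun e he => he
  have hAort : ∀ g e, e ∈ E → inner ℝ (A g) e = 0 := by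
    intro g e he
    have := hA g e
    simp only [ContinuousLinearMap.coe_coe] at this
    rw [this, hAE e he, inner_zero_right]
  -- Adding the projection onto the kernel moves the eigenvalue `0` to `1` and leaves `A` alone on
  -- the orthogonal complement. The window must then stay below `1`, whence `min δ 1`.
  set A' : V →L[ℝ] V := A + E.starProjection with hA'
  have hdec : ∀ x : V, ∃ e ∈ E, ∃ g ∈ Eᗮ, x = e + g := by
    intro x
    exact ⟨_, E.starProjection_apply_mem x, _, E.sub_starProjection_mem_orthogonal x, by abel⟩
  have hproj : ∀ e ∈ E, ∀ g ∈ Eᗮ, E.starProjection (e + g) = e := by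
    intro e he g hg
    rw [map_add, Submodule.starProjection_eq_self_iff.2 he,
      (E.starProjection_apply_eq_zero_iff).2 hg, add_zero]
  have hA'app : ∀ e ∈ E, ∀ g ∈ Eᗮ, A' (e + g) = e + A g := by
    intro e he g hg
    rw [hA', add_apply, hproj e he g hg, map_add, hAE e he]
    abel
  have hA's : (A' : V →ₗ[ℝ] V).IsSymmetric := by
    intro y z
    have h1 := hA y z
    have h2 := E.starProjection_isSymmetric y z
    simp only [ContinuousLinearMap.coe_coe] at h1 h2 ⊢
    simp [hA', inner_add_left, inner_add_right, h1, h2]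
  have hinj : Function.Injective A' := by
    rw [injective_iff_map_eq_zero]
    intro x hx
    obtain ⟨e, he, g, hg, rfl⟩ := hdec x
    rw [hA'app e he g hg] at hx
    have h1 : inner ℝ e (A g) = 0 := by rw [real_inner_comm]; exact hAort g e he
    have h2 := norm_le_norm_add_left h1
    have h3 := norm_le_norm_add_right h1
    rw [hx, norm_zero] at h2 h3
    have h4 : g ∈ E := norm_le_zero_iff.1 h3
    have h5 : inner ℝ g g = 0 := (Submodule.mem_orthogonal _ _).1 hg _ h4
    rw [norm_le_zero_iff.1 h2, inner_self_eq_zero.1 h5, add_zero]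
  have hkey := bijective_of_isolated hA's hinj (lt_min hδ one_pos) (by
    intro t ht0 ht
    obtain ⟨c, hc, hcb⟩ := exists_bounded_below (h t ht0 (ht.trans_le (min_le_left _ _)))
    have ht1 : |t| < 1 := ht.trans_le (min_le_right _ _)
    have htl := le_abs_self t
    have hs : ((A' - t • 1 : V →L[ℝ] V) : V →ₗ[ℝ] V).IsSymmetric := by
      intro y z
      have := hA's y z
      simp only [ContinuousLinearMap.coe_coe] at this ⊢
      simp [inner_sub_left, inner_sub_right, inner_smul_left, inner_smul_right, this]
    refine bijective_of_bounded_below hs (c := min c (1 - t) / 2)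
      (half_pos (lt_min hc (by linarith))) fun x => ?_
    obtain ⟨e, he, g, hg, rfl⟩ := hdec x
    have heq : (A' - t • (1 : V →L[ℝ] V)) (e + g) = (1 - t) • e + (A g - t • g) := by
      rw [sub_apply, hA'app e he g hg, smul_apply, one_apply_eq_self]
      module
    have hge : inner ℝ g e = 0 := by
      rw [real_inner_comm]; exact (Submodule.mem_orthogonal _ _).1 hg _ he
    have hin : inner ℝ ((1 - t) • e) (A g - t • g) = 0 := by
      rw [inner_smul_left, inner_sub_right, inner_smul_right, real_inner_comm, hAort g e he,
        real_inner_comm, hge]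
      simp
    rw [heq]
    have h2 := norm_le_norm_add_left hin
    have h3 := norm_le_norm_add_right hin
    rw [norm_smul, Real.norm_of_nonneg (by linarith)] at h2
    have h4 := hcb g
    simp only [sub_apply, smul_apply, one_apply_eq_self] at h4
    have h5 := norm_add_le e g
    have h6 := min_le_left c (1 - t)
    have h7 := min_le_right c (1 - t)
    have h8 : 0 < min c (1 - t) := lt_min hc (by linarith)
    nlinarith [norm_nonneg e, norm_nonneg g])
  refine ⟨min δ 1, lt_min hδ one_pos, fun x hx => ?_⟩
  have h1 := hkey x
  have h2 := hA'app 0 E.zero_mem x hx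
  rw [zero_add, zero_add] at h2
  rwa [h2] at h1

/-- A symmetric operator that is bounded below on a subspace of finite codimension has a
finite-dimensional kernel and is bounded below on its orthogonal complement. -/
theorem bounded_below_of_finite_codim {A : V →L[ℝ] V} (hA : (A : V →ₗ[ℝ] V).IsSymmetric)
    (Y : Submodule ℝ V) [FiniteDimensional ℝ Y] {δ : ℝ} (hδ : 0 < δ)
    (h : ∀ g ∈ Yᗮ, δ * ‖g‖ ≤ ‖A g‖) :
    FiniteDimensional ℝ (LinearMap.ker (A : V →ₗ[ℝ] V)) ∧
    ∃ c > 0, ∀ x ∈ (LinearMap.ker (A : V →ₗ[ℝ] V))ᗮ, c * ‖x‖ ≤ ‖A x‖ := by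
  set E := LinearMap.ker (A : V →ₗ[ℝ] V) with hE
  have hAE : ∀ e ∈ E, A e = 0 := fun e he => he
  have hfin : FiniteDimensional ℝ E := by
    have hinj : Function.Injective ((Y.orthogonalProjectionOnto : V →ₗ[ℝ] Y) ∘ₗ E.subtype) := by
      rw [injective_iff_map_eq_zero]
      rintro ⟨e, he⟩ h0
      have h1 : e ∈ Yᗮ := by
        rw [← Submodule.orthogonalProjectionOnto_eq_zero_iff]
        exact h0
      have h2 := h e h1
      rw [hAE e he, norm_zero] at h2
      have : e = 0 := norm_le_zero_iff.1 (by nlinarith [norm_nonneg e])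
      simpa using this
    exact FiniteDimensional.of_injective _ hinj
  refine ⟨hfin, ?_⟩
  -- The lower bound makes the image of `Yᗮ` closed. The range of `A + E.starProjection` is this
  -- image plus a finite-dimensional space, so it is closed too, and injectivity gives a lower
  -- bound.
  have hclosed : IsClosed ((Submodule.map (A : V →ₗ[ℝ] V) Yᗮ : Submodule ℝ V) : Set V) := by
    have : AntilipschitzWith ⟨δ⁻¹, by positivity⟩ (A ∘L Yᗮ.subtypeL) := by
      refine ContinuousLinearMap.antilipschitz_of_bound _ fun x => ?_
      change ‖x‖ ≤ δ⁻¹ * ‖A x‖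
      rw [inv_mul_eq_div, le_div_iff₀ hδ]
      have := h x x.2
      rw [Submodule.coe_norm]
      linarith
    have h2 := this.isClosed_range (A ∘L Yᗮ.subtypeL).uniformContinuous
    convert h2 using 1
    ext z
    simp
  set A' : V →L[ℝ] V := A + E.starProjection with hA'
  have hAort : ∀ g e, e ∈ E → inner ℝ (A g) e = 0 := by
    intro g e he
    have := hA g e
    simp only [ContinuousLinearMap.coe_coe] at this
    rw [this, hAE e he, inner_zero_right]
  have hrange : IsClosed (Set.range A') := by
    have h1 := Submodule.isClosed_sup_finiteDimensional _
      (Submodule.map (A : V →ₗ[ℝ] V) Y ⊔ E) hclosed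
    convert h1 using 1
    ext z
    simp only [Set.mem_range, SetLike.mem_coe, Submodule.mem_sup, Submodule.mem_map]
    constructor
    · rintro ⟨x, rfl⟩
      exact ⟨A (x - Y.starProjection x), ⟨_, Y.sub_starProjection_mem_orthogonal x, rfl⟩, _,
        ⟨_, ⟨_, Y.starProjection_apply_mem x, rfl⟩, _, E.starProjection_apply_mem x, rfl⟩, by
          simp [hA']; abel⟩
    · rintro ⟨_, ⟨x, -, rfl⟩, _, ⟨_, ⟨y, -, rfl⟩, e, he, rfl⟩, rfl⟩
      refine ⟨(x + y) - E.starProjection (x + y) + e, ?_⟩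
      have h2 : A (E.starProjection (x + y)) = 0 := hAE _ (E.starProjection_apply_mem _)
      have h3 : E.starProjection (E.starProjection (x + y)) = E.starProjection (x + y) :=
        Submodule.starProjection_eq_self_iff.2 (E.starProjection_apply_mem _)
      have h4 : E.starProjection e = e := Submodule.starProjection_eq_self_iff.2 he
      rw [hA', add_apply]
      simp only [map_add, map_sub] at h2 h3 ⊢
      rw [h3, h4, hAE e he, h2]
      simp only [ContinuousLinearMap.coe_coe]
      abel
  have hA'inj : Function.Injective A' := by
    rw [injective_iff_map_eq_zero]
    intro x hx
    rw [hA', add_apply] at hx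
    have h1 := hAort x _ (E.starProjection_apply_mem x)
    have h2 := norm_le_norm_add_left h1
    have h3 := norm_le_norm_add_right h1
    rw [hx, norm_zero] at h2 h3
    have h4 : x ∈ E := norm_le_zero_iff.1 h2
    rw [← Submodule.starProjection_eq_self_iff.2 h4]
    exact norm_le_zero_iff.1 h3
  obtain ⟨K, hK⟩ := A'.antilipschitz_of_injective_of_isClosed_range hA'inj hrange
  refine ⟨((K : ℝ) + 1)⁻¹, by positivity, fun x hx => ?_⟩
  rw [inv_mul_le_iff₀ (by positivity)]
  have h1 := hK.le_mul_dist x 0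
  simp only [dist_zero_right, map_zero] at h1
  have h2 : A' x = A x := by
    rw [hA', add_apply, (E.starProjection_apply_eq_zero_iff).2 hx, add_zero]
  rw [h2] at h1
  nlinarith [norm_nonneg (A x)]

end Pencil

/-! ### Weyl's criterion for the essential spectrum -/

section EssSpectrum

variable {V : Type*} [NormedAddCommGroup V] [InnerProductSpace ℝ V]

/-- At `l = 1` the pencil is the identity, so an eigenvalue is never `1` and `1 - l` can be divided
by. -/
theorem pencilKer_one (T : V →L[ℝ] V) : pencilKer T 1 = ⊥ := by
  rw [Submodule.eq_bot_iff]
  intro x hx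
  rw [mem_pencilKer] at hx
  simpa using hx

/-- Translates a shift by `t` of the eigenvalue `(1 - l)⁻¹` of `T` into a shift of `l`. -/
theorem pencil_eq_smul (T : V →L[ℝ] V) {l : ℝ} (hl : l ≠ 1) (t : ℝ)
    (ht : (1 - l)⁻¹ + t ≠ 0) :
    T - (1 - l)⁻¹ • 1 - t • (1 : V →L[ℝ] V) =
      (-((1 - l)⁻¹ + t)) • pencil T (1 - ((1 - l)⁻¹ + t)⁻¹) := by
  have h2 : (1 - l)⁻¹ * (1 - l) + t * (1 - l) ≠ 0 := by
    rw [← add_mul]; exact mul_ne_zero ht (sub_ne_zero.2 hl.symm)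
  ext x
  simp only [pencil_apply, sub_apply, smul_apply, one_apply_eq_self, sub_sub_cancel, smul_sub,
    smul_smul]
  rw [neg_mul, mul_inv_cancel₀ ht]
  module

theorem exists_mem_orthogonal_of_finrank_lt (X E : Submodule ℝ V) [FiniteDimensional ℝ X]
    [FiniteDimensional ℝ E] (h : Module.finrank ℝ E < Module.finrank ℝ X) :
    ∃ x ∈ X, x ∈ Eᗮ ∧ x ≠ 0 := by
  have h1 := LinearMap.ker_ne_bot_of_finrank_lt
    (f := (E.orthogonalProjectionOnto : V →ₗ[ℝ] E) ∘ₗ X.subtype) h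
  obtain ⟨⟨x, hx⟩, hx1, hx0⟩ := Submodule.exists_mem_ne_zero_of_ne_bot h1
  refine ⟨x, hx, ?_, by simpa using hx0⟩
  rw [← Submodule.orthogonalProjectionOnto_eq_zero_iff]
  exact hx1

variable [CompleteSpace V]

theorem mem_pencilSpectrum_of_hasQuasimodes {T : V →L[ℝ] V} {l : ℝ}
    (h : ∀ ε > 0, HasQuasimodes T l ε 1) : l ∈ pencilSpectrum T := by
  intro hb
  obtain ⟨c, hc, hcb⟩ := exists_bounded_below hb
  obtain ⟨X, hX, hk, hXb⟩ := h (c / 2) (by positivity)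
  have : Nontrivial X := Module.nontrivial_of_finrank_pos (R := ℝ) (by omega)
  obtain ⟨⟨x, hx⟩, hx0⟩ := exists_ne (0 : X)
  have hx0' : 0 < ‖x‖ := norm_pos_iff.2 (by simpa using hx0)
  have h1 := hcb x
  have h2 := hXb x hx
  nlinarith

/-- If Weyl's condition fails, the pencil is bounded below off a finite-dimensional space; its
kernel is then finite-dimensional and perturbation of `l` shows that `l` is isolated. Conversely, at
an isolated eigenvalue of finite multiplicity the pencil is bounded below off the kernel, which
limits the dimension of good quasi-modes. -/
theorem mem_pencilEssSpectrum_iff {T : V →L[ℝ] V} (hT : (T : V →ₗ[ℝ] V).IsSymmetric) {l : ℝ} :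
    l ∈ pencilEssSpectrum T ↔ ∀ (k : ℕ) (ε : ℝ), 0 < ε → HasQuasimodes T l ε k := by
  constructor
  · rintro ⟨hl, hni⟩
    refine hasQuasimodes_of_weyl ?_
    by_contra! hcon
    obtain ⟨Y, hY, δ, hδ, hb⟩ := hcon
    have hAs := pencil_symm hT l
    obtain ⟨hfin, c, hc, hcb⟩ := bounded_below_of_finite_codim hAs Y hδ (by
      intro g hg
      by_cases hg0 : g = 0
      · simp [hg0]
      · exact (hb g hg hg0).le)
    change FiniteDimensional ℝ (pencilKer T l) at hfin
    change ∀ x ∈ (pencilKer T l)ᗮ, _ at hcb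
    have hker : pencilKer T l ≠ ⊥ := by
      intro h0
      refine hl (bijective_of_bounded_below hAs hc fun x => hcb x ?_)
      rw [h0, Submodule.bot_orthogonal_eq_top]
      trivial
    refine hni ⟨?_, hker, hfin⟩
    set E := pencilKer T l with hE
    have hl1 : l ≠ 1 := by
      rintro rfl
      exact hker (pencilKer_one T)
    have hl1' : 1 - l ≠ 0 := sub_ne_zero.2 hl1.symm
    -- Within this radius the pencil changes by at most `c / 2`, so it stays bounded below by `c /
    -- 2` on the complement of the kernel. On the kernel it becomes the nonzero scalar `(l' - l) /
    -- (1 - l)`.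
    refine ⟨c / 2 / (‖T‖ + 1), by positivity, fun l' hl' hd => ?_⟩
    by_contra hne
    have hne' : 0 < |l' - l| := abs_pos.2 (sub_ne_zero.2 hne)
    rw [lt_div_iff₀ (by positivity)] at hd
    set c' := |l' - l| / |1 - l| with hc'
    have hc'pos : 0 < c' := div_pos hne' (abs_pos.2 hl1')
    refine hl' (bijective_of_bounded_below (pencil_symm hT l') (c := min c' (c / 2) / 2)
      (half_pos (lt_min hc'pos (half_pos hc))) fun x => ?_)
    have hdec : x = E.starProjection x + (x - E.starProjection x) := by abel
    have he := E.starProjection_apply_mem x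
    have hg := E.sub_starProjection_mem_orthogonal x
    generalize E.starProjection x = e at hdec he hg
    generalize x - e = g at hdec hg
    subst hdec
    have hTe : T e = (1 - l)⁻¹ • e := by
      have h1 := mem_pencilKer.1 he
      nth_rewrite 2 [h1]
      rw [smul_smul, inv_mul_cancel₀ hl1', one_smul]
    have hBe : pencil T l' e = ((l' - l) / (1 - l)) • e := by
      rw [pencil_apply, hTe, smul_smul, ← one_smul ℝ e, smul_smul, smul_smul, ← sub_smul]
      congr 1
      field_simp
      ring
    have hge : inner ℝ g e = 0 := by
      rw [real_inner_comm]; exact (Submodule.mem_orthogonal _ _).1 hg _ he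
    have hin : inner ℝ (pencil T l' e) (pencil T l' g) = 0 := by
      have h1 := pencil_symm hT l' e (pencil T l' g)
      have h2 := pencil_symm hT l' (pencil T l' e) g
      simp only [ContinuousLinearMap.coe_coe] at h1 h2
      rw [← h2, hBe, map_smul, hBe, inner_smul_left, inner_smul_left, real_inner_comm, hge]
      simp
    have hBg : c / 2 * ‖g‖ ≤ ‖pencil T l' g‖ := by
      have h1 : pencil T l' g = pencil T l g + (l' - l) • T g := by
        simp only [pencil_apply]; module
      have h2 := hcb g hg
      have h3 := T.le_opNorm g
      have h4 : ‖pencil T l g‖ ≤ ‖pencil T l' g‖ + |l' - l| * ‖T g‖ := by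
        have : pencil T l g = pencil T l' g - (l' - l) • T g := by rw [h1]; abel
        rw [this]
        refine (norm_sub_le _ _).trans ?_
        rw [norm_smul, Real.norm_eq_abs]
      have h5 : |l' - l| * ‖T g‖ ≤ c / 2 * ‖g‖ := by
        calc |l' - l| * ‖T g‖ ≤ |l' - l| * (‖T‖ * ‖g‖) := by gcongr
          _ ≤ (|l' - l| * (‖T‖ + 1)) * ‖g‖ := by
            nlinarith [mul_nonneg hne'.le (norm_nonneg g)]
          _ ≤ _ := by gcongr
      linarith
    have hBe' : c' * ‖e‖ = ‖pencil T l' e‖ := by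
      rw [hBe, norm_smul, Real.norm_eq_abs, abs_div]
    have h2 := norm_le_norm_add_left hin
    have h3 := norm_le_norm_add_right hin
    rw [← map_add] at h2 h3
    have h5 := norm_add_le e g
    have h6 := min_le_left c' (c / 2)
    have h7 := min_le_right c' (c / 2)
    have h8 : 0 < min c' (c / 2) := lt_min hc'pos (half_pos hc)
    nlinarith [norm_nonneg e, norm_nonneg g]
  · intro h
    refine ⟨mem_pencilSpectrum_of_hasQuasimodes fun ε hε => h 1 ε hε, ?_⟩
    rintro ⟨⟨δ, hδ, hiso⟩, hker, hfin⟩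
    have hl1 : l ≠ 1 := by
      rintro rfl
      exact hker (pencilKer_one T)
    have hl1' : 1 - l ≠ 0 := sub_ne_zero.2 hl1.symm
    set τ := (1 - l)⁻¹ with hτ
    have hτ0 : τ ≠ 0 := inv_ne_zero hl1'
    set A : V →L[ℝ] V := T - τ • 1 with hA
    have hAs : (A : V →ₗ[ℝ] V).IsSymmetric := by
      intro y z
      have := hT y z
      simp only [ContinuousLinearMap.coe_coe] at this ⊢
      simp [hA, inner_sub_left, inner_sub_right, inner_smul_left, inner_smul_right, this]
    have hAp : ∀ x, pencil T l x = -(1 - l) • A x := by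
      intro x
      simp only [pencil_apply, hA, sub_apply, smul_apply, one_apply_eq_self, smul_sub, smul_smul,
        neg_mul, hτ, mul_inv_cancel₀ hl1']
      module
    have hcont : ContinuousAt (fun t : ℝ => 1 - (τ + t)⁻¹) 0 := by
      refine continuousAt_const.sub (ContinuousAt.inv₀ (by fun_prop) (by simpa using hτ0))
    have hev : ∀ᶠ t in 𝓝 (0 : ℝ), |1 - (τ + t)⁻¹ - l| < δ ∧ τ + t ≠ 0 := by
      have h1 : ∀ᶠ t in 𝓝 (0 : ℝ), 1 - (τ + t)⁻¹ ∈ Metric.ball l δ := by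
        refine hcont ?_
        change Metric.ball l δ ∈ 𝓝 (1 - (τ + 0)⁻¹)
        rw [show 1 - (τ + 0)⁻¹ = l by simp [hτ]]
        exact Metric.ball_mem_nhds l hδ
      have h2 : ∀ᶠ t in 𝓝 (0 : ℝ), τ + t ≠ 0 := by
        refine ContinuousAt.eventually_ne (by fun_prop) (by simpa using hτ0)
      filter_upwards [h1, h2] with t ht1 ht2
      exact ⟨by rwa [Metric.mem_ball, Real.dist_eq] at ht1, ht2⟩
    obtain ⟨η, hη, hηb⟩ := Metric.eventually_nhds_iff.1 hev
    obtain ⟨c, hc, hcb⟩ := bounded_below_of_isolated hAs hη (by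
      intro t ht0 ht
      obtain ⟨h1, h2⟩ := hηb (y := t) (by simpa [Real.dist_eq] using ht)
      have h3 : Function.Bijective (pencil T (1 - (τ + t)⁻¹)) := by
        by_contra hnb
        have h4 := hiso _ hnb h1
        have h5 : τ + t = τ := by
          have e1 : (τ + t)⁻¹ = 1 - l := by linarith
          rw [← inv_inv (τ + t), e1]
        exact ht0 (by linarith)
      rw [hA, pencil_eq_smul T hl1 t h2]
      have h6 : -(τ + t) ≠ 0 := neg_ne_zero.2 h2
      exact (MulAction.bijective (Units.mk0 _ h6)).comp h3)
    have hkerA : LinearMap.ker (A : V →ₗ[ℝ] V) = pencilKer T l := by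
      ext x
      rw [pencilKer, LinearMap.mem_ker, LinearMap.mem_ker]
      simp only [ContinuousLinearMap.coe_coe]
      rw [hAp, smul_eq_zero_iff_right (neg_ne_zero.2 hl1')]
    rw [hkerA] at hcb
    -- One dimension more than the kernel forces a vector orthogonal to it, and the error is half of
    -- the lower bound `|1 - l| * c` which holds there.
    obtain ⟨X, hX, hk, hXb⟩ := h (Module.finrank ℝ (pencilKer T l) + 1) (|1 - l| * c / 2)
      (by positivity)
    obtain ⟨x, hxX, hxE, hx0⟩ := exists_mem_orthogonal_of_finrank_lt X (pencilKer T l) (by omega)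
    have h1 := hXb x hxX
    have h2 := hcb x hxE
    rw [hAp, norm_smul, Real.norm_eq_abs, abs_neg] at h1
    have h3 : 0 < |1 - l| := abs_pos.2 hl1'
    have h4 : 0 < ‖x‖ := norm_pos_iff.2 hx0
    have h5 : |1 - l| * (c * ‖x‖) ≤ |1 - l| * ‖A x‖ := by gcongr
    have h6 : 0 < |1 - l| * (c * ‖x‖) := by positivity
    nlinarith

end EssSpectrum

/-! ### Spans of eigenspaces and the counting measure -/

section Eigenspaces

variable {V : Type*} [NormedAddCommGroup V] [InnerProductSpace ℝ V]

/-- No exception at `l = 1`, where the kernel is trivial. -/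
theorem apply_of_mem_pencilKer {T : V →L[ℝ] V} {l : ℝ} {x : V} (hx : x ∈ pencilKer T l) :
    T x = (1 - l)⁻¹ • x := by
  by_cases hl : l = 1
  · subst hl
    rw [pencilKer_one, Submodule.mem_bot] at hx
    simp [hx]
  · have h1 := mem_pencilKer.1 hx
    nth_rewrite 2 [h1]
    rw [smul_smul, inv_mul_cancel₀ (sub_ne_zero.2 (Ne.symm hl)), one_smul]

theorem orthogonalFamily_pencilKer {T : V →L[ℝ] V} (hT : (T : V →ₗ[ℝ] V).IsSymmetric) :
    OrthogonalFamily ℝ (fun l => pencilKer T l) fun l => (pencilKer T l).subtypeₗᵢ := by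
  rintro l l' hne ⟨x, hx⟩ ⟨y, hy⟩
  change inner ℝ x y = 0
  have h1 := mem_pencilKer.1 hx
  have h2 := mem_pencilKer.1 hy
  have h3 := hT x y
  simp only [ContinuousLinearMap.coe_coe] at h3
  have h4 : inner ℝ x y = (1 - l) * inner ℝ (T x) y := by
    nth_rewrite 1 [h1]
    rw [inner_smul_left]; simp
  have h5 : inner ℝ x y = (1 - l') * inner ℝ (T x) y := by
    nth_rewrite 1 [h2]
    rw [inner_smul_right, h3]
  have h6 : (l' - l) * inner ℝ (T x) y = 0 := by linarith
  rcases mul_eq_zero.1 h6 with h7 | h7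
  · exact absurd (by linarith) hne
  · rw [h4, h7, mul_zero]

/-- The span of the kernels of the pencil at the points of `J`. -/
def pencilSpan (T : V →L[ℝ] V) (J : Set ℝ) : Submodule ℝ V := ⨆ l : J, pencilKer T l

theorem mem_pencilSpan {T : V →L[ℝ] V} {J : Set ℝ} {x : V} (hx : x ∈ pencilSpan T J) :
    ∃ (s : Finset J) (f : ∀ l : J, pencilKer T l), x = ∑ l ∈ s, (f l : V) := by
  obtain ⟨f, hf, rfl⟩ := (Submodule.mem_iSup_iff_exists_finsupp _ _).1 hx
  exact ⟨f.support, fun l => ⟨f l, hf l⟩, rfl⟩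

theorem norm_sum_pencilKer {T : V →L[ℝ] V} (hT : (T : V →ₗ[ℝ] V).IsSymmetric) {J : Set ℝ}
    (s : Finset J) (f : ∀ l : J, pencilKer T l) (c : ℝ → ℝ) :
    ‖∑ l ∈ s, c l • (f l : V)‖ ^ 2 = ∑ l ∈ s, c l ^ 2 * ‖(f l : V)‖ ^ 2 := by
  have h := ((orthogonalFamily_pencilKer hT).comp (Subtype.val_injective (p := (· ∈ J)))).norm_sum
    (fun l => c l • f l) s
  refine Eq.trans ?_ (h.trans ?_)
  · rfl
  · refine Finset.sum_congr rfl fun l _ => ?_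
    rw [norm_smul, mul_pow, Real.norm_eq_abs, sq_abs]
    rfl

/-- Functional calculus on finite sums of eigenvectors: by orthogonality, norms compare as the
multipliers do. The point `1` may be left out because its kernel is zero. -/
theorem norm_sum_pencilKer_le {T : V →L[ℝ] V} (hT : (T : V →ₗ[ℝ] V).IsSymmetric) {J : Set ℝ}
    (s : Finset J) (f : ∀ l : J, pencilKer T l) (c d : ℝ → ℝ)
    (h : ∀ l ∈ J, l ≠ 1 → |c l| ≤ |d l|) :
    ‖∑ l ∈ s, c l • (f l : V)‖ ≤ ‖∑ l ∈ s, d l • (f l : V)‖ := by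
  refine le_of_sq_le_sq ?_ (norm_nonneg _)
  rw [norm_sum_pencilKer hT, norm_sum_pencilKer hT]
  refine Finset.sum_le_sum fun l _ => ?_
  by_cases hl : (l : ℝ) = 1
  · have h1 : (f l : V) ∈ pencilKer T 1 := hl ▸ (f l).2
    rw [pencilKer_one, Submodule.mem_bot] at h1
    simp [h1]
  · exact mul_le_mul_of_nonneg_right (sq_le_sq.2 (h l l.2 hl)) (sq_nonneg _)

theorem apply_sum_pencilKer (T : V →L[ℝ] V) {J : Set ℝ} (s : Finset J)
    (f : ∀ l : J, pencilKer T l) :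
    T (∑ l ∈ s, (f l : V)) = ∑ l ∈ s, (1 - (l : ℝ))⁻¹ • (f l : V) := by
  rw [map_sum]
  exact Finset.sum_congr rfl fun l _ => apply_of_mem_pencilKer (f l).2

/-- The eigenvalues `(1 - l)⁻¹` of `T` that occur have modulus at least `(1 + |a| + |b|)⁻¹`. -/
theorem norm_le_of_mem_pencilSpan {T : V →L[ℝ] V} (hT : (T : V →ₗ[ℝ] V).IsSymmetric) {a b : ℝ}
    {x : V} (hx : x ∈ pencilSpan T (Set.Icc a b)) :
    ‖x‖ ≤ (1 + |a| + |b|) * ‖T x‖ := by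
  obtain ⟨s, f, rfl⟩ := mem_pencilSpan hx
  have hM : 0 < 1 + |a| + |b| := by positivity
  rw [apply_sum_pencilKer]
  have h1 := norm_sum_pencilKer_le hT s f (fun _ => 1)
    (fun l => (1 + |a| + |b|) * (1 - l)⁻¹) (by
      rintro l ⟨hla, hlb⟩ hl1
      rw [abs_one, abs_mul, abs_inv, abs_of_pos hM, ← div_eq_mul_inv,
        one_le_div (abs_pos.2 (sub_ne_zero.2 hl1.symm))]
      have h1 := neg_abs_le a
      have h2 := le_abs_self b
      have h3 := abs_nonneg a
      have h4 := abs_nonneg b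
      rw [abs_le]
      constructor <;> linarith)
  simp only [one_smul, mul_smul] at h1
  rwa [← Finset.smul_sum, norm_smul, Real.norm_of_nonneg hM.le] at h1

/-- On the eigenvectors of `l'` the pencil at `l` is `(l - l') (1 - l')⁻¹`. The bound is in terms of
`‖T x‖`, because the vectors `T x` will serve as quasi-modes. -/
theorem norm_sub_le_of_mem_pencilSpan {T : V →L[ℝ] V} (hT : (T : V →ₗ[ℝ] V).IsSymmetric)
    {l ε : ℝ} {x : V} (hx : x ∈ pencilSpan T (Set.Icc (l - ε) (l + ε))) :
    ‖x - (1 - l) • T x‖ ≤ ε * ‖T x‖ := by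
  obtain ⟨s, f, rfl⟩ := mem_pencilSpan hx
  by_cases hs : s = ∅
  · simp [hs]
  obtain ⟨l₀, hl₀⟩ := Finset.nonempty_iff_ne_empty.2 hs
  have hε : 0 ≤ ε := by have := l₀.2.1; have := l₀.2.2; linarith
  rw [apply_sum_pencilKer]
  have h1 := norm_sum_pencilKer_le hT s f (fun l' => 1 - (1 - l) * (1 - l')⁻¹)
    (fun l' => ε * (1 - l')⁻¹) (by
      rintro l' ⟨hla, hlb⟩ hl1
      have h2 : 1 - l' ≠ 0 := sub_ne_zero.2 hl1.symm
      have h3 : 1 - (1 - l) * (1 - l')⁻¹ = (l - l') * (1 - l')⁻¹ := by field_simp; ring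
      rw [h3, abs_mul, abs_mul, abs_of_nonneg hε]
      refine mul_le_mul_of_nonneg_right ?_ (abs_nonneg _)
      rw [abs_le]
      constructor <;> linarith)
  simp only [sub_smul, one_smul, mul_smul, Finset.sum_sub_distrib] at h1
  rw [← Finset.smul_sum, ← Finset.smul_sum, norm_smul, Real.norm_of_nonneg hε] at h1
  rwa [sub_smul, one_smul]

/-- Dimension bound for compact operators. -/
theorem exists_finrank_bound_of_compact {T : V →L[ℝ] V} (hc : IsCompactOperator T) {c : ℝ}
    (hcpos : 0 < c) :
    ∃ M : ℕ, ∀ X : Submodule ℝ V, FiniteDimensional ℝ X → (∀ x ∈ X, c * ‖x‖ ≤ ‖T x‖) →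
      Module.finrank ℝ X ≤ M := by
  have hK := hc.isCompact_closure_image_closedBall (f := (T : V →ₗ[ℝ] V)) 1
  obtain ⟨t, -, htf, htc⟩ := hK.totallyBounded.exists_subset (Metric.dist_mem_uniformity
    (half_pos hcpos))
  refine ⟨htf.toFinset.card, fun X hX hXb => ?_⟩
  let e := stdOrthonormalBasis ℝ X
  have hmem : ∀ i, ∃ y ∈ t, dist (T (e i)) y < c / 2 := by
    intro i
    have h1 : T (e i) ∈ closure ((T : V →ₗ[ℝ] V) '' Metric.closedBall 0 1) :=
      subset_closure ⟨e i, by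
        have := e.orthonormal.1 i
        simp only [mem_closedBall_zero_iff]
        rw [← Submodule.coe_norm, this], rfl⟩
    simpa using htc h1
  choose y hy hyd using hmem
  -- Images of two orthonormal vectors are at distance at least `c`, so they cannot share a point of
  -- the `c / 2`-net.
  have hinj : Function.Injective y := by
    intro i j hij
    by_contra hne
    have h1 : dist (T (e i)) (T (e j)) < c := by
      have := dist_triangle_right (T (e i)) (T (e j)) (y i)
      have h2 := hyd i
      have h3 := hyd j
      rw [← hij] at h3
      linarith
    have h2 := hXb _ (X.sub_mem (e i).2 (e j).2)
    have h3 : (1 : ℝ) ≤ ‖((e i : V) - e j)‖ := by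
      have h4 : ‖((e i : X) - e j)‖ ^ 2 = 2 := by
        rw [norm_sub_sq_real, e.orthonormal.1 i, e.orthonormal.1 j, e.orthonormal.2 hne]
        norm_num
      rw [← Submodule.coe_sub, ← Submodule.coe_norm]
      nlinarith [norm_nonneg ((e i : X) - e j)]
    rw [map_sub, ← dist_eq_norm, ← dist_eq_norm] at h2
    rw [← dist_eq_norm] at h3
    nlinarith
  have h1 : Fintype.card (Fin (Module.finrank ℝ X)) ≤ htf.toFinset.card := by
    rw [← Finset.card_univ]
    exact Finset.card_le_card_of_injOn y (fun i _ => by simpa using hy i) hinj.injOn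
  simpa using h1

theorem finiteDimensional_of_finrank_bound (U : Submodule ℝ V) (M : ℕ)
    (h : ∀ X ≤ U, FiniteDimensional ℝ X → Module.finrank ℝ X ≤ M) : FiniteDimensional ℝ U := by
  have h1 : Module.rank ℝ U ≤ M := by
    refine rank_le fun s hs => ?_
    have h2 : LinearIndependent ℝ (fun i : s => ((i : U) : V)) :=
      hs.map' U.subtype (Submodule.ker_subtype _)
    have h3 := finrank_span_eq_card h2
    rw [Fintype.card_coe] at h3
    rw [← h3]
    refine h _ (Submodule.span_le.2 ?_) (FiniteDimensional.span_of_finite ℝ (Set.finite_range _))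
    rintro _ ⟨i, rfl⟩
    exact (i : U).2
  exact Module.rank_lt_aleph0_iff.1 (h1.trans_lt (Cardinal.natCast_lt_aleph0))

theorem finiteDimensional_pencilSpan {T : V →L[ℝ] V} (hT : (T : V →ₗ[ℝ] V).IsSymmetric)
    (hc : IsCompactOperator T) (a b : ℝ) : FiniteDimensional ℝ (pencilSpan T (Set.Icc a b)) := by
  obtain ⟨M, hM⟩ := exists_finrank_bound_of_compact hc
    (c := (1 + |a| + |b|)⁻¹) (by positivity)
  refine finiteDimensional_of_finrank_bound _ M fun X hX hfin => hM X hfin fun x hx => ?_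
  rw [inv_mul_le_iff₀ (by positivity)]
  exact norm_le_of_mem_pencilSpan hT (hX hx)

theorem finrank_biSup_pencilKer {T : V →L[ℝ] V} (hT : (T : V →ₗ[ℝ] V).IsSymmetric)
    (s : Finset ℝ) (hfin : ∀ l ∈ s, FiniteDimensional ℝ (pencilKer T l)) :
    FiniteDimensional ℝ (⨆ l ∈ s, pencilKer T l : Submodule ℝ V) ∧
    Module.finrank ℝ (⨆ l ∈ s, pencilKer T l : Submodule ℝ V) =
      ∑ l ∈ s, Module.finrank ℝ (pencilKer T l) := by
  classical
  induction s using Finset.induction_on with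
  | empty =>
    rw [show (⨆ l ∈ (∅ : Finset ℝ), pencilKer T l) = ⊥ by simp]
    exact ⟨inferInstance, by simp⟩
  | insert a s ha ih =>
    obtain ⟨ih1, ih2⟩ := ih fun l hl => hfin l (Finset.mem_insert_of_mem hl)
    have h0 := hfin a (Finset.mem_insert_self _ _)
    rw [Finset.iSup_insert, Finset.sum_insert ha, ← ih2]
    refine ⟨inferInstance, ?_⟩
    have hd : Disjoint (pencilKer T a) (⨆ l ∈ s, pencilKer T l) := by
      refine ((orthogonalFamily_pencilKer hT).independent a).mono_right ?_
      refine iSup₂_le fun l hl => ?_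
      exact le_iSup₂_of_le l (fun h => ha (h ▸ hl)) le_rfl
    have h1 := Submodule.finrank_sup_add_finrank_inf_eq (pencilKer T a)
      (⨆ l ∈ s, pencilKer T l)
    rw [hd.eq_bot, finrank_bot] at h1
    omega

/-- The measure counting the singular points of the pencil with multiplicity. -/
noncomputable def pencilMeasure (T : V →L[ℝ] V) : Measure ℝ :=
  Measure.sum fun l : ℝ =>
    ((Cardinal.toENat (Module.rank ℝ (pencilKer T l)) : ℕ∞) : ℝ≥0∞) • Measure.dirac l

/-- The kernels are orthogonal and lie in a finite-dimensional span, so only finitely many in the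
interval are nontrivial and their dimensions add up. -/
theorem pencilMeasure_Icc {T : V →L[ℝ] V} (hT : (T : V →ₗ[ℝ] V).IsSymmetric)
    (hc : IsCompactOperator T) (a b : ℝ) :
    pencilMeasure T (Set.Icc a b) = Module.finrank ℝ (pencilSpan T (Set.Icc a b)) := by
  classical
  have hfd := finiteDimensional_pencilSpan hT hc a b
  have hle : ∀ l ∈ Set.Icc a b, pencilKer T l ≤ pencilSpan T (Set.Icc a b) := fun l hl =>
    le_iSup (fun l : Set.Icc a b => pencilKer T l) ⟨l, hl⟩
  have hfin : ∀ l ∈ Set.Icc a b, FiniteDimensional ℝ (pencilKer T l) := fun l hl =>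
    Submodule.finiteDimensional_of_le (hle l hl)
  have hfinite : {l | l ∈ Set.Icc a b ∧ pencilKer T l ≠ ⊥}.Finite := by
    by_contra hinf
    obtain ⟨s, hs, hcard⟩ := Set.Infinite.exists_subset_card_eq hinf
      (Module.finrank ℝ (pencilSpan T (Set.Icc a b)) + 1)
    obtain ⟨h1, h2⟩ := finrank_biSup_pencilKer hT s fun l hl => hfin l (hs hl).1
    have h3 : Module.finrank ℝ (⨆ l ∈ s, pencilKer T l : Submodule ℝ V) ≤
        Module.finrank ℝ (pencilSpan T (Set.Icc a b)) :=
      Submodule.finrank_mono (iSup₂_le fun l hl => hle l (hs hl).1)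
    have h4 : ∑ l ∈ s, 1 ≤ ∑ l ∈ s, Module.finrank ℝ (pencilKer T l) := by
      refine Finset.sum_le_sum fun l hl => ?_
      have := hfin l (hs hl).1
      exact Submodule.one_le_finrank_iff.2 (hs hl).2
    rw [Finset.sum_const, smul_eq_mul, mul_one] at h4
    omega
  set s := hfinite.toFinset with hs
  have hspan : pencilSpan T (Set.Icc a b) = ⨆ l ∈ s, pencilKer T l := by
    refine le_antisymm (iSup_le fun l => ?_) (iSup₂_le fun l hl => ?_)
    · by_cases h0 : pencilKer T l = ⊥
      · simp [h0]
      · exact le_iSup₂_of_le (l : ℝ) ((Set.Finite.mem_toFinset _).2 ⟨l.2, h0⟩) le_rfl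
    · exact hle l (by simp [hs] at hl; exact ⟨hl.1.1, hl.1.2⟩)
  rw [hspan, (finrank_biSup_pencilKer hT s fun l hl => hfin l (by
    simp [hs] at hl; exact ⟨hl.1.1, hl.1.2⟩)).2]
  rw [pencilMeasure, Measure.sum_apply _ measurableSet_Icc, tsum_eq_sum (s := s)]
  · push_cast
    refine Finset.sum_congr rfl fun l hl => ?_
    have hl' : l ∈ Set.Icc a b := by simp [hs] at hl; exact ⟨hl.1.1, hl.1.2⟩
    have := hfin l hl'
    rw [Pi.smul_apply, Measure.dirac_apply_of_mem hl', smul_eq_mul, mul_one,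
      ← Module.finrank_eq_rank, map_natCast, ENat.toENNReal_coe]
  · intro l hl
    by_cases hl' : l ∈ Set.Icc a b
    · have h0 : pencilKer T l = ⊥ := by
        by_contra h0
        exact hl (by simp only [hs, Set.Finite.mem_toFinset]; exact ⟨hl', h0⟩)
      rw [h0]
      simp
    · rw [Measure.coe_smul, Pi.smul_apply, Measure.dirac_apply' _ measurableSet_Icc]
      simp [hl']

end Eigenspaces

/-! ### Compact resolvents: the spectral theorem and a compactness criterion -/

section Compact

variable {V : Type*} [NormedAddCommGroup V] [InnerProductSpace ℝ V] [CompleteSpace V]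

/-- By the spectral theorem for compact operators, the complement of the spectral space of the
window is the closed span of the remaining eigenspaces of `T`. There the pencil multiplies by `1 -
(1 - l) τ`, which is at least `δ` in modulus. -/
theorem orthogonal_pencilSpan_le {T : V →L[ℝ] V} (hT : (T : V →ₗ[ℝ] V).IsSymmetric)
    (hc : IsCompactOperator T) {l r : ℝ} (hr : 0 < r) {x : V}
    (hx : x ∈ (pencilSpan T (Set.Icc (l - r) (l + r)))ᗮ) :
    r / (|1 - l| + r) * ‖x‖ ≤ ‖pencil T l x‖ := by
  set U := pencilSpan T (Set.Icc (l - r) (l + r)) with hU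
  set δ := r / (|1 - l| + r) with hδ
  have hden : 0 < |1 - l| + r := by positivity
  have hδ1 : δ ≤ 1 := by rw [hδ, div_le_one hden]; linarith [abs_nonneg (1 - l)]
  -- The eigenvalues of `T` not coming from the window. The value `0` belongs to them: the kernel of
  -- `T` corresponds to no `l'`, and Lean's `0⁻¹ = 0` must not assign it one.
  let I : Set ℝ := {τ | ¬ (τ ≠ 0 ∧ 1 - τ⁻¹ ∈ Set.Icc (l - r) (l + r))}
  let G : ℝ → Submodule ℝ V := fun τ => Module.End.eigenspace (T : V →ₗ[ℝ] V) τ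
  have hGfam : OrthogonalFamily ℝ (fun τ => G τ) fun τ => (G τ).subtypeₗᵢ :=
    hT.orthogonalFamily_eigenspaces
  have hGT : ∀ τ, ∀ y ∈ G τ, T y = τ • y := fun τ y hy => Module.End.mem_eigenspace_iff.1 hy
  have hGker : ∀ τ, τ ≠ 0 → G τ = pencilKer T (1 - τ⁻¹) := by
    intro τ hτ
    ext y
    rw [mem_pencilKer, sub_sub_cancel, Module.End.mem_eigenspace_iff]
    change T y = τ • y ↔ _
    constructor
    · intro h; rw [h, smul_smul, inv_mul_cancel₀ hτ, one_smul]
    · intro h; nth_rewrite 2 [h]; rw [smul_smul, mul_inv_cancel₀ hτ, one_smul]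
  let S : Submodule ℝ V := ⨆ τ : I, G τ
  have hfactor : ∀ τ ∈ I, δ ≤ |1 - (1 - l) * τ| := by
    intro τ hτ
    by_cases h0 : τ = 0
    · simpa [h0] using hδ1
    · have h1 : 1 - τ⁻¹ ∉ Set.Icc (l - r) (l + r) := fun h => hτ ⟨h0, h⟩
      have h2 : r < |τ⁻¹ - (1 - l)| := by
        by_contra! h3
        rw [abs_le] at h3
        exact h1 ⟨by linarith, by linarith⟩
      -- With `s = |τ⁻¹ - (1 - l)| > r` one has `|τ| ≥ 1 / (|1 - l| + s)`, and `s / (|1 - l| + s)`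
      -- increases with `s`.
      have h4 : 1 - (1 - l) * τ = (τ⁻¹ - (1 - l)) * τ := by field_simp
      have h5 : |τ⁻¹| ≤ |1 - l| + |τ⁻¹ - (1 - l)| := by
        have := abs_add_le (1 - l) (τ⁻¹ - (1 - l))
        rwa [add_sub_cancel] at this
      rw [h4, abs_mul, hδ, div_le_iff₀ hden]
      have h6 : |τ| * |τ⁻¹| = 1 := by rw [← abs_mul, mul_inv_cancel₀ h0, abs_one]
      have h7 : 0 < |τ| := abs_pos.2 h0
      have h8 : 1 ≤ |τ| * (|1 - l| + |τ⁻¹ - (1 - l)|) := le_of_eq_of_le h6.symm (by gcongr)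
      have h9 : r * |1 - l| ≤ |τ⁻¹ - (1 - l)| * |1 - l| := by gcongr
      nlinarith [mul_le_mul_of_nonneg_left h9 h7.le]
  have hSb : ∀ y ∈ S, δ * ‖y‖ ≤ ‖pencil T l y‖ := by
    intro y hy
    obtain ⟨f, hf, rfl⟩ := (Submodule.mem_iSup_iff_exists_finsupp _ _).1 hy
    have hfam := hGfam.comp (Subtype.val_injective (p := (· ∈ I)))
    have e1 : pencil T l (f.sum fun _ xi => xi) = ∑ τ ∈ f.support, (1 - (1 - l) * (τ : ℝ)) • f τ := by
      rw [Finsupp.sum, map_sum]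
      refine Finset.sum_congr rfl fun τ _ => ?_
      rw [pencil_apply, hGT τ _ (hf τ), smul_smul, sub_smul, one_smul]
    have n1 := hfam.norm_sum (fun τ => (⟨f τ, hf τ⟩ : G τ)) f.support
    have n2 := hfam.norm_sum (fun τ => (1 - (1 - l) * (τ : ℝ)) • (⟨f τ, hf τ⟩ : G τ)) f.support
    change ‖∑ τ ∈ f.support, f τ‖ ^ 2 = ∑ τ ∈ f.support, ‖f τ‖ ^ 2 at n1
    change ‖∑ τ ∈ f.support, (1 - (1 - l) * (τ : ℝ)) • f τ‖ ^ 2 =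
      ∑ τ ∈ f.support, ‖(1 - (1 - l) * (τ : ℝ)) • f τ‖ ^ 2 at n2
    have hδ0 : 0 ≤ δ := by positivity
    refine le_of_sq_le_sq ?_ (norm_nonneg _)
    rw [e1, n2, mul_pow, Finsupp.sum, n1, Finset.mul_sum]
    refine Finset.sum_le_sum fun τ _ => ?_
    rw [norm_smul, mul_pow, Real.norm_eq_abs]
    gcongr
    exact hfactor τ τ.2
  have hSU : S ≤ Uᗮ := by
    refine iSup_le fun τ => ?_
    intro y hy
    rw [Submodule.mem_orthogonal]
    intro u hu
    obtain ⟨f, hf, rfl⟩ := (Submodule.mem_iSup_iff_exists_finsupp _ _).1 hu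
    rw [Finsupp.sum, sum_inner]
    refine Finset.sum_eq_zero fun l' _ => ?_
    have h1 := hf l'
    by_cases hl1 : (l' : ℝ) = 1
    · rw [hl1, pencilKer_one, Submodule.mem_bot] at h1
      rw [h1, inner_zero_left]
    · have h2 : (1 - (l' : ℝ))⁻¹ ≠ 0 := inv_ne_zero (sub_ne_zero.2 (Ne.symm hl1))
      have h3 : f l' ∈ G (1 - (l' : ℝ))⁻¹ := by
        rw [hGker _ h2, inv_inv, sub_sub_cancel]; exact h1
      have hne : (1 - (l' : ℝ))⁻¹ ≠ (τ : ℝ) := by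
        intro h
        refine τ.2 ⟨h ▸ h2, ?_⟩
        rw [← h, inv_inv, sub_sub_cancel]
        exact l'.2
      exact hGfam hne ⟨_, h3⟩ ⟨y, hy⟩
  have hUS : (U ⊔ S)ᗮ = ⊥ := by
    rw [eq_bot_iff, ← ContinuousLinearMap.orthogonalComplement_iSup_eigenspaces_eq_bot hc hT]
    refine Submodule.orthogonal_le (iSup_le fun τ => ?_)
    by_cases hτ : τ ∈ I
    · exact le_sup_of_le_right (le_iSup (fun τ : I => G τ) ⟨τ, hτ⟩)
    · obtain ⟨h0, h1⟩ := not_not.1 hτ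
      refine le_sup_of_le_left ?_
      change G τ ≤ U
      rw [hGker τ h0]
      exact le_iSup (fun l' : Set.Icc (l - r) (l + r) => pencilKer T l') ⟨_, h1⟩
  have hclos : S.topologicalClosure ≤ Uᗮ :=
    S.topologicalClosure_minimal hSU U.isClosed_orthogonal
  have hcomp : CompleteSpace S.topologicalClosure :=
    S.isClosed_topologicalClosure.completeSpace_coe
  have hxS : x ∈ S.topologicalClosure := by
    have h1 := S.topologicalClosure.sub_starProjection_mem_orthogonal x
    have h2 : x - S.topologicalClosure.starProjection x ∈ (U ⊔ S)ᗮ := by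
      rw [← Submodule.inf_orthogonal]
      exact ⟨Uᗮ.sub_mem hx (hclos (Submodule.starProjection_apply_mem _ x)),
        Submodule.orthogonal_le S.le_topologicalClosure h1⟩
    rw [hUS, Submodule.mem_bot, sub_eq_zero] at h2
    rw [h2]
    exact Submodule.starProjection_apply_mem _ x
  have hclosed : IsClosed {y : V | δ * ‖y‖ ≤ ‖pencil T l y‖} :=
    isClosed_le (by fun_prop) (by fun_prop)
  exact closure_minimal hSb hclosed hxS

/-- Turns quasi-modes into eigenvalues: a surplus of quasi-modes would contain one orthogonal to the
spectral space of the window, where the pencil is bounded below by more than `ε`. -/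
theorem finrank_le_of_quasimodes {T : V →L[ℝ] V} (hT : (T : V →ₗ[ℝ] V).IsSymmetric)
    (hc : IsCompactOperator T) {l r ε : ℝ} (hr : 0 < r) (hε : ε < r / (|1 - l| + r))
    (X : Submodule ℝ V) [FiniteDimensional ℝ X] (hX : ∀ x ∈ X, ‖pencil T l x‖ ≤ ε * ‖x‖) :
    Module.finrank ℝ X ≤ Module.finrank ℝ (pencilSpan T (Set.Icc (l - r) (l + r))) := by
  by_contra! hlt
  have := finiteDimensional_pencilSpan hT hc (l - r) (l + r)
  obtain ⟨x, hxX, hxU, hx0⟩ := exists_mem_orthogonal_of_finrank_lt X _ hlt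
  have h1 := orthogonal_pencilSpan_le hT hc hr hxU
  have h2 := hX x hxX
  have h3 : 0 < ‖x‖ := norm_pos_iff.2 hx0
  nlinarith

/-- A positive operator is compact if the spaces on which it is large have bounded dimension. -/
theorem isCompactOperator_of_finrank_bound {T : V →L[ℝ] V} (hT : (T : V →ₗ[ℝ] V).IsSymmetric)
    (h0 : ∀ x, 0 ≤ inner ℝ (T x) x)
    (hdim : ∀ c > 0, ∃ M : ℕ, ∀ X : Submodule ℝ V, FiniteDimensional ℝ X →
      (∀ x ∈ X, c * ‖x‖ ^ 2 ≤ inner ℝ (T x) x) → Module.finrank ℝ X ≤ M) :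
    IsCompactOperator T := by
  classical
  have hcl : IsClosed {f : V →L[ℝ] V | IsCompactOperator f} := isClosed_setOfPred_isCompactOperator
  refine hcl.closure_subset (Metric.mem_closure_iff.2 fun c' hc' => ?_)
  obtain ⟨c, hc, hcc'⟩ : ∃ c : ℝ, 0 < c ∧ c < c' := ⟨c' / 2, by linarith, by linarith⟩
  obtain ⟨M, hM⟩ := hdim c hc
  let p : ℕ → Prop := fun n => ∃ X : Submodule ℝ V, FiniteDimensional ℝ X ∧
    (∀ x ∈ X, c * ‖x‖ ^ 2 ≤ inner ℝ (T x) x) ∧ Module.finrank ℝ X = n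
  have hp0 : p 0 := ⟨⊥, inferInstance, by simp, by simp⟩
  obtain ⟨X, hX, hXb, hXn⟩ : p (Nat.findGreatest p M) := Nat.findGreatest_spec (Nat.zero_le M) hp0
  have hmax : ∀ X' : Submodule ℝ V, FiniteDimensional ℝ X' →
      (∀ x ∈ X', c * ‖x‖ ^ 2 ≤ inner ℝ (T x) x) →
      Module.finrank ℝ X' ≤ Module.finrank ℝ X := by
    intro X' hX' hb
    rw [hXn]
    exact Nat.le_findGreatest (hM X' hX' hb) ⟨X', hX', hb, rfl⟩
  -- Here `X` has maximal dimension among the spaces where the form is at least `c`. Orthogonality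
  -- to `T X` as well removes the cross terms of the form, so a vector of `Yᗮ` with larger form
  -- could be adjoined to `X`.
  set Y := X ⊔ X.map (T : V →ₗ[ℝ] V) with hY
  have hsmall : ∀ g ∈ Yᗮ, inner ℝ (T g) g ≤ c * ‖g‖ ^ 2 := by
    intro g hg
    by_contra! hlt
    have hg0 : g ≠ 0 := by rintro rfl; simp at hlt
    have hgX : ∀ x ∈ X, inner ℝ x g = 0 := fun x hx =>
      (Submodule.mem_orthogonal _ _).1 hg _ (Submodule.mem_sup_left hx)
    have hgTX : ∀ x ∈ X, inner ℝ (T x) g = 0 := fun x hx =>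
      (Submodule.mem_orthogonal _ _).1 hg _ (Submodule.mem_sup_right ⟨x, hx, rfl⟩)
    have hd : X ⊓ Submodule.span ℝ {g} = ⊥ := by
      rw [Submodule.eq_bot_iff]
      rintro x ⟨hx, hxg⟩
      obtain ⟨t, rfl⟩ := Submodule.mem_span_singleton.1 hxg
      have h1 := hgX _ hx
      rw [inner_smul_left, real_inner_self_eq_norm_sq] at h1
      rcases mul_eq_zero.1 h1 with h1 | h1
      · simp only [conj_trivial] at h1; simp [h1]
      · exact absurd (norm_eq_zero.1 (pow_eq_zero_iff two_ne_zero |>.1 h1)) hg0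
    have h2 := Submodule.finrank_sup_add_finrank_inf_eq X (Submodule.span ℝ {g})
    rw [hd, finrank_bot, finrank_span_singleton hg0] at h2
    have h3 := hmax (X ⊔ Submodule.span ℝ {g}) inferInstance (by
      intro z hz
      obtain ⟨x, hx, y, hy, rfl⟩ := Submodule.mem_sup.1 hz
      obtain ⟨t, rfl⟩ := Submodule.mem_span_singleton.1 hy
      have e1 : inner ℝ (T g) x = 0 := by
        have := hT g x
        simp only [ContinuousLinearMap.coe_coe] at this
        rw [this, real_inner_comm]; exact hgTX x hx
      have e2 := hgTX x hx
      have e3 := hgX x hx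
      have e4 := hXb x hx
      rw [norm_add_sq_real, map_add, map_smul, inner_add_left, inner_add_right, inner_add_right]
      simp only [inner_smul_left, inner_smul_right, e1, e2, e3, norm_smul, Real.norm_eq_abs,
        mul_pow, sq_abs, conj_trivial]
      nlinarith [mul_le_mul_of_nonneg_left hlt.le (sq_nonneg t)])
    omega
  set Q : V →L[ℝ] V := Y.starProjection with hQ
  have hQc : IsCompactOperator Q := by
    have h1 : IsCompactOperator (Y.orthogonalProjectionOnto : V →L[ℝ] Y) :=
      isCompactOperator_of_locallyCompactSpace_dom _
    exact h1.clm_comp Y.subtypeL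
  set P : V →L[ℝ] V := 1 - Q with hP
  have hPs : (P : V →ₗ[ℝ] V).IsSymmetric := by
    intro y z
    have := Y.starProjection_isSymmetric y z
    simp only [ContinuousLinearMap.coe_coe] at this ⊢
    simp [hP, hQ, inner_sub_left, inner_sub_right, this]
  have hPmem : ∀ x, P x ∈ Yᗮ := fun x => Y.sub_starProjection_mem_orthogonal x
  have hPn : ∀ x, ‖P x‖ ≤ ‖x‖ := by
    intro x
    have h1 : inner ℝ (Q x) (P x) = 0 :=
      (Submodule.mem_orthogonal _ _).1 (hPmem x) _ (Y.starProjection_apply_mem x)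
    have h2 := norm_le_norm_add_right h1
    rwa [show Q x + P x = x by simp [hP]] at h2
  -- A compact operator; the remainder `P T P` is nonnegative with quadratic form at most `c`, hence
  -- of norm at most `c`, again by Cauchy–Schwarz.
  refine ⟨Q ∘L T + P ∘L (T ∘L Q), ?_, ?_⟩
  · exact (hQc.comp_clm T).add ((hQc.clm_comp T).clm_comp P)
  · have hSdef : T - (Q ∘L T + P ∘L (T ∘L Q)) = P ∘L (T ∘L P) := by
      ext x
      simp [hP]
      abel
    rw [dist_eq_norm, hSdef]
    refine (ContinuousLinearMap.opNorm_le_bound _ hc.le fun x => ?_).trans_lt hcc'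
    set S : V →L[ℝ] V := P ∘L (T ∘L P) with hS
    have hSin : ∀ y, inner ℝ (S y) y = inner ℝ (T (P y)) (P y) := fun y => hPs (T (P y)) y
    have hSs : (S : V →ₗ[ℝ] V).IsSymmetric := by
      intro y z
      have h1 := hPs (T (P y)) z
      have h2 := hT (P y) (P z)
      have h3 := hPs y (T (P z))
      simp only [ContinuousLinearMap.coe_coe] at h1 h2 h3 ⊢
      rw [hS]
      simp only [ContinuousLinearMap.comp_apply, h1, h2, h3]
    have hSb : ∀ y, inner ℝ (S y) y ≤ c * ‖y‖ ^ 2 := by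
      intro y
      rw [hSin]
      refine (hsmall _ (hPmem y)).trans ?_
      gcongr
      exact hPn y
    have h1 := inner_sq_le_of_nonneg hSs (fun y => by
      simp only [ContinuousLinearMap.coe_coe]; rw [hSin]; exact h0 _) x (S x)
    simp only [ContinuousLinearMap.coe_coe, real_inner_self_eq_norm_sq] at h1
    have h2 : inner ℝ (S x) x * inner ℝ (S (S x)) (S x) ≤ (c * ‖x‖ ^ 2) * (c * ‖S x‖ ^ 2) := by
      refine mul_le_mul (hSb x) (hSb _) ?_ (by positivity)
      rw [hSin]; exact h0 _
    by_cases hz : ‖S x‖ = 0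
    · rw [hz]; positivity
    · have h3 : 0 < ‖S x‖ ^ 2 := by positivity
      refine le_of_sq_le_sq ?_ (by positivity)
      refine le_of_mul_le_mul_right (a := ‖S x‖ ^ 2) ?_ h3
      nlinarith

end Compact

theorem isSymmetric_of_inner_eq {V H : Type*} [NormedAddCommGroup V] [InnerProductSpace ℝ V]
    [NormedAddCommGroup H] [InnerProductSpace ℝ H] {T : V →L[ℝ] V} {j : V →L[ℝ] H}
    (hT : ∀ x y, inner ℝ (T x) y = inner ℝ (j x) (j y)) : (T : V →ₗ[ℝ] V).IsSymmetric := by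
  intro x y
  simp only [ContinuousLinearMap.coe_coe]
  rw [hT, real_inner_comm, ← hT, real_inner_comm]

/-! ### The operator of a form and the resolvent on its form domain -/

section Realization

variable {E : Type*} [MeasurableSpace E] {V : Type*} [NormedAddCommGroup V]
  [InnerProductSpace ℝ V]

/-- The form `Q` is the Hilbert space `V`, included by `j` in `L²`: the inner product of `V` is the
energy plus the inner product of `L²`. -/
structure IsRealization (Q : EnergyForm E) (j : V →L[ℝ] Lp ℝ 2 Q.ref) : Prop where
  injective : Function.Injective j
  exists_dom : ∀ x, ∃ u ∈ Q.dom, j x =ᵐ[Q.ref] u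
  exists_lift : ∀ u ∈ Q.dom, ∃ x, j x =ᵐ[Q.ref] u
  energy_eq : ∀ x y : V, ∀ u ∈ Q.dom, ∀ v ∈ Q.dom, j x =ᵐ[Q.ref] u → j y =ᵐ[Q.ref] v →
    Q.energy u v = inner ℝ x y - inner ℝ (j x) (j y)

namespace IsRealization

variable {Q : EnergyForm E} {j : V →L[ℝ] Lp ℝ 2 Q.ref} (hj : IsRealization Q j)
include hj

theorem space_eq : Q.space = (LinearMap.range (j : V →ₗ[ℝ] Lp ℝ 2 Q.ref)).topologicalClosure := by
  unfold EnergyForm.space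
  congr 1
  refine le_antisymm (Submodule.span_le.2 ?_) ?_
  · rintro f ⟨u, hu, hfu⟩
    obtain ⟨x, hx⟩ := hj.exists_lift u hu
    exact ⟨x, Lp.ext (hx.trans hfu.symm)⟩
  · rintro _ ⟨x, rfl⟩
    obtain ⟨u, hu, hxu⟩ := hj.exists_dom x
    exact Submodule.subset_span ⟨u, hu, hxu⟩

theorem mem_space (x : V) : j x ∈ Q.space := by
  rw [hj.space_eq]
  exact Submodule.le_topologicalClosure _ ⟨x, rfl⟩

theorem isGenerator_iff {f h : Lp ℝ 2 Q.ref} :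
    Q.IsGenerator f h ↔ h ∈ Q.space ∧ ∃ x, f = j x ∧
      ∀ y, inner ℝ x y - inner ℝ (j x) (j y) = - inner ℝ h (j y) := by
  have hint : ∀ (y : V) (v : E → ℝ), j y =ᵐ[Q.ref] v →
      ∫ z, h z * v z ∂Q.ref = inner ℝ h (j y) := by
    intro y v hv
    rw [L2.inner_def]
    refine integral_congr_ae ?_
    filter_upwards [hv] with z hz
    rw [hz]
    simp [mul_comm]
  unfold EnergyForm.IsGenerator
  refine and_congr_right fun hh => ⟨?_, ?_⟩
  · rintro ⟨u, hu, hfu, hw⟩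
    obtain ⟨x, hx⟩ := hj.exists_lift u hu
    refine ⟨x, Lp.ext (hfu.trans hx.symm), fun y => ?_⟩
    obtain ⟨v, hv, hyv⟩ := hj.exists_dom y
    rw [← hj.energy_eq x y u hu v hv hx hyv, hw v hv, hint y v hyv]
  · rintro ⟨x, rfl, hw⟩
    obtain ⟨u, hu, hxu⟩ := hj.exists_dom x
    refine ⟨u, hu, hxu, fun v hv => ?_⟩
    obtain ⟨y, hy⟩ := hj.exists_lift v hv
    rw [hj.energy_eq x y u hu v hv hxu hy, hw y, hint y v hy]

variable {T : V →L[ℝ] V} (hT : ∀ x y, inner ℝ (T x) y = inner ℝ (j x) (j y))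
include hT

theorem isGenerator_smul_iff {f : Lp ℝ 2 Q.ref} {l : ℝ} :
    Q.IsGenerator f (l • f) ↔ ∃ x ∈ pencilKer T l, f = j x := by
  rw [hj.isGenerator_iff]
  have key : ∀ x : V, (∀ y, inner ℝ x y - inner ℝ (j x) (j y) = - inner ℝ (l • j x) (j y)) ↔
      x ∈ pencilKer T l := by
    intro x
    rw [mem_pencilKer]
    constructor
    · intro h
      refine ext_inner_right ℝ fun y => ?_
      have := h y
      rw [inner_smul_left, ← hT] at this
      rw [inner_smul_left]
      simp only [conj_trivial] at this ⊢
      linarith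
    · intro h y
      have h1 : inner ℝ x y = (1 - l) * inner ℝ (T x) y := by
        nth_rewrite 1 [h]; rw [inner_smul_left]; simp
      rw [h1, inner_smul_left, ← hT]
      simp only [conj_trivial]
      ring
  constructor
  · rintro ⟨-, x, rfl, hx⟩
    exact ⟨x, (key x).1 hx, rfl⟩
  · rintro ⟨x, hx, rfl⟩
    exact ⟨Submodule.smul_mem _ _ (hj.mem_space x), x, rfl, (key x).2 hx⟩

theorem eigenspace_eq (l : ℝ) :
    Q.eigenspace l = (pencilKer T l).map (j : V →ₗ[ℝ] Lp ℝ 2 Q.ref) := by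
  unfold EnergyForm.eigenspace
  refine le_antisymm (Submodule.span_le.2 ?_) ?_
  · intro f hf
    obtain ⟨x, hx, rfl⟩ := (hj.isGenerator_smul_iff hT).1 hf
    exact ⟨x, hx, rfl⟩
  · rintro _ ⟨x, hx, rfl⟩
    exact Submodule.subset_span ((hj.isGenerator_smul_iff hT).2 ⟨x, hx, rfl⟩)

theorem isEigenvalue_iff (l : ℝ) : Q.IsEigenvalue l ↔ pencilKer T l ≠ ⊥ := by
  unfold EnergyForm.IsEigenvalue
  rw [Submodule.ne_bot_iff]
  constructor
  · rintro ⟨f, hf, hg⟩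
    obtain ⟨x, hx, rfl⟩ := (hj.isGenerator_smul_iff hT).1 hg
    exact ⟨x, hx, by rintro rfl; simp at hf⟩
  · rintro ⟨x, hx, hx0⟩
    refine ⟨j x, fun h => hx0 (hj.injective (by rw [h, map_zero])), ?_⟩
    exact (hj.isGenerator_smul_iff hT).2 ⟨x, hx, rfl⟩

noncomputable def eigenspaceEquiv (l : ℝ) : pencilKer T l ≃ₗ[ℝ] Q.eigenspace l :=
  (Submodule.equivMapOfInjective (j : V →ₗ[ℝ] Lp ℝ 2 Q.ref) hj.injective (pencilKer T l)).trans
    (LinearEquiv.ofEq _ _ (hj.eigenspace_eq hT l).symm)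

theorem finiteDimensional_eigenspace_iff (l : ℝ) :
    FiniteDimensional ℝ (Q.eigenspace l) ↔ FiniteDimensional ℝ (pencilKer T l) :=
  ⟨fun _ => (hj.eigenspaceEquiv hT l).symm.finiteDimensional,
    fun _ => (hj.eigenspaceEquiv hT l).finiteDimensional⟩

theorem finrank_eigenspace (l : ℝ) :
    Module.finrank ℝ (Q.eigenspace l) = Module.finrank ℝ (pencilKer T l) :=
  (hj.eigenspaceEquiv hT l).finrank_eq.symm

variable [CompleteSpace V]

/-- If `z` represents `k`, that is `z = j* k`, then `(H - l) f = k` with `f = j x` reads `pencil T l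
x = -z`. Only such `z` occur as right-hand sides, so surjectivity of the pencil needs one more step.
-/
theorem spectrum_eq : Q.spectrum = pencilSpectrum T := by
  ext l
  refine not_congr ?_
  have hrep : ∀ k : Lp ℝ 2 Q.ref, ∃ z : V, ∀ y, inner ℝ z y = inner ℝ k (j y) := by
    intro k
    refine ⟨ContinuousLinearMap.adjoint j k, fun y => ?_⟩
    rw [ContinuousLinearMap.adjoint_inner_left]
  have key : ∀ k ∈ Q.space, ∀ z : V, (∀ y, inner ℝ z y = inner ℝ k (j y)) →
      ∀ f, (∃ h, Q.IsGenerator f h ∧ h - l • f = k) ↔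
        ∃ x, f = j x ∧ pencil T l x = -z := by
    intro k hk z hz f
    have aux : ∀ x : V, (∀ y, inner ℝ x y - inner ℝ (j x) (j y) =
        - inner ℝ (k + l • j x) (j y)) ↔ pencil T l x = -z := by
      intro x
      have e : ∀ y, inner ℝ (pencil T l x) y - inner ℝ (-z) y =
          (inner ℝ x y - inner ℝ (j x) (j y)) - (- inner ℝ (k + l • j x) (j y)) := by
        intro y
        rw [pencil_apply, inner_sub_left, inner_smul_left, inner_neg_left, hz, hT, inner_add_left,
          inner_smul_left]
        simp only [conj_trivial]
        ring
      constructor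
      · intro h
        refine ext_inner_right ℝ fun y => ?_
        have := e y
        rw [h y] at this
        linarith
      · intro h y
        have := e y
        rw [h] at this
        linarith
    constructor
    · rintro ⟨h, hg, rfl⟩
      obtain ⟨-, x, rfl, hx⟩ := hj.isGenerator_iff.1 hg
      refine ⟨x, rfl, (aux x).1 fun y => ?_⟩
      rw [sub_add_cancel]
      exact hx y
    · rintro ⟨x, rfl, hx⟩
      refine ⟨k + l • j x, hj.isGenerator_iff.2 ⟨?_, x, rfl, (aux x).2 hx⟩, by abel⟩
      exact Submodule.add_mem _ hk (Submodule.smul_mem _ _ (hj.mem_space x))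
  constructor
  · intro h
    constructor
    · rw [injective_iff_map_eq_zero]
      intro x hx
      obtain ⟨f, -, huniq⟩ := h 0 (Submodule.zero_mem _)
      have h1 := huniq (j x) ((key 0 (Submodule.zero_mem _) 0 (by simp) _).2
        ⟨x, rfl, by simp [hx]⟩)
      have h2 := huniq (j 0) ((key 0 (Submodule.zero_mem _) 0 (by simp) _).2 ⟨0, rfl, by simp⟩)
      exact hj.injective (h1.trans h2.symm)
    · intro y
      have hk : -(j y) ∈ Q.space := Submodule.neg_mem _ (hj.mem_space y)
      obtain ⟨f, hf, -⟩ := h _ hk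
      obtain ⟨x, -, hx⟩ := (key _ hk (-(T y)) (by
        intro w; rw [inner_neg_left, inner_neg_left, hT]) f).1 hf
      rw [neg_neg] at hx
      -- The equation is solvable for the right-hand side `T y`; the pencil maps `y` to `y - (1 - l)
      -- T y`, and adding `(1 - l) x` restores `y`.
      refine ⟨y + (1 - l) • x, ?_⟩
      rw [map_add, map_smul, hx, pencil_apply]
      abel
  · intro hb k hk
    obtain ⟨z, hz⟩ := hrep k
    obtain ⟨x, hx⟩ := hb.2 (-z)
    refine ⟨j x, (key k hk z hz _).2 ⟨x, rfl, hx⟩, fun f hf => ?_⟩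
    obtain ⟨x', rfl, hx'⟩ := (key k hk z hz _).1 hf
    rw [hb.1 (hx'.trans hx.symm)]

theorem essSpectrum_eq : Q.essSpectrum = pencilEssSpectrum T := by
  unfold EnergyForm.essSpectrum pencilEssSpectrum
  rw [hj.spectrum_eq hT]
  ext l
  simp only [Set.mem_ofPred_eq, hj.isEigenvalue_iff hT, hj.finiteDimensional_eigenspace_iff hT]

end IsRealization

end Realization

theorem IsRealization.countingMeasure_eq {V : Type} [NormedAddCommGroup V] [InnerProductSpace ℝ V]
    {E : Type} [MeasurableSpace E] {Q : EnergyForm E} {j : V →L[ℝ] Lp ℝ 2 Q.ref}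
    (hj : IsRealization Q j) {T : V →L[ℝ] V}
    (hT : ∀ x y, inner ℝ (T x) y = inner ℝ (j x) (j y)) :
    Q.countingMeasure = pencilMeasure T := by
  unfold EnergyForm.countingMeasure pencilMeasure
  congr 1
  ext1 l
  rw [(hj.eigenspaceEquiv hT l).rank_eq]

namespace SelfSimilarSet

variable {d N : ℕ} (S : SelfSimilarSet d N)

/-! ### Iterated maps -/

/-- `Ψ_{τ_{n-1}} ∘ ⋯ ∘ Ψ_{τ_0}`. -/
noncomputable def iter (τ : ℕ → Fin N) : ℕ → (EuclideanSpace ℝ (Fin d) ≃ᵈ EuclideanSpace ℝ (Fin d))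
  | 0 => 1
  | n + 1 => S.Ψ (τ n) * iter τ n

@[simp] theorem iter_zero (τ : ℕ → Fin N) : S.iter τ 0 = 1 := rfl

theorem iter_succ (τ : ℕ → Fin N) (n : ℕ) : S.iter τ (n + 1) = S.Ψ (τ n) * S.iter τ n := rfl

theorem iter_succ_apply (τ : ℕ → Fin N) (n : ℕ) (x : EuclideanSpace ℝ (Fin d)) :
    S.iter τ (n + 1) x = S.Ψ (τ n) (S.iter τ n x) := rfl

theorem iter_congr {τ τ' : ℕ → Fin N} {n : ℕ} (h : ∀ j < n, τ j = τ' j) :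
    S.iter τ n = S.iter τ' n := by
  induction n with
  | zero => rfl
  | succ n ih =>
    rw [iter_succ, iter_succ, ih fun j hj => h j (by omega), h n (by omega)]

@[simp] theorem blowUp_zero (ω : ℕ → Fin N) : S.blowUp ω 0 = 1 := by simp [blowUp]

theorem blowUp_succ (ω : ℕ → Fin N) (n : ℕ) :
    S.blowUp ω (n + 1) = S.blowUp ω n * (S.Ψ (ω n))⁻¹ := by
  simp only [blowUp, List.ofFn_succ', List.prod_concat]
  rfl

theorem blowUp_eq_inv (ω : ℕ → Fin N) (n : ℕ) : S.blowUp ω n = (S.iter ω n)⁻¹ := by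
  induction n with
  | zero => simp
  | succ n ih => rw [blowUp_succ, iter_succ, mul_inv_rev, ih]

/-- A word applies its first letter last, whereas `iter` applies the letter of largest index last;
hence the reversal. -/
theorem wordMap_eq_iter (τ : ℕ → Fin N) (n : ℕ) :
    S.wordMap (fun k : Fin n => τ (n - 1 - k)) = S.iter τ n := by
  induction n with
  | zero => simp [wordMap]
  | succ n ih =>
    rw [iter_succ, ← ih]
    simp only [wordMap, List.ofFn_succ, List.prod_cons]
    congr 1
    congr 1
    refine congrArg List.ofFn (funext fun k => ?_)
    congr 2
    simp only [Fin.val_succ]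
    omega

theorem exists_ratio : ∃ R : ℝ, 0 ≤ R ∧ R < 1 ∧
    ∀ i x y, dist (S.Ψ i x) (S.Ψ i y) ≤ R * dist x y := by
  choose r hr hd using S.contracting
  obtain ⟨⟨M, hM⟩, hle⟩ := Finite.exists_le (fun i => (⟨max (r i) 0, max_lt (hr i) one_pos⟩ :
    Set.Iio (1 : ℝ)))
  refine ⟨max M 0, le_max_right _ _, max_lt hM one_pos, fun i x y => ?_⟩
  rw [hd]
  have h1 : max (r i) 0 ≤ M := hle i
  exact mul_le_mul_of_nonneg_right ((le_max_left _ _).trans (h1.trans (le_max_left _ _)))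
    dist_nonneg

theorem dist_iter_le {R : ℝ} (hR : 0 ≤ R)
    (h : ∀ i x y, dist (S.Ψ i x) (S.Ψ i y) ≤ R * dist x y) (τ : ℕ → Fin N) (n : ℕ)
    (x y : EuclideanSpace ℝ (Fin d)) :
    dist (S.iter τ n x) (S.iter τ n y) ≤ R ^ n * dist x y := by
  induction n with
  | zero => simp
  | succ n ih =>
    rw [iter_succ_apply, iter_succ_apply]
    refine (h _ _ _).trans ?_
    rw [pow_succ']
    nlinarith

theorem iter_mem (τ : ℕ → Fin N) (n : ℕ) {x : EuclideanSpace ℝ (Fin d)} (hx : x ∈ S.X) :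
    S.iter τ n x ∈ S.X := by
  induction n with
  | zero => simpa
  | succ n ih => exact S.map_mem _ ih

/-- Iterating `Ψ i` from any point of `X` converges to its fixed point, and `X` is closed. -/
theorem F_subset {p : EuclideanSpace ℝ (Fin d)} (hp : p ∈ S.F) : p ∈ S.X := by
  obtain ⟨i, hi⟩ := S.fixed_of_mem p hp
  obtain ⟨R, hR0, hR1, hR⟩ := S.exists_ratio
  obtain ⟨x, hx⟩ := S.isConnected.nonempty
  have hfix : ∀ n, S.iter (fun _ => i) n p = p := by
    intro n
    induction n with
    | zero => rfl
    | succ n ih => rw [iter_succ_apply, ih, hi]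
  refine S.isCompact.isClosed.mem_of_tendsto (f := fun n => S.iter (fun _ => i) n x)
    (b := atTop) ?_ (Eventually.of_forall fun n => S.iter_mem _ n hx)
  rw [tendsto_iff_dist_tendsto_zero]
  refine squeeze_zero (fun n => dist_nonneg) (fun n => ?_)
    (by simpa using (tendsto_pow_atTop_nhds_zero_of_lt_one hR0 hR1).mul_const (dist x p))
  have := S.dist_iter_le hR0 hR (fun _ => i) n x p
  rwa [hfix] at this

/-- The image is fixed by some `Ψ j`. If `j = i`, then `x` is that fixed point; otherwise the image
lies in two different cells, which meet only in images of `F`. -/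
theorem mem_F_of_map_mem_F {i : Fin N} {x : EuclideanSpace ℝ (Fin d)} (hx : x ∈ S.X)
    (h : S.Ψ i x ∈ S.F) : x ∈ S.F := by
  obtain ⟨j, hj⟩ := S.fixed_of_mem _ h
  by_cases hij : i = j
  · subst hij
    rwa [(S.Ψ i).injective hj] at h
  · have h1 : S.Ψ i x ∈ S.Ψ i '' S.X ∩ S.Ψ j '' S.X := ⟨⟨x, hx, rfl⟩, ⟨_, S.F_subset h, hj⟩⟩
    rw [S.inter_cells i j hij] at h1
    obtain ⟨⟨y, hy, hyx⟩, -⟩ := h1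
    rwa [(S.Ψ i).injective hyx] at hy

theorem mem_F_of_iter_mem_F {τ : ℕ → Fin N} {k n : ℕ} (hkn : k ≤ n)
    {x : EuclideanSpace ℝ (Fin d)} (hx : x ∈ S.X) (h : S.iter τ n x ∈ S.F) :
    S.iter τ k x ∈ S.F := by
  induction n, hkn using Nat.le_induction with
  | base => exact h
  | succ n hn ih => exact ih (S.mem_F_of_map_mem_F (S.iter_mem τ n hx) h)

/-- Common outer letters are peeled off. At the outermost disagreement two different cells meet,
which puts the point in `F`, and membership in `F` passes down to the inner letters. -/
theorem iter_mem_F_of_iter_eq {τ τ' : ℕ → Fin N} {n j m : ℕ} (hnj : n ≤ j) (hjm : j < m)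
    (hne : τ j ≠ τ' j) {x y : EuclideanSpace ℝ (Fin d)} (hx : x ∈ S.X) (hy : y ∈ S.X)
    (h : S.iter τ m x = S.iter τ' m y) : S.iter τ n x ∈ S.F := by
  induction m with
  | zero => omega
  | succ m ih =>
    rw [iter_succ_apply, iter_succ_apply] at h
    by_cases hm : τ m = τ' m
    · rw [hm] at h
      refine ih ?_ ((S.Ψ _).injective h)
      rcases Nat.lt_succ_iff_lt_or_eq.1 hjm with h1 | rfl
      · exact h1
      · exact absurd hm hne
    · have h1 : S.Ψ (τ m) (S.iter τ m x) ∈ S.Ψ (τ m) '' S.X ∩ S.Ψ (τ' m) '' S.X :=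
        ⟨⟨_, S.iter_mem τ m hx, rfl⟩, ⟨_, S.iter_mem τ' m hy, h.symm⟩⟩
      rw [S.inter_cells _ _ hm] at h1
      obtain ⟨⟨z, hz, hzx⟩, -⟩ := h1
      rw [(S.Ψ _).injective hzx] at hz
      exact S.mem_F_of_iter_mem_F (by omega) hx hz

end SelfSimilarSet

/-! ### Cells of the blow-up -/

/-- The cells of the blow-up `ω`, coded by the sequences that end like `ω`. -/
def Cell {N : ℕ} (ω : ℕ → Fin N) : Type := {τ : ℕ → Fin N // ∃ n, ∀ j ≥ n, τ j = ω j}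

namespace Cell

variable {d N : ℕ} {ω : ℕ → Fin N}

/-- The cells contained in the `n`-th stage of the blow-up. -/
def upTo (ω : ℕ → Fin N) (n : ℕ) : Set (Cell ω) := {τ | ∀ j ≥ n, τ.1 j = ω j}

theorem upTo_mono {m n : ℕ} (h : m ≤ n) : upTo ω m ⊆ upTo ω n :=
  fun _ hτ j hj => hτ j (h.trans hj)

/-- The stage of a cell. -/
noncomputable def level (τ : Cell ω) : ℕ := τ.2.choose

theorem mem_upTo_level (τ : Cell ω) : τ ∈ upTo ω τ.level := τ.2.choose_spec

theorem exists_mem_upTo (τ τ' : Cell ω) : ∃ n, τ ∈ upTo ω n ∧ τ' ∈ upTo ω n :=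
  ⟨max τ.level τ'.level, upTo_mono (le_max_left _ _) τ.mem_upTo_level,
    upTo_mono (le_max_right _ _) τ'.mem_upTo_level⟩

/-- The sequence that is `w` (read backwards) below `n` and `ω` from `n` on. -/
def ofWord (ω : ℕ → Fin N) {n : ℕ} (w : Fin n → Fin N) : Cell ω :=
  ⟨fun j => if h : j < n then w ⟨n - 1 - j, by omega⟩ else ω j, n, fun j hj => by
    simp [not_lt.2 hj]⟩

theorem ofWord_mem {n : ℕ} (w : Fin n → Fin N) : ofWord ω w ∈ upTo ω n := fun j hj => by
  simp [ofWord, not_lt.2 hj]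

theorem ofWord_apply {n : ℕ} (w : Fin n → Fin N) (k : Fin n) :
    (ofWord ω w).1 (n - 1 - k) = w k := by
  have h : n - 1 - (k : ℕ) < n := by omega
  simp only [ofWord, h, dite_true]
  congr 1
  ext
  simp only
  omega

theorem ofWord_injective {n : ℕ} :
    Function.Injective (ofWord ω : (Fin n → Fin N) → Cell ω) := by
  intro w w' h
  ext1 k
  rw [← ofWord_apply (ω := ω) w k, h, ofWord_apply]

theorem exists_ofWord {n : ℕ} {τ : Cell ω} (h : τ ∈ upTo ω n) :
    ofWord ω (fun k : Fin n => τ.1 (n - 1 - k)) = τ := by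
  refine Subtype.ext (funext fun j => ?_)
  by_cases hj : j < n
  · simp only [ofWord, hj, dite_true]
    rw [show n - 1 - (n - 1 - j) = j by omega]
  · simp only [ofWord, hj, dite_false]
    exact (h j (not_lt.1 hj)).symm

open Classical in
/-- The finite set of the cells of the `n`-th stage. -/
noncomputable def stage (ω : ℕ → Fin N) (n : ℕ) : Finset (Cell ω) :=
  Finset.univ.image (ofWord ω : (Fin n → Fin N) → Cell ω)

theorem mem_stage {n : ℕ} {τ : Cell ω} : τ ∈ stage ω n ↔ τ ∈ upTo ω n := by
  classical
  simp only [stage, Finset.mem_image, Finset.mem_univ, true_and]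
  exact ⟨by rintro ⟨w, rfl⟩; exact ofWord_mem w, fun h => ⟨_, exists_ofWord h⟩⟩

theorem coe_stage (n : ℕ) : (stage ω n : Set (Cell ω)) = upTo ω n :=
  Set.ext fun _ => mem_stage

theorem sum_stage {M : Type*} [AddCommMonoid M] (n : ℕ) (f : Cell ω → M) :
    ∑ τ ∈ stage ω n, f τ = ∑ w : Fin n → Fin N, f (ofWord ω w) := by
  classical
  rw [stage, Finset.sum_image fun _ _ _ _ h => ofWord_injective h]

theorem stage_mono : Monotone (stage ω) := fun _ _ h _ hτ =>
  mem_stage.2 (upTo_mono h (mem_stage.1 hτ))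

theorem tendsto_stage : Tendsto (stage ω) atTop atTop :=
  tendsto_atTop_finset_of_monotone stage_mono fun τ => ⟨τ.level, mem_stage.2 τ.mem_upTo_level⟩

instance : Countable (Cell ω) := by
  have h : (Set.univ : Set (Cell ω)) = ⋃ n, (stage ω n : Set (Cell ω)) := by
    ext τ
    simp only [Set.mem_univ, Set.mem_iUnion, true_iff]
    exact ⟨τ.level, mem_stage.2 τ.mem_upTo_level⟩
  rw [← Set.countable_univ_iff, h]
  exact Set.countable_iUnion fun n => (stage ω n).countable_toSet

/-- The cell `ω` itself, i.e. the set `X`. -/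
def root (ω : ℕ → Fin N) : Cell ω := ⟨ω, 0, fun _ _ => rfl⟩

/-- The cell corresponding to `τ` in the copy of the `n`-th stage given by `v`. -/
def splice (n : ℕ) (v τ : Cell ω) : Cell ω :=
  ⟨fun j => if j < n then τ.1 j else v.1 j, max n v.level, fun j hj => by
    have h1 : ¬ j < n := by have := le_max_left n v.level; omega
    simp only [h1, if_false]
    exact v.mem_upTo_level j ((le_max_right _ _).trans hj)⟩

theorem splice_of_lt {n : ℕ} (v τ : Cell ω) {j : ℕ} (h : j < n) :
    (splice n v τ).1 j = τ.1 j := by simp [splice, h]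

theorem splice_of_le {n : ℕ} (v τ : Cell ω) {j : ℕ} (h : n ≤ j) :
    (splice n v τ).1 j = v.1 j := by simp [splice, not_lt.2 h]

theorem splice_mem {n k : ℕ} (hnk : n ≤ k) {v : Cell ω} (hv : v ∈ upTo ω k) (τ : Cell ω) :
    splice n v τ ∈ upTo ω k := fun j hj => by
  rw [splice_of_le v τ (hnk.trans hj)]
  exact hv j hj

/-- The similitude sending `X` to the cell `τ`. -/
noncomputable def map (S : SelfSimilarSet d N) (τ : Cell ω) :
    EuclideanSpace ℝ (Fin d) ≃ᵈ EuclideanSpace ℝ (Fin d) :=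
  S.blowUp ω τ.level * S.iter τ.1 τ.level

variable (S : SelfSimilarSet d N)

theorem map_eq_aux {τ : Cell ω} {m n : ℕ} (hmn : m ≤ n) (h : τ ∈ upTo ω m) :
    S.blowUp ω n * S.iter τ.1 n = S.blowUp ω m * S.iter τ.1 m := by
  induction n, hmn using Nat.le_induction with
  | base => rfl
  | succ n hn ih =>
    rw [S.blowUp_succ, S.iter_succ, h n hn, ← ih]
    group

theorem map_eq {τ : Cell ω} {n : ℕ} (h : τ ∈ upTo ω n) :
    τ.map S = S.blowUp ω n * S.iter τ.1 n := by
  rcases le_total n τ.level with h1 | h1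
  · rw [map, map_eq_aux S h1 h]
  · rw [map, map_eq_aux S h1 τ.mem_upTo_level]

theorem map_apply {τ : Cell ω} {n : ℕ} (h : τ ∈ upTo ω n) (x : EuclideanSpace ℝ (Fin d)) :
    τ.map S x = S.blowUp ω n (S.iter τ.1 n x) := by
  rw [map_eq S h]
  rfl

theorem map_mem_boundary_iff {τ : Cell ω} {n : ℕ} (h : τ ∈ upTo ω n)
    {x : EuclideanSpace ℝ (Fin d)} : τ.map S x ∈ S.boundary ω n ↔ S.iter τ.1 n x ∈ S.F := by
  rw [map_apply S h, SelfSimilarSet.boundary, (S.blowUp ω n).injective.mem_set_image]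
  rfl

/-- Two cells that do not belong to the same copy of the `n`-th stage meet at points that are
boundary points of these copies. -/
theorem iter_mem_F {τ τ' : Cell ω} {n j : ℕ} (hj : n ≤ j) (hne : τ.1 j ≠ τ'.1 j)
    {x y : EuclideanSpace ℝ (Fin d)} (hx : x ∈ S.X) (hy : y ∈ S.X)
    (h : τ.map S x = τ'.map S y) : S.iter τ.1 n x ∈ S.F := by
  obtain ⟨m, hm, hm'⟩ := exists_mem_upTo τ τ'
  rw [map_apply S hm, map_apply S hm'] at h
  refine S.iter_mem_F_of_iter_eq hj ?_ hne hx hy ((S.blowUp ω m).injective h)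
  by_contra hjm
  exact hne ((hm j (not_lt.1 hjm)).trans (hm' j (not_lt.1 hjm)).symm)

theorem mem_F_of_map_eq {τ τ' : Cell ω} (hne : τ ≠ τ')
    {x y : EuclideanSpace ℝ (Fin d)} (hx : x ∈ S.X) (hy : y ∈ S.X)
    (h : τ.map S x = τ'.map S y) : x ∈ S.F := by
  obtain ⟨j, hj⟩ : ∃ j, τ.1 j ≠ τ'.1 j := by
    by_contra! hall
    exact hne (Subtype.ext (funext hall))
  exact iter_mem_F S (Nat.zero_le j) hj hx hy h

/-- Boundary points that are left behind do not return, because membership in `F` pulls back along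
the letters between `n` and `m`. -/
theorem map_mem_boundary_of_le {τ : Cell ω} {n m : ℕ} (h : τ ∈ upTo ω n) (hnm : n ≤ m)
    {x : EuclideanSpace ℝ (Fin d)} (hx : x ∈ S.X) (hb : τ.map S x ∈ S.boundary ω m) :
    τ.map S x ∈ S.boundary ω n := by
  rw [map_mem_boundary_iff S (upTo_mono hnm h)] at hb
  rw [map_mem_boundary_iff S h]
  exact S.mem_F_of_iter_mem_F hnm hx hb

theorem mem_F_of_map_mem_boundary {τ : Cell ω} {n : ℕ} (h : τ ∈ upTo ω n)
    {x : EuclideanSpace ℝ (Fin d)} (hx : x ∈ S.X) (hb : τ.map S x ∈ S.boundary ω n) :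
    x ∈ S.F :=
  S.mem_F_of_iter_mem_F (Nat.zero_le n) hx ((map_mem_boundary_iff S h).1 hb)

theorem map_mem_boundary_of_outside {τ τ' : Cell ω} {n : ℕ} (h : τ ∈ upTo ω n)
    (h' : τ' ∉ upTo ω n) {x y : EuclideanSpace ℝ (Fin d)} (hx : x ∈ S.X) (hy : y ∈ S.X)
    (he : τ.map S x = τ'.map S y) : τ.map S x ∈ S.boundary ω n := by
  rw [map_mem_boundary_iff S h]
  obtain ⟨j, hj, hne⟩ : ∃ j ≥ n, τ'.1 j ≠ ω j := by
    by_contra! hall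
    exact h' hall
  exact iter_mem_F S hj (by rw [h j hj]; exact hne.symm) hx hy he

theorem map_mem_boundary_of_infty {τ : Cell ω} {n : ℕ} (h : τ ∈ upTo ω n)
    {x : EuclideanSpace ℝ (Fin d)} (hx : x ∈ S.X) (hb : τ.map S x ∈ S.boundaryInfty ω) :
    τ.map S x ∈ S.boundary ω n := by
  obtain ⟨m, hm, hmb⟩ := Set.mem_iUnion₂.1 (Set.mem_iInter.1 hb n)
  exact map_mem_boundary_of_le S h hm hx hmb

theorem mem_F_of_map_mem_boundaryInfty {τ : Cell ω}
    {x : EuclideanSpace ℝ (Fin d)} (hx : x ∈ S.X) (hb : τ.map S x ∈ S.boundaryInfty ω) :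
    x ∈ S.F :=
  mem_F_of_map_mem_boundary S τ.mem_upTo_level hx
    (map_mem_boundary_of_infty S τ.mem_upTo_level hx hb)

/-- The boundary point is the vertex `p = Ψ i p` of the corner cell all of whose letters below `n`
are `i`. -/
theorem exists_map_eq {n : ℕ} {z : EuclideanSpace ℝ (Fin d)} (hz : z ∈ S.boundary ω n) :
    ∃ τ ∈ upTo ω n, ∃ p ∈ S.F, z = τ.map S p := by
  obtain ⟨p, hp, rfl⟩ := hz
  obtain ⟨i, hi⟩ := S.fixed_of_mem p hp
  refine ⟨ofWord ω fun _ : Fin n => i, ofWord_mem _, p, hp, ?_⟩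
  rw [map_apply S (ofWord_mem _)]
  congr 1
  have h1 : S.iter (ofWord ω fun _ : Fin n => i).1 n = S.iter (fun _ => i) n := by
    refine S.iter_congr fun j hj => ?_
    simp [ofWord, hj]
  rw [h1]
  clear h1
  induction n with
  | zero => rfl
  | succ n ih => rw [S.iter_succ_apply, ← ih, hi]

/-- The cells leave the boundary, except at the points of the boundary of the blow-up. -/
theorem eventually_boundary (τ : Cell ω) :
    ∀ᶠ n in atTop, ∀ p ∈ S.F, τ.map S p ∈ S.boundary ω n → τ.map S p ∈ S.boundaryInfty ω := by
  rw [Filter.eventually_all_finset]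
  intro p _
  by_cases hp : τ.map S p ∈ S.boundaryInfty ω
  · exact Eventually.of_forall fun _ _ => hp
  · rw [SelfSimilarSet.boundaryInfty, Set.mem_iInter] at hp
    push Not at hp
    obtain ⟨n, hn⟩ := hp
    filter_upwards [eventually_ge_atTop n] with m hm hb
    exact absurd (Set.mem_iUnion₂.2 ⟨m, hm, hb⟩) hn

theorem eventually_mem_boundary {z : EuclideanSpace ℝ (Fin d)} (hz : z ∈ S.boundaryInfty ω) :
    ∀ᶠ n in atTop, z ∈ S.boundary ω n := by
  obtain ⟨m, -, hm⟩ := Set.mem_iUnion₂.1 (Set.mem_iInter.1 hz 0)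
  obtain ⟨τ, hτ, p, hp, rfl⟩ := exists_map_eq S hm
  filter_upwards [eventually_ge_atTop m] with n hn
  exact map_mem_boundary_of_infty S (upTo_mono hn hτ) (S.F_subset hp) hz

/-- Two such points lie in all late boundaries, so the contractions `S.iter ω n` send them to two
points of the finite set `F` whose distance tends to zero. -/
theorem boundaryInfty_subsingleton : (S.boundaryInfty ω).Subsingleton := by
  intro z hz z' hz'
  obtain ⟨R, hR0, hR1, hR⟩ := S.exists_ratio
  by_contra hne
  obtain ⟨δ, hδ, hδF⟩ : ∃ δ > 0, ∀ p ∈ S.F, ∀ q ∈ S.F, dist p q < δ → p = q := by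
    have h1 : (S.F : Set (EuclideanSpace ℝ (Fin d))).Finite := S.F.finite_toSet
    have h2 := h1.infsep_pos_iff_nontrivial
    by_cases hnt : (S.F : Set (EuclideanSpace ℝ (Fin d))).Nontrivial
    · refine ⟨_, h2.2 hnt, fun p hp q hq hpq => ?_⟩
      by_contra hne
      exact absurd ((hnt.le_infsep_iff.1 le_rfl p hp q hq hne)) (not_le.2 hpq)
    · refine ⟨1, one_pos, fun p hp q hq _ => ?_⟩
      exact Set.not_nontrivial_iff.1 hnt hp hq
  have h3 : Tendsto (fun n => R ^ n * dist z z') atTop (𝓝 0) := by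
    simpa using (tendsto_pow_atTop_nhds_zero_of_lt_one hR0 hR1).mul_const (dist z z')
  obtain ⟨n, hn1, hn2, hn3⟩ := ((eventually_mem_boundary S hz).and
    ((eventually_mem_boundary S hz').and (h3.eventually (gt_mem_nhds hδ)))).exists
  obtain ⟨p, hp, rfl⟩ := hn1
  obtain ⟨q, hq, rfl⟩ := hn2
  have h4 := S.dist_iter_le hR0 hR ω n (S.blowUp ω n p) (S.blowUp ω n q)
  have h5 : ∀ x, S.iter ω n (S.blowUp ω n x) = x := by
    intro x
    rw [S.blowUp_eq_inv]
    exact (S.iter ω n).apply_symm_apply x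
  rw [h5, h5] at h4
  exact hne (by rw [hδF p hp q hq (h4.trans_lt hn3)])

/-- The factor in front of `τ.map S` does not involve `τ`: a single similitude carries the whole
stage to its copy, so incidences between cells are the same in the copy. -/
theorem map_splice {n : ℕ} (v : Cell ω) {τ : Cell ω} (hτ : τ ∈ upTo ω n) :
    (splice n v τ).map S =
      v.map S * (S.iter v.1 n)⁻¹ * (S.blowUp ω n)⁻¹ * τ.map S := by
  have key : ∀ m, n ≤ m → S.iter (splice n v τ).1 m =
      S.iter v.1 m * (S.iter v.1 n)⁻¹ * S.iter τ.1 n := by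
    intro m hm
    induction m, hm using Nat.le_induction with
    | base =>
      rw [mul_inv_cancel, one_mul]
      exact S.iter_congr fun j hj => splice_of_lt _ _ hj
    | succ m hm ih =>
      rw [S.iter_succ, S.iter_succ, ih, splice_of_le _ _ hm]
      group
  have hv : v ∈ upTo ω (max n v.level) := upTo_mono (le_max_right _ _) v.mem_upTo_level
  rw [map_eq S (splice_mem (le_max_left _ _) hv τ), key _ (le_max_left _ _), map_eq S hv,
    map_eq S hτ]
  group

/-- The weight of a cell: the factor by which both energy and measure are multiplied. -/
noncomputable def weight (W : Weights N) (τ : Cell ω) : ℝ :=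
  ∏ j ∈ Finset.range τ.level, W.β (τ.1 j) / W.β (ω j)

variable (W : Weights N)

theorem weight_eq_aux {τ : Cell ω} {m n : ℕ} (hmn : m ≤ n) (h : τ ∈ upTo ω m) :
    ∏ j ∈ Finset.range n, W.β (τ.1 j) / W.β (ω j) =
      ∏ j ∈ Finset.range m, W.β (τ.1 j) / W.β (ω j) := by
  refine (Finset.prod_subset (Finset.range_mono hmn) fun j _ hj => ?_).symm
  rw [h j (by simpa using hj), div_self (W.β_mem _).1.ne']

theorem weight_eq {τ : Cell ω} {n : ℕ} (h : τ ∈ upTo ω n) :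
    τ.weight W = ∏ j ∈ Finset.range n, W.β (τ.1 j) / W.β (ω j) := by
  rcases le_total n τ.level with h1 | h1
  · rw [weight, weight_eq_aux W h1 h]
  · rw [weight, weight_eq_aux W h1 τ.mem_upTo_level]

theorem weight_pos (τ : Cell ω) : 0 < τ.weight W :=
  Finset.prod_pos fun _ _ => div_pos (W.β_mem _).1 (W.β_mem _).1

/-- The letters of `v` from `n` on contribute a factor common to the whole copy. -/
theorem exists_weight_splice (n : ℕ) (v : Cell ω) :
    ∃ c > 0, ∀ τ ∈ upTo ω n, (splice n v τ).weight W = c * τ.weight W := by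
  have hv : v ∈ upTo ω (max n v.level) := upTo_mono (le_max_right _ _) v.mem_upTo_level
  refine ⟨∏ j ∈ Finset.range (max n v.level) \ Finset.range n, W.β (v.1 j) / W.β (ω j),
    Finset.prod_pos fun _ _ => div_pos (W.β_mem _).1 (W.β_mem _).1, fun τ hτ => ?_⟩
  rw [weight_eq W (splice_mem (le_max_left _ _) hv τ), weight_eq W hτ,
    ← Finset.prod_sdiff (Finset.range_mono (le_max_left n v.level))]
  congr 1
  · refine Finset.prod_congr rfl fun j hj => ?_
    rw [splice_of_le]
    simp at hj
    omega
  · refine Finset.prod_congr rfl fun j hj => ?_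
    rw [splice_of_lt]
    simpa using hj

end Cell

/-- The square summable families of functions on the cells of the blow-up. -/
abbrev Fam {N : ℕ} (ω : ℕ → Fin N) (D : Type) [NormedAddCommGroup D] : Type :=
  lp (fun _ : Cell ω => D) 2

/-- A reference cell: a set `Y` of points of `X` containing `F`, with a finite measure `m`, and a
Hilbert space `D` of functions on `Y`, whose norm dominates that of `L²(m)`. -/
structure CellModel {d N : ℕ} (S : SelfSimilarSet d N) (Y D : Type) [MeasurableSpace Y]
    [NormedAddCommGroup D] [InnerProductSpace ℝ D] where
  m : Measure Y
  finite : IsFiniteMeasure m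
  pt : Y → EuclideanSpace ℝ (Fin d)
  pt_emb : MeasurableEmbedding pt
  pt_mem : ∀ y, pt y ∈ S.X
  exists_pt : ∀ p ∈ S.F, ∃ y, pt y = p
  ev : D →ₗ[ℝ] (Y → ℝ)
  ev_bound : ∃ C, ∀ f y, |ev f y| ≤ C * ‖f‖
  ev_meas : ∀ f, Measurable (ev f)
  ev_ae : ∀ f, ev f =ᵐ[m] 0 → f = 0
  integral_le : ∀ f, ∫ y, ev f y ^ 2 ∂m ≤ ‖f‖ ^ 2
  exists_bump : ∀ p ∈ S.F, ∃ h : D, ∀ y, pt y ∈ S.F → ev h y = Set.indicator {p} 1 (pt y)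

namespace CellModel

variable {d N : ℕ} {S : SelfSimilarSet d N} {Y D : Type} [MeasurableSpace Y]
  [NormedAddCommGroup D] [InnerProductSpace ℝ D] (M : CellModel S Y D)

/-! ### The `L²` inner product on the reference cell -/

theorem memLp (f : D) : MemLp (M.ev f) 2 M.m := by
  have := M.finite
  obtain ⟨C, hC⟩ := M.ev_bound
  exact MemLp.of_bound (M.ev_meas f).aestronglyMeasurable (C * ‖f‖)
    (Eventually.of_forall fun y => hC f y)

theorem integrable_mul (f g : D) : Integrable (fun y => M.ev f y * M.ev g y) M.m :=
  (M.memLp f).integrable_mul (M.memLp g)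

/-- The inclusion of the functions on the reference cell in `L²`. -/
noncomputable def incl : D →L[ℝ] Lp ℝ 2 M.m :=
  LinearMap.mkContinuous
    { toFun := fun f => (M.memLp f).toLp (M.ev f)
      map_add' := fun f g => by
        rw [← MemLp.toLp_add]
        congr 1
        exact map_add _ _ _
      map_smul' := fun c f => by
        rw [RingHom.id_apply, ← MemLp.toLp_const_smul]
        congr 1
        exact map_smul _ _ _ } 1 fun f => by
    rw [one_mul]
    refine le_of_sq_le_sq ?_ (norm_nonneg _)
    refine le_trans (le_of_eq ?_) (M.integral_le f)
    rw [← real_inner_self_eq_norm_sq, L2.inner_def]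
    refine integral_congr_ae ?_
    filter_upwards [(M.memLp f).coeFn_toLp] with y hy
    simp only [LinearMap.coe_mk, AddHom.coe_mk]
    rw [hy]
    simp [sq]

theorem coeFn_incl (f : D) : M.incl f =ᵐ[M.m] M.ev f := (M.memLp f).coeFn_toLp

theorem inner_incl (f g : D) :
    inner ℝ (M.incl f) (M.incl g) = ∫ y, M.ev f y * M.ev g y ∂M.m := by
  rw [L2.inner_def]
  refine integral_congr_ae ?_
  filter_upwards [M.coeFn_incl f, M.coeFn_incl g] with y hf hg
  rw [hf, hg]
  simp [mul_comm]

theorem norm_incl_le (f : D) : ‖M.incl f‖ ≤ ‖f‖ := by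
  have h := LinearMap.mkContinuous_norm_le (f := _) (C := 1) zero_le_one
    (h := fun f : D => show ‖(M.incl : D →ₗ[ℝ] Lp ℝ 2 M.m) f‖ ≤ 1 * ‖f‖ by
      rw [one_mul]
      refine le_of_sq_le_sq ?_ (norm_nonneg _)
      rw [ContinuousLinearMap.coe_coe, ← real_inner_self_eq_norm_sq, inner_incl]
      simpa [sq] using M.integral_le f)
  have h2 := ((M.incl : D →ₗ[ℝ] Lp ℝ 2 M.m).mkContinuous 1 _).le_of_opNorm_le h f
  simpa using h2

variable [CompleteSpace D]

/-- The operator of the `L²` inner product on the reference cell. -/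
noncomputable def resolvent : D →L[ℝ] D := (ContinuousLinearMap.adjoint M.incl) ∘L M.incl

theorem inner_resolvent (f g : D) :
    inner ℝ (M.resolvent f) g = ∫ y, M.ev f y * M.ev g y ∂M.m := by
  rw [← inner_incl, resolvent, ContinuousLinearMap.comp_apply,
    ContinuousLinearMap.adjoint_inner_left]

theorem inner_resolvent_eq (f g : D) :
    inner ℝ (M.resolvent f) g = inner ℝ (M.incl f) (M.incl g) := by
  rw [inner_resolvent, inner_incl]

theorem norm_resolvent_le (f : D) : ‖M.resolvent f‖ ≤ ‖f‖ := by
  by_cases h0 : ‖M.resolvent f‖ = 0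
  · rw [h0]; exact norm_nonneg _
  · have h1 : ‖M.resolvent f‖ ^ 2 ≤ ‖f‖ * ‖M.resolvent f‖ := by
      rw [← real_inner_self_eq_norm_sq, inner_resolvent_eq]
      refine (real_inner_le_norm _ _).trans ?_
      gcongr <;> exact M.norm_incl_le _
    have h2 : 0 < ‖M.resolvent f‖ := lt_of_le_of_ne (norm_nonneg _) (Ne.symm h0)
    nlinarith

/-- Point evaluations are uniformly bounded by the norm, so the squares of an orthonormal system sum
to at most `C ^ 2` at each point. Integrating over the finite measure bounds the dimension of any
space on which the `L²` norm is comparable to the norm of `D`. -/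
theorem isCompactOperator_resolvent : IsCompactOperator M.resolvent := by
  have := M.finite
  refine isCompactOperator_of_finrank_bound (isSymmetric_of_inner_eq M.inner_resolvent_eq)
    (fun x => ?_) fun c hc => ?_
  · rw [inner_resolvent_eq]; exact real_inner_self_nonneg
  · obtain ⟨C, hC⟩ := M.ev_bound
    refine ⟨⌈C ^ 2 * M.m.real Set.univ / c⌉₊, fun X hX hb => ?_⟩
    let e := stdOrthonormalBasis ℝ X
    have hpt : ∀ y, ∑ i, M.ev (e i : D) y ^ 2 ≤ C ^ 2 := by
      intro y
      -- The vector representing evaluation at `y` on `X`: its value at `y` and its squared norm are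
      -- both `s`, so the bound on evaluations gives `s ^ 2 ≤ C ^ 2 * s`.
      set g : X := ∑ i, M.ev (e i : D) y • e i with hg
      set s := ∑ i, M.ev (e i : D) y ^ 2 with hs
      have hs0 : 0 ≤ s := Finset.sum_nonneg fun i _ => sq_nonneg _
      have h1 : M.ev (g : D) y = s := by
        rw [hg, Submodule.coe_sum, map_sum, Finset.sum_apply]
        refine Finset.sum_congr rfl fun i _ => ?_
        rw [Submodule.coe_smul, map_smul, Pi.smul_apply, smul_eq_mul, sq]
      have h2 : ‖(g : D)‖ ^ 2 = s := by
        rw [← Submodule.coe_norm, ← real_inner_self_eq_norm_sq, hg,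
          e.orthonormal.inner_sum]
        simp [hs, sq]
      have h3 := hC (g : D) y
      rw [h1, abs_of_nonneg hs0] at h3
      have h4 : s ^ 2 ≤ C ^ 2 * s := by
        rw [← h2, ← mul_pow, h2]
        exact pow_le_pow_left₀ hs0 h3 2
      by_cases h5 : s = 0
      · rw [h5]; positivity
      · have h6 : 0 < s := lt_of_le_of_ne hs0 (Ne.symm h5)
        nlinarith
    have hint : ∀ i, c ≤ ∫ y, M.ev (e i : D) y ^ 2 ∂M.m := by
      intro i
      have h1 := hb (e i) (e i).2
      rw [inner_resolvent, ← Submodule.coe_norm, e.orthonormal.1 i] at h1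
      simpa [sq] using h1
    have hsum : (Module.finrank ℝ X : ℝ) * c ≤ C ^ 2 * M.m.real Set.univ := by
      calc (Module.finrank ℝ X : ℝ) * c = ∑ _i : Fin (Module.finrank ℝ X), c := by simp
        _ ≤ ∑ i, ∫ y, M.ev (e i : D) y ^ 2 ∂M.m := Finset.sum_le_sum fun i _ => hint i
        _ = ∫ y, ∑ i, M.ev (e i : D) y ^ 2 ∂M.m := by
          rw [integral_finsetSum]
          intro i _
          simpa [sq] using M.integrable_mul (e i) (e i)
        _ ≤ ∫ _y, C ^ 2 ∂M.m := by
          refine integral_mono (integrable_finsetSum _ fun i _ => ?_) (integrable_const _) hpt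
          simpa [sq] using M.integrable_mul (e i) (e i)
        _ = C ^ 2 * M.m.real Set.univ := by simp [mul_comm]
    have h2 : (Module.finrank ℝ X : ℝ) ≤ C ^ 2 * M.m.real Set.univ / c := by
      rwa [le_div_iff₀ hc]
    exact_mod_cast h2.trans (Nat.le_ceil _)

/-! ### Families of functions on the cells -/

variable (ω : ℕ → Fin N)

/-- The operator of the `L²` inner product on families. -/
noncomputable def famResolvent : Fam ω D →L[ℝ] Fam ω D :=
  LinearMap.mkContinuous
    { toFun := fun x => ⟨fun τ => M.resolvent (x τ), by
        refine memℓp_gen ?_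
        refine Summable.of_nonneg_of_le (fun τ => by positivity) (fun τ => ?_)
          ((lp.memℓp x).summable (by simp))
        exact Real.rpow_le_rpow (norm_nonneg _) (M.norm_resolvent_le _) (by simp)⟩
      map_add' := fun x y => by
        ext τ
        exact map_add M.resolvent _ _
      map_smul' := fun c x => by
        ext τ
        exact map_smul M.resolvent _ _ } 1 fun x => by
    rw [one_mul]
    exact lp.norm_mono (by simp) fun τ => M.norm_resolvent_le _

variable {ω}

@[simp] theorem famResolvent_apply (x : Fam ω D) (τ : Cell ω) :
    M.famResolvent ω x τ = M.resolvent (x τ) := rfl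

theorem norm_famResolvent_le (x : Fam ω D) : ‖M.famResolvent ω x‖ ≤ ‖x‖ :=
  lp.norm_mono (by simp) fun τ => M.norm_resolvent_le _

theorem pencil_famResolvent_apply (l : ℝ) (x : Fam ω D) (τ : Cell ω) :
    pencil (M.famResolvent ω) l x τ = pencil M.resolvent l (x τ) := rfl

theorem famResolvent_inner (x y : Fam ω D) :
    inner ℝ (M.famResolvent ω x) y = inner ℝ x (M.famResolvent ω y) := by
  rw [lp.inner_eq_tsum, lp.inner_eq_tsum]
  exact tsum_congr fun τ => isSymmetric_of_inner_eq M.inner_resolvent_eq (x τ) (y τ)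

/-- The compression to a subspace of the operator of the `L²` inner product. -/
noncomputable def comp (V : Submodule ℝ (Fam ω D)) [CompleteSpace V] : V →L[ℝ] V :=
  ContinuousLinearMap.adjoint V.subtypeL ∘L (M.famResolvent ω ∘L V.subtypeL)

theorem inner_comp (V : Submodule ℝ (Fam ω D)) [CompleteSpace V] (x y : V) :
    inner ℝ (M.comp V x) y = inner ℝ (M.famResolvent ω x) (y : Fam ω D) := by
  rw [comp, ContinuousLinearMap.comp_apply, ContinuousLinearMap.adjoint_inner_left]
  rfl

theorem inner_pencil_comp (V : Submodule ℝ (Fam ω D)) [CompleteSpace V] (l : ℝ) (x y : V) :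
    inner ℝ (pencil (M.comp V) l x) y =
      inner ℝ (pencil (M.famResolvent ω) l x) (y : Fam ω D) := by
  rw [pencil_apply, pencil_apply, inner_sub_left, inner_sub_left, inner_smul_left,
    inner_smul_left, inner_comp]
  rfl

theorem comp_symm (V : Submodule ℝ (Fam ω D)) [CompleteSpace V] :
    (M.comp V : V →ₗ[ℝ] V).IsSymmetric := by
  intro x y
  simp only [ContinuousLinearMap.coe_coe]
  rw [inner_comp, real_inner_comm (M.comp V y), inner_comp, famResolvent_inner, real_inner_comm]

theorem norm_pencil_comp_le {V : Submodule ℝ (Fam ω D)} [CompleteSpace V] {l c : ℝ} {x : V}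
    (hc : 0 ≤ c) (h : ∀ v ∈ V, inner ℝ (pencil (M.famResolvent ω) l x) v ≤ c * ‖v‖) :
    ‖pencil (M.comp V) l x‖ ≤ c := by
  by_cases h0 : pencil (M.comp V) l x = 0
  · rwa [h0, norm_zero]
  · have h1 := h _ (pencil (M.comp V) l x).2
    rw [← inner_pencil_comp, real_inner_self_eq_norm_sq, ← Submodule.coe_norm, sq] at h1
    exact le_of_mul_le_mul_right h1 (norm_pos_iff.2 h0)

end CellModel

/-! ### Finitely supported families and truncation -/

section Fam

variable {N : ℕ} {ω : ℕ → Fin N} {D : Type} [NormedAddCommGroup D] [InnerProductSpace ℝ D]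

open Classical in
/-- The family equal to `g` on a finite set `C` of cells, and to zero elsewhere. -/
noncomputable def patch (C : Finset (Cell ω)) : (Cell ω → D) →ₗ[ℝ] Fam ω D where
  toFun g := ⟨fun τ => if τ ∈ C then g τ else 0, by
    refine memℓp_gen (summable_of_ne_finset_zero (s := C) fun τ hτ => ?_)
    simp [hτ]⟩
  map_add' g h := by
    ext τ
    change (if τ ∈ C then (g + h) τ else 0) = (if τ ∈ C then g τ else 0) + if τ ∈ C then h τ else 0
    split_ifs <;> simp
  map_smul' c g := by
    ext τ
    change (if τ ∈ C then (c • g) τ else 0) = c • (if τ ∈ C then g τ else 0)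
    split_ifs <;> simp

theorem patch_of_mem {C : Finset (Cell ω)} {τ : Cell ω} (h : τ ∈ C) (g : Cell ω → D) :
    patch C g τ = g τ := if_pos h

theorem patch_of_notMem {C : Finset (Cell ω)} {τ : Cell ω} (h : τ ∉ C) (g : Cell ω → D) :
    patch C g τ = 0 := if_neg h

theorem inner_eq_sum {C : Finset (Cell ω)} {x : Fam ω D} (hx : ∀ τ ∉ C, x τ = 0) (y : Fam ω D) :
    inner ℝ x y = ∑ τ ∈ C, inner ℝ (x τ) (y τ) := by
  rw [lp.inner_eq_tsum]
  exact tsum_eq_sum fun τ hτ => by rw [hx τ hτ, inner_zero_left]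

theorem norm_sq_eq_sum {C : Finset (Cell ω)} {x : Fam ω D} (hx : ∀ τ ∉ C, x τ = 0) :
    ‖x‖ ^ 2 = ∑ τ ∈ C, ‖x τ‖ ^ 2 := by
  rw [← real_inner_self_eq_norm_sq, inner_eq_sum hx]
  exact Finset.sum_congr rfl fun τ _ => real_inner_self_eq_norm_sq _

theorem norm_sq_patch (C : Finset (Cell ω)) (g : Cell ω → D) :
    ‖patch C g‖ ^ 2 = ∑ τ ∈ C, ‖g τ‖ ^ 2 := by
  rw [norm_sq_eq_sum fun τ hτ => patch_of_notMem hτ g]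
  exact Finset.sum_congr rfl fun τ hτ => by rw [patch_of_mem hτ]

theorem summable_norm_sq (x : Fam ω D) : Summable fun τ => ‖x τ‖ ^ 2 := by
  refine (lp.summable_inner (𝕜 := ℝ) x x).congr fun τ => real_inner_self_eq_norm_sq _

theorem norm_le_of_apply_le {x y : Fam ω D} {c : ℝ} (hc : 0 ≤ c)
    (h : ∀ τ, ‖x τ‖ ≤ c * ‖y τ‖) : ‖x‖ ≤ c * ‖y‖ := by
  have h1 : ‖x‖ ≤ ‖c • y‖ := lp.norm_mono (by simp) fun τ => by
    rw [lp.coeFn_smul, Pi.smul_apply, norm_smul, Real.norm_of_nonneg hc]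
    exact h τ
  rwa [norm_smul, Real.norm_of_nonneg hc] at h1

/-- Restriction of a family to a finite set of cells. -/
noncomputable def restr (C : Finset (Cell ω)) : Fam ω D →ₗ[ℝ] Fam ω D where
  toFun x := patch C x
  map_add' x y := by rw [lp.coeFn_add, map_add]
  map_smul' c x := by rw [lp.coeFn_smul, map_smul, RingHom.id_apply]

theorem restr_of_mem {C : Finset (Cell ω)} {τ : Cell ω} (h : τ ∈ C) (x : Fam ω D) :
    restr C x τ = x τ := patch_of_mem h _

theorem restr_of_notMem {C : Finset (Cell ω)} {τ : Cell ω} (h : τ ∉ C) (x : Fam ω D) :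
    restr C x τ = 0 := patch_of_notMem h _

theorem norm_restr_le (C : Finset (Cell ω)) (x : Fam ω D) : ‖restr C x‖ ≤ ‖x‖ := by
  refine lp.norm_mono (by simp) fun τ => ?_
  by_cases h : τ ∈ C
  · rw [restr_of_mem h]
  · rw [restr_of_notMem h, norm_zero]; exact norm_nonneg _

theorem restr_eq_self {C : Finset (Cell ω)} {x : Fam ω D} (hx : ∀ τ ∉ C, x τ = 0) :
    restr C x = x := by
  ext τ
  by_cases h : τ ∈ C
  · rw [restr_of_mem h]
  · rw [restr_of_notMem h, hx τ h]

theorem tendsto_restr (x : Fam ω D) :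
    Tendsto (fun C => restr C x) atTop (𝓝 x) := by
  classical
  have h := lp.hasSum_single (E := fun _ : Cell ω => D) (p := 2) (by simp) x
  refine Tendsto.congr (fun C => ?_) h
  ext τ
  rw [lp.coeFn_sum, Finset.sum_apply]
  simp only [lp.single_apply, Pi.single_apply]
  rw [Finset.sum_ite_eq]
  by_cases h : τ ∈ C
  · rw [restr_of_mem h, if_pos h]
  · rw [restr_of_notMem h, if_neg h]

/-- Up to a small error the family lives on finitely many cells, which `C n` eventually avoids. -/
theorem tendsto_restr_of_eventually_notMem {C : ℕ → Finset (Cell ω)}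
    (hC : ∀ τ, ∀ᶠ n in atTop, τ ∉ C n) (x : Fam ω D) :
    Tendsto (fun n => restr (C n) x) atTop (𝓝 0) := by
  rw [Metric.tendsto_nhds]
  intro ε hε
  obtain ⟨B, hB⟩ := ((Metric.tendsto_nhds.1 (tendsto_restr x)) ε hε).exists
  have h1 : ∀ᶠ n in atTop, ∀ τ ∈ B, τ ∉ C n :=
    (Filter.eventually_all_finset B).2 fun τ _ => hC τ
  filter_upwards [h1] with n hn
  have h2 : restr (C n) x = restr (C n) (x - restr B x) := by
    ext τ
    by_cases h : τ ∈ C n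
    · have h3 : τ ∉ B := fun h3 => hn τ h3 h
      rw [restr_of_mem h, restr_of_mem h, lp.coeFn_sub, Pi.sub_apply, restr_of_notMem h3, sub_zero]
    · rw [restr_of_notMem h, restr_of_notMem h]
  rw [dist_zero_right, h2]
  refine (norm_restr_le _ _).trans_lt ?_
  rwa [dist_comm, dist_eq_norm] at hB

/-- Strong convergence to zero is uniform on finite-dimensional subspaces. -/
theorem eventually_norm_le_of_tendsto {V : Type*} [NormedAddCommGroup V] [InnerProductSpace ℝ V]
    (A : ℕ → V →ₗ[ℝ] V) (hA : ∀ x, Tendsto (fun n => A n x) atTop (𝓝 0)) (X : Submodule ℝ V)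
    [FiniteDimensional ℝ X] {δ : ℝ} (hδ : 0 < δ) :
    ∀ᶠ n in atTop, ∀ x ∈ X, ‖A n x‖ ≤ δ * ‖x‖ := by
  let e := stdOrthonormalBasis ℝ X
  have h1 : Tendsto (fun n => ∑ i, ‖A n (e i)‖) atTop (𝓝 0) := by
    rw [show (0 : ℝ) = ∑ i : Fin (Module.finrank ℝ X), ‖(0 : V)‖ by simp]
    exact tendsto_finsetSum _ fun i _ => (hA _).norm
  filter_upwards [h1.eventually (gt_mem_nhds hδ)] with n hn x hx
  have h2 : x = ∑ i, inner ℝ (e i) (⟨x, hx⟩ : X) • (e i : V) := by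
    have := congrArg (Subtype.val) (e.sum_repr' ⟨x, hx⟩)
    rw [Submodule.coe_sum] at this
    exact this.symm
  calc ‖A n x‖ = ‖∑ i, inner ℝ (e i) (⟨x, hx⟩ : X) • A n (e i : V)‖ := by
        conv_lhs => rw [h2]
        simp
    _ ≤ ∑ i, ‖inner ℝ (e i) (⟨x, hx⟩ : X) • A n (e i : V)‖ := norm_sum_le _ _
    _ ≤ ∑ i, ‖x‖ * ‖A n (e i : V)‖ := by
        refine Finset.sum_le_sum fun i _ => ?_
        rw [norm_smul]
        refine mul_le_mul_of_nonneg_right ?_ (norm_nonneg _)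
        refine (norm_inner_le_norm _ _).trans ?_
        rw [e.orthonormal.1 i, one_mul]
        exact le_rfl
    _ = (∑ i, ‖A n (e i : V)‖) * ‖x‖ := by rw [← Finset.mul_sum, mul_comm]
    _ ≤ δ * ‖x‖ := by gcongr

end Fam

namespace CellModel

variable {d N : ℕ} {S : SelfSimilarSet d N} {Y D : Type} [MeasurableSpace Y]
  [NormedAddCommGroup D] [InnerProductSpace ℝ D] (M : CellModel S Y D) (W : Weights N)
  {ω : ℕ → Fin N}

theorem pt_injective : Function.Injective M.pt := M.pt_emb.injective

/-! ### Values of a family at the points of the cells -/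

/-- The value at the point `y` of the cell `τ` of the function which a family represents. -/
noncomputable def val (τ : Cell ω) (y : Y) : Fam ω D →L[ℝ] ℝ :=
  LinearMap.mkContinuousOfExistsBound
    -- Families carry the square root of the weight of the cell, so that weighted energies and
    -- integrals become unweighted sums over the cells.
    { toFun := fun x => (√(τ.weight W))⁻¹ * M.ev (x τ) y
      map_add' := fun x x' => by
        rw [lp.coeFn_add, Pi.add_apply, map_add, Pi.add_apply, mul_add]
      map_smul' := fun c x => by
        rw [lp.coeFn_smul, Pi.smul_apply, map_smul, Pi.smul_apply, smul_eq_mul, smul_eq_mul,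
          RingHom.id_apply]
        ring } (by
    obtain ⟨C, hC⟩ := M.ev_bound
    refine ⟨(√(τ.weight W))⁻¹ * |C|, fun x => ?_⟩
    simp only [LinearMap.coe_mk, AddHom.coe_mk]
    rw [norm_mul, Real.norm_of_nonneg (by positivity), mul_assoc]
    gcongr
    refine (hC _ y).trans ?_
    refine (mul_le_mul_of_nonneg_right (le_abs_self C) (norm_nonneg _)).trans ?_
    gcongr
    exact lp.norm_apply_le_norm (by simp) x τ)

theorem val_apply (τ : Cell ω) (y : Y) (x : Fam ω D) :
    M.val W τ y x = (√(τ.weight W))⁻¹ * M.ev (x τ) y := rfl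

theorem sqrt_weight_pos (τ : Cell ω) : 0 < √(τ.weight W) := Real.sqrt_pos.2 (τ.weight_pos W)

theorem val_eq_zero_iff {τ : Cell ω} {y : Y} {x : Fam ω D} :
    M.val W τ y x = 0 ↔ M.ev (x τ) y = 0 := by
  rw [val_apply, mul_eq_zero, or_iff_right (inv_ne_zero (sqrt_weight_pos W τ).ne')]

theorem val_eq_zero {τ : Cell ω} {x : Fam ω D} (h : x τ = 0) (y : Y) : M.val W τ y x = 0 := by
  rw [val_apply, h, map_zero, Pi.zero_apply, mul_zero]

theorem val_congr {τ : Cell ω} {x x' : Fam ω D} (h : x τ = x' τ) (y : Y) :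
    M.val W τ y x = M.val W τ y x' := by
  rw [val_apply, val_apply, h]

/-- The families, supported in the set `C` of cells, which represent a function on the union of
these cells vanishing on `Z`. -/
noncomputable def space (C : Set (Cell ω)) (Z : Set (EuclideanSpace ℝ (Fin d))) :
    Submodule ℝ (Fam ω D) where
  carrier := {x | (∀ τ ∉ C, x τ = 0) ∧
    (∀ τ ∈ C, ∀ τ' ∈ C, ∀ y y', τ.map S (M.pt y) = τ'.map S (M.pt y') →
      M.val W τ y x = M.val W τ' y' x) ∧
    ∀ τ ∈ C, ∀ y, τ.map S (M.pt y) ∈ Z → M.val W τ y x = 0}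
  add_mem' := fun {x x'} hx hx' => by
    refine ⟨fun τ hτ => ?_, fun τ hτ τ' hτ' y y' h => ?_, fun τ hτ y h => ?_⟩
    · rw [lp.coeFn_add, Pi.add_apply, hx.1 τ hτ, hx'.1 τ hτ, add_zero]
    · rw [map_add, map_add, hx.2.1 τ hτ τ' hτ' y y' h, hx'.2.1 τ hτ τ' hτ' y y' h]
    · rw [map_add, hx.2.2 τ hτ y h, hx'.2.2 τ hτ y h, add_zero]
  zero_mem' := ⟨fun τ _ => rfl, fun _ _ _ _ _ _ _ => by rw [map_zero, map_zero],
    fun _ _ _ _ => map_zero _⟩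
  smul_mem' := fun c x hx => by
    refine ⟨fun τ hτ => ?_, fun τ hτ τ' hτ' y y' h => ?_, fun τ hτ y h => ?_⟩
    · rw [lp.coeFn_smul, Pi.smul_apply, hx.1 τ hτ, smul_zero]
    · rw [map_smul, map_smul, hx.2.1 τ hτ τ' hτ' y y' h]
    · rw [map_smul, hx.2.2 τ hτ y h, smul_zero]

variable {C : Set (Cell ω)} {Z : Set (EuclideanSpace ℝ (Fin d))}

theorem isClosed_space : IsClosed (M.space W C Z : Set (Fam ω D)) := by
  have h1 : (M.space W C Z : Set (Fam ω D)) =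
      (⋂ τ ∈ Cᶜ, {x | x τ = 0}) ∩
      ((⋂ τ ∈ C, ⋂ τ' ∈ C, ⋂ y, ⋂ y', ⋂ _ : τ.map S (M.pt y) = τ'.map S (M.pt y'),
        {x | M.val W τ y x = M.val W τ' y' x}) ∩
      ⋂ τ ∈ C, ⋂ y, ⋂ _ : τ.map S (M.pt y) ∈ Z, {x | M.val W τ y x = 0}) := by
    ext x
    simp only [Set.mem_inter_iff, Set.mem_iInter, Set.mem_ofPred_eq]
    rfl
  rw [h1]
  refine IsClosed.inter ?_ (IsClosed.inter ?_ ?_)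
  · exact isClosed_biInter fun τ _ =>
      isClosed_eq (lp.evalCLM ℝ (fun _ : Cell ω => D) 2 τ).continuous continuous_const
  · exact isClosed_biInter fun τ _ => isClosed_biInter fun τ' _ => isClosed_iInter fun y =>
      isClosed_iInter fun y' => isClosed_iInter fun _ =>
        isClosed_eq (M.val W τ y).continuous (M.val W τ' y').continuous
  · exact isClosed_biInter fun τ _ => isClosed_iInter fun y => isClosed_iInter fun _ =>
        isClosed_eq (M.val W τ y).continuous continuous_const

instance [CompleteSpace D] : CompleteSpace (M.space W C Z) :=
  (M.isClosed_space W).completeSpace_coe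

variable {M W}

theorem apply_eq_zero {x : Fam ω D} (hx : x ∈ M.space W C Z) {τ : Cell ω} (h : τ ∉ C) :
    x τ = 0 := hx.1 τ h

theorem val_eq {x : Fam ω D} (hx : x ∈ M.space W C Z) {τ τ' : Cell ω} (hτ : τ ∈ C) (hτ' : τ' ∈ C)
    {y y' : Y} (h : τ.map S (M.pt y) = τ'.map S (M.pt y')) : M.val W τ y x = M.val W τ' y' x :=
  hx.2.1 τ hτ τ' hτ' y y' h

theorem val_eq_zero_of_mem {x : Fam ω D} (hx : x ∈ M.space W C Z) {τ : Cell ω} (hτ : τ ∈ C)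
    {y : Y} (h : τ.map S (M.pt y) ∈ Z) : M.val W τ y x = 0 := hx.2.2 τ hτ y h

theorem space_anti {Z' : Set (EuclideanSpace ℝ (Fin d))} (h : Z ⊆ Z') :
    M.space W C Z' ≤ M.space W C Z := fun _ hx =>
  ⟨hx.1, hx.2.1, fun τ hτ y hy => hx.2.2 τ hτ y (h hy)⟩

/-- Distinct cells meet only at vertices, so that the compatibility of the values has to be checked
only there. -/
theorem mem_space_of_vertices {x : Fam ω D} (h0 : ∀ τ ∉ C, x τ = 0)
    (h1 : ∀ τ ∈ C, ∀ τ' ∈ C, ∀ y y', M.pt y ∈ S.F → M.pt y' ∈ S.F →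
      τ.map S (M.pt y) = τ'.map S (M.pt y') → M.val W τ y x = M.val W τ' y' x)
    (h2 : ∀ τ ∈ C, ∀ y, τ.map S (M.pt y) ∈ Z → M.val W τ y x = 0) : x ∈ M.space W C Z := by
  refine ⟨h0, fun τ hτ τ' hτ' y y' h => ?_, h2⟩
  by_cases hne : τ = τ'
  · subst hne
    rw [M.pt_injective ((τ.map S).injective h)]
  · exact h1 τ hτ τ' hτ' y y' (Cell.mem_F_of_map_eq S hne (M.pt_mem y) (M.pt_mem y') h)
      (Cell.mem_F_of_map_eq S (Ne.symm hne) (M.pt_mem y') (M.pt_mem y) h.symm) h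

theorem restr_mem_space {x : Fam ω D} {C' : Finset (Cell ω)} (hx : x ∈ M.space W C Z)
    (h : (C' : Set (Cell ω)) ⊆ C) : restr C' x ∈ M.space W (C' : Set (Cell ω)) Z := by
  refine ⟨fun τ hτ => restr_of_notMem hτ x, fun τ hτ τ' hτ' y y' he => ?_, fun τ hτ y hy => ?_⟩
  · rw [M.val_congr W (restr_of_mem hτ x), M.val_congr W (restr_of_mem hτ' x)]
    exact val_eq hx (h hτ) (h hτ') he
  · rw [M.val_congr W (restr_of_mem hτ x)]
    exact val_eq_zero_of_mem hx (h hτ) hy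

theorem restr_stage_mem_space {x : Fam ω D} {n : ℕ} (hx : x ∈ M.space W C Z)
    (h : Cell.upTo ω n ⊆ C) : restr (Cell.stage ω n) x ∈ M.space W (Cell.upTo ω n) Z := by
  rw [← Cell.coe_stage] at h ⊢
  exact restr_mem_space hx h

variable (M W ω) in
/-- The functions on the `n`-th stage. -/
noncomputable abbrev neumannSpace (n : ℕ) : Submodule ℝ (Fam ω D) :=
  M.space W (Cell.upTo ω n) ∅

variable (M W ω) in
/-- The functions on the `n`-th stage which vanish on its boundary. -/
noncomputable abbrev dirichletSpace (n : ℕ) : Submodule ℝ (Fam ω D) :=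
  M.space W (Cell.upTo ω n) (S.boundary ω n)

variable (M W ω) in
/-- The functions on the blow-up. -/
noncomputable abbrev neumannSpaceInfty : Submodule ℝ (Fam ω D) := M.space W Set.univ ∅

variable (M W ω) in
/-- The functions on the blow-up which vanish on its boundary. -/
noncomputable abbrev dirichletSpaceInfty : Submodule ℝ (Fam ω D) :=
  M.space W Set.univ (S.boundaryInfty ω)

theorem dirichletSpace_le_neumannSpace (n : ℕ) : M.dirichletSpace W ω n ≤ M.neumannSpace W ω n :=
  space_anti (Set.empty_subset _)

theorem dirichletSpaceInfty_le_neumannSpaceInfty :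
    M.dirichletSpaceInfty W ω ≤ M.neumannSpaceInfty W ω := space_anti (Set.empty_subset _)

/-- Extension by zero: a cell of the stage meets a cell outside it only on the boundary of the
stage, where the function vanishes. -/
theorem dirichletSpace_le_dirichletSpaceInfty (n : ℕ) :
    M.dirichletSpace W ω n ≤ M.dirichletSpaceInfty W ω := by
  intro x hx
  have key : ∀ τ τ' : Cell ω, ∀ y y', τ ∈ Cell.upTo ω n → τ' ∉ Cell.upTo ω n →
      τ.map S (M.pt y) = τ'.map S (M.pt y') → M.val W τ y x = 0 := fun τ τ' y y' h h' he =>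
    val_eq_zero_of_mem hx h (Cell.map_mem_boundary_of_outside S h h' (M.pt_mem _) (M.pt_mem _) he)
  refine ⟨fun τ h => absurd (Set.mem_univ τ) h, fun τ _ τ' _ y y' he => ?_, fun τ _ y hy => ?_⟩
  · by_cases h : τ ∈ Cell.upTo ω n <;> by_cases h' : τ' ∈ Cell.upTo ω n
    · exact val_eq hx h h' he
    · rw [key τ τ' y y' h h' he, M.val_eq_zero W (apply_eq_zero hx h')]
    · rw [key τ' τ y' y h' h he.symm, M.val_eq_zero W (apply_eq_zero hx h)]
    · rw [M.val_eq_zero W (apply_eq_zero hx h), M.val_eq_zero W (apply_eq_zero hx h')]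
  · by_cases h : τ ∈ Cell.upTo ω n
    · exact val_eq_zero_of_mem hx h (Cell.map_mem_boundary_of_infty S h (M.pt_mem _) hy)
    · exact M.val_eq_zero W (apply_eq_zero hx h) y

/-! ### Boundary values -/

variable (M W) in
/-- The values of a family at the boundary points of the `n`-th stage. -/
theorem exists_boundaryValues (n : ℕ) : ∃ R : Fam ω D →ₗ[ℝ] (S.F → ℝ), ∀ (C) (Z) (x : Fam ω D),
    x ∈ M.space W C Z → Cell.upTo ω n ⊆ C → R x = 0 →
      restr (Cell.stage ω n) x ∈ M.dirichletSpace W ω n := by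
  have h1 : ∀ p : S.F, ∃ τ ∈ Cell.upTo ω n, ∃ y, τ.map S (M.pt y) = S.blowUp ω n p := by
    intro p
    obtain ⟨τ, hτ, q, hq, he⟩ := Cell.exists_map_eq S (ω := ω) (n := n)
      (Set.mem_image_of_mem _ p.2)
    obtain ⟨y, hy⟩ := M.exists_pt q hq
    exact ⟨τ, hτ, y, by rw [hy, he]⟩
  choose τ hτ y hy using h1
  refine ⟨LinearMap.pi fun p => (M.val W (τ p) (y p) : Fam ω D →ₗ[ℝ] ℝ),
    fun C Z x hx hC h0 => ?_⟩
  have h2 : ∀ p, M.val W (τ p) (y p) x = 0 := fun p => congrFun h0 p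
  have h3 := restr_stage_mem_space hx hC
  refine ⟨h3.1, h3.2.1, fun τ' hτ' y' hb => ?_⟩
  obtain ⟨p, hp, he⟩ := hb
  rw [M.val_congr W (restr_of_mem (Cell.mem_stage.2 hτ') x)]
  rw [val_eq hx (hC hτ') (hC (hτ ⟨p, hp⟩)) (he.symm.trans (hy ⟨p, hp⟩).symm), h2]

end CellModel

namespace CellModel

variable {d N : ℕ} {S : SelfSimilarSet d N} {Y D : Type} [MeasurableSpace Y]
  [NormedAddCommGroup D] [InnerProductSpace ℝ D] [CompleteSpace D] (M : CellModel S Y D)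
  {W : Weights N} {ω : ℕ → Fin N}

/-! ### The form of the pencil -/

/-- The form of the pencil of the resolvent on families. -/
noncomputable def form (l : ℝ) (x v : Fam ω D) : ℝ := inner ℝ (pencil (M.famResolvent ω) l x) v

theorem form_add_left (l : ℝ) (x x' v : Fam ω D) :
    M.form l (x + x') v = M.form l x v + M.form l x' v := by
  rw [form, map_add, inner_add_left]; rfl

theorem form_sub_left (l : ℝ) (x x' v : Fam ω D) :
    M.form l (x - x') v = M.form l x v - M.form l x' v := by
  rw [form, map_sub, inner_sub_left]; rfl

theorem form_smul_left (l c : ℝ) (x v : Fam ω D) :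
    M.form l (c • x) v = c * M.form l x v := by
  rw [form, map_smul, real_inner_smul_left]; rfl

theorem form_sub_right (l : ℝ) (x v v' : Fam ω D) :
    M.form l x (v - v') = M.form l x v - M.form l x v' := inner_sub_right _ _ _

theorem form_smul_right (l c : ℝ) (x v : Fam ω D) :
    M.form l x (c • v) = c * M.form l x v := real_inner_smul_right _ _ _

theorem form_comm (l : ℝ) (x v : Fam ω D) : M.form l x v = M.form l v x := by
  rw [form, form, pencil_apply, pencil_apply, inner_sub_left, inner_sub_left,
    real_inner_smul_left, real_inner_smul_left, famResolvent_inner, real_inner_comm,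
    real_inner_comm x (M.famResolvent ω v)]

theorem abs_form_le (l : ℝ) (x v : Fam ω D) :
    |M.form l x v| ≤ (1 + |1 - l|) * ‖x‖ * ‖v‖ := by
  refine (abs_real_inner_le_norm _ _).trans ?_
  gcongr
  rw [pencil_apply]
  refine (norm_sub_le _ _).trans ?_
  rw [norm_smul, Real.norm_eq_abs, add_mul, one_mul]
  gcongr
  exact M.norm_famResolvent_le x

theorem form_eq_sum {C : Finset (Cell ω)} (l : ℝ) {x : Fam ω D} (hx : ∀ τ ∉ C, x τ = 0)
    (v : Fam ω D) :
    M.form l x v = ∑ τ ∈ C, inner ℝ (pencil M.resolvent l (x τ)) (v τ) := by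
  rw [form, inner_eq_sum (C := C)]
  · rfl
  · intro τ hτ
    rw [pencil_famResolvent_apply, hx τ hτ, map_zero]

/-- The form is diagonal over the cells; they interact only through the matching conditions in the
spaces. -/
theorem form_restr_left {C : Finset (Cell ω)} (l : ℝ) (x v : Fam ω D) :
    M.form l (restr C x) v = M.form l x (restr C v) := by
  rw [form_eq_sum M l fun τ hτ => restr_of_notMem hτ x, form_comm M l x,
    form_eq_sum M l fun τ hτ => restr_of_notMem hτ v]
  refine Finset.sum_congr rfl fun τ hτ => ?_
  rw [restr_of_mem hτ, restr_of_mem hτ]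
  exact (pencil_symm (isSymmetric_of_inner_eq M.inner_resolvent_eq) l (x τ) (v τ)).trans
    (real_inner_comm _ _)

/-! ### Quasi-modes in subspaces of families -/

variable {M}

theorem hasQuasimodes_comp_iff {V : Submodule ℝ (Fam ω D)} [CompleteSpace V] {l ε : ℝ}
    (hε : 0 ≤ ε) {k : ℕ} :
    HasQuasimodes (M.comp V) l ε k ↔ ∃ X ≤ V, FiniteDimensional ℝ X ∧
      k ≤ Module.finrank ℝ X ∧ ∀ x ∈ X, ∀ v ∈ V, |M.form l x v| ≤ ε * ‖x‖ * ‖v‖ := by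
  constructor
  · rintro ⟨X, hX, hk, h⟩
    refine ⟨X.map V.subtype, Submodule.map_subtype_le _ _, inferInstance, ?_, ?_⟩
    · rwa [Submodule.finrank_map_subtype_eq]
    · rintro _ ⟨x, hx, rfl⟩ v hv
      have h1 := abs_real_inner_le_norm (pencil (M.comp V) l x) ⟨v, hv⟩
      rw [inner_pencil_comp] at h1
      refine h1.trans ?_
      exact mul_le_mul_of_nonneg_right (h x hx) (norm_nonneg _)
  · rintro ⟨X, hXV, hX, hk, h⟩
    let e := Submodule.comapSubtypeEquivOfLe hXV
    refine ⟨X.comap V.subtype, e.symm.finiteDimensional, ?_, fun x hx => ?_⟩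
    · rwa [e.finrank_eq]
    · refine M.norm_pencil_comp_le (by positivity) fun v hv => ?_
      exact (le_abs_self _).trans (h x hx v hv)

variable (M W) in
/-- There is a `k`-dimensional space of functions on the `n`-th stage, vanishing on the boundary,
which satisfy the eigenvalue equation for `l` with error `ε` even when it is tested on functions
which do not vanish on the boundary. -/
def HasFreeQuasimodes (ω : ℕ → Fin N) (n : ℕ) (l ε : ℝ) (k : ℕ) : Prop :=
  ∃ X ≤ M.dirichletSpace W ω n, FiniteDimensional ℝ X ∧ k ≤ Module.finrank ℝ X ∧
    ∀ x ∈ X, ∀ v ∈ M.neumannSpace W ω n, |M.form l x v| ≤ ε * ‖x‖ * ‖v‖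

theorem form_eq_form_restr {n : ℕ} {x v : Fam ω D} {Z : Set (EuclideanSpace ℝ (Fin d))} (l : ℝ)
    (hx : x ∈ M.space W (Cell.upTo ω n) Z) :
    M.form l x v = M.form l x (restr (Cell.stage ω n) v) := by
  rw [← form_restr_left, restr_eq_self]
  exact fun τ hτ => apply_eq_zero hx fun h => hτ (Cell.mem_stage.2 h)

/-- A test function on the blow-up, cut down to the stage, need not vanish on the boundary. This is
why the error has to be controlled on the Neumann space. -/
theorem HasFreeQuasimodes.hasQuasimodes {n : ℕ} {l ε : ℝ} (hε : 0 ≤ ε) {k : ℕ}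
    (h : M.HasFreeQuasimodes W ω n l ε k) {V : Submodule ℝ (Fam ω D)} [CompleteSpace V]
    (hV : M.dirichletSpaceInfty W ω ≤ V) (hV' : V ≤ M.neumannSpaceInfty W ω) :
    HasQuasimodes (M.comp V) l ε k := by
  obtain ⟨X, hX, hfd, hk, hq⟩ := h
  refine (hasQuasimodes_comp_iff hε).2
    ⟨X, (hX.trans (dirichletSpace_le_dirichletSpaceInfty n)).trans hV, hfd, hk,
      fun x hx v hv => ?_⟩
  rw [form_eq_form_restr l (hX hx)]
  refine (hq x hx _ (restr_stage_mem_space (hV' hv) (Set.subset_univ _))).trans ?_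
  exact mul_le_mul_of_nonneg_left (norm_restr_le _ _) (by positivity)

theorem le_finrank_ker {V F : Type*} [AddCommGroup V] [Module ℝ V] [AddCommGroup F] [Module ℝ F]
    [FiniteDimensional ℝ V] [FiniteDimensional ℝ F] (f : V →ₗ[ℝ] F) {k : ℕ}
    (h : k + Module.finrank ℝ F ≤ Module.finrank ℝ V) :
    k ≤ Module.finrank ℝ (LinearMap.ker f) := by
  have h1 := f.finrank_range_add_finrank_ker
  have h2 := (LinearMap.range f).finrank_le
  omega

theorem le_finrank_inf_ker {V F : Type*} [AddCommGroup V] [Module ℝ V] [AddCommGroup F]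
    [Module ℝ F] [FiniteDimensional ℝ F] (X : Submodule ℝ V) [FiniteDimensional ℝ X]
    (f : V →ₗ[ℝ] F) {k : ℕ} (h : k + Module.finrank ℝ F ≤ Module.finrank ℝ X) :
    k ≤ Module.finrank ℝ (X ⊓ LinearMap.ker f : Submodule ℝ V) := by
  refine (le_finrank_ker (f.domRestrict X) h).trans ?_
  rw [← Submodule.finrank_map_subtype_eq]
  refine Submodule.finrank_mono ?_
  rintro _ ⟨x, hx, rfl⟩
  exact ⟨x.2, hx⟩

theorem finrank_map_of_injOn {V F : Type*} [AddCommGroup V] [Module ℝ V] [AddCommGroup F]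
    [Module ℝ F] (X : Submodule ℝ V) (f : V →ₗ[ℝ] F) (h : ∀ x ∈ X, f x = 0 → x = 0) :
    Module.finrank ℝ (X.map f) = Module.finrank ℝ X := by
  rw [← LinearMap.range_domRestrict]
  refine LinearMap.finrank_range_of_inj ((injective_iff_map_eq_zero _).2 fun x hx => ?_)
  exact Subtype.ext (h x x.2 hx)

/-- Combinations of Dirichlet eigenfunctions near `l` satisfy the equation against all test
functions once their Dirichlet and Neumann resolvents agree, and this amounts to at most `|F|`
linear conditions. -/
theorem hasFreeQuasimodes_of_le_finrank (n : ℕ) (l r : ℝ) (k : ℕ)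
    (hfd : FiniteDimensional ℝ (pencilSpan (M.comp (M.dirichletSpace W ω n))
      (Set.Icc (l - r) (l + r))))
    (h : k + S.F.card ≤ Module.finrank ℝ (pencilSpan (M.comp (M.dirichletSpace W ω n))
      (Set.Icc (l - r) (l + r)))) : M.HasFreeQuasimodes W ω n l r k := by
  set V := M.dirichletSpace W ω n
  set V' := M.neumannSpace W ω n
  set T := M.comp V
  have hT : (T : V →ₗ[ℝ] V).IsSymmetric := M.comp_symm V
  set U := pencilSpan T (Set.Icc (l - r) (l + r))
  have hVV : V ≤ V' := dirichletSpace_le_neumannSpace n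
  obtain ⟨R, hR⟩ := exists_boundaryValues M W (ω := ω) n
  let i : V →ₗ[ℝ] V' := Submodule.inclusion hVV
  -- The difference of the two resolvents is orthogonal to `V`, where both represent the `L²`
  -- product. If its boundary values vanish, it also lies in `V`, hence is zero.
  let Φ : U →ₗ[ℝ] V' := ((i ∘ₗ (T : V →ₗ[ℝ] V)) - ((M.comp V' : V' →ₗ[ℝ] V') ∘ₗ i)) ∘ₗ U.subtype
  have hdim := le_finrank_ker (k := k) ((R ∘ₗ V'.subtype) ∘ₗ Φ) (by simpa using h)
  set K := LinearMap.ker ((R ∘ₗ V'.subtype) ∘ₗ Φ)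
  have hΦ : ∀ y : U, ∀ v : V', inner ℝ (Φ y) v =
      inner ℝ ((T y : V) : Fam ω D) (v : Fam ω D) - inner ℝ (M.famResolvent ω (y : V)) (v : Fam ω D) := by
    intro y v
    change inner ℝ (i (T y) - M.comp V' (i y)) v = _
    rw [inner_sub_left, inner_comp]
    rfl
  have hK : ∀ y ∈ K, Φ y = 0 := by
    intro y hy
    have h1 : restr (Cell.stage ω n) (Φ y : Fam ω D) ∈ V :=
      hR _ _ _ (Φ y).2 subset_rfl hy
    rw [restr_eq_self fun τ hτ => apply_eq_zero (Φ y).2 fun h => hτ (Cell.mem_stage.2 h)] at h1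
    rw [← inner_self_eq_zero (𝕜 := ℝ), hΦ]
    have h2 := M.inner_comp V y ⟨_, h1⟩
    rw [Submodule.coe_inner] at h2
    exact sub_eq_zero.2 h2
  -- The quasi-modes are the vectors `T y`, not `y`: for `y` in `K` the form of `T y` with a Neumann
  -- function `v` is the inner product of `y - (1 - l) T y` with the resolvent of `v`, and so is at
  -- most `r ‖T y‖ ‖v‖`.
  let P : K →ₗ[ℝ] Fam ω D := V.subtype ∘ₗ (T : V →ₗ[ℝ] V) ∘ₗ U.subtype ∘ₗ K.subtype
  have hP : Function.Injective P := by
    rw [injective_iff_map_eq_zero]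
    intro y hy
    have h1 := norm_le_of_mem_pencilSpan hT (y : U).2
    have h2 : T (y : U) = 0 := Subtype.ext hy
    rw [h2, norm_zero, mul_zero] at h1
    exact Subtype.ext (Subtype.ext (norm_le_zero_iff.1 h1))
  refine ⟨LinearMap.range P, ?_, inferInstance, ?_, ?_⟩
  · rintro _ ⟨y, rfl⟩
    exact (T (y : U)).2
  · rwa [LinearMap.finrank_range_of_inj hP]
  · rintro _ ⟨y, rfl⟩ v hv
    have h1 := norm_sub_le_of_mem_pencilSpan hT (y : U).2
    have h2 : ∀ v ∈ V', inner ℝ ((T (y : U) : V) : Fam ω D) v =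
        inner ℝ (M.famResolvent ω ((y : U) : V)) v := by
      intro v hv
      have := hΦ y ⟨v, hv⟩
      rw [hK y y.2, inner_zero_left] at this
      exact (sub_eq_zero.1 this.symm)
    have h3 : M.form l (P y) v =
        inner ℝ ((((y : U) : V) - (1 - l) • T (y : U) : V) : Fam ω D) (M.famResolvent ω v) := by
      change inner ℝ (((T (y : U) : V) : Fam ω D) - (1 - l) • M.famResolvent ω (T (y : U) : V)) v = _
      rw [inner_sub_left, h2 v hv, Submodule.coe_sub, Submodule.coe_smul, inner_sub_left,
        famResolvent_inner, real_inner_smul_left, real_inner_smul_left, famResolvent_inner]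
    rw [h3]
    refine (abs_real_inner_le_norm _ _).trans ?_
    exact mul_le_mul h1 (M.norm_famResolvent_le v) (norm_nonneg _) ((norm_nonneg _).trans h1)

omit [CompleteSpace D] in
theorem isCompactOperator_comp {V : Type*} [NormedAddCommGroup V] [NormedSpace ℝ V]
    {T : D →L[ℝ] D} (hT : IsCompactOperator T) (A : V →L[ℝ] D) (B : D →L[ℝ] V) :
    IsCompactOperator (B ∘L T ∘L A : V →L[ℝ] V) := (hT.comp_clm A).clm_comp B

theorem isCompactOperator_sum {V ι : Type*} [NormedAddCommGroup V] [NormedSpace ℝ V]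
    (s : Finset ι) (f : ι → V →L[ℝ] V) (h : ∀ i ∈ s, IsCompactOperator (f i)) :
    IsCompactOperator (∑ i ∈ s, f i : V →L[ℝ] V) := by
  classical
  induction s using Finset.induction_on with
  | empty => exact isCompactOperator_zero
  | insert i s hi ih =>
    rw [Finset.sum_insert hi]
    exact (h i (Finset.mem_insert_self i s)).add
      (ih fun j hj => h j (Finset.mem_insert_of_mem hj))

/-- A stage has finitely many cells, and each contributes the compact resolvent of the reference
cell. -/
theorem isCompactOperator_comp_dirichletSpace (n : ℕ) :
    IsCompactOperator (M.comp (M.dirichletSpace W ω n)) := by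
  classical
  set V := M.dirichletSpace W ω n
  have h1 : (M.comp V) = ∑ τ ∈ Cell.stage ω n,
      (ContinuousLinearMap.adjoint V.subtypeL ∘L
        lp.singleContinuousLinearMap ℝ (fun _ : Cell ω => D) 2 τ) ∘L M.resolvent ∘L
      (lp.evalCLM ℝ (fun _ : Cell ω => D) 2 τ ∘L V.subtypeL) := by
    ext1 x
    rw [comp, sum_apply]
    simp only [ContinuousLinearMap.comp_apply]
    rw [← map_sum]
    congr 1
    ext τ
    rw [lp.coeFn_sum, Finset.sum_apply]
    simp only [lp.singleContinuousLinearMap_apply, lp.single_apply, Pi.single_apply]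
    rw [Finset.sum_ite_eq]
    split_ifs with h
    · rfl
    · rw [famResolvent_apply]
      change M.resolvent ((x : Fam ω D) τ) = 0
      rw [apply_eq_zero x.2 fun h' => h (Cell.mem_stage.2 h'), map_zero]
  rw [h1]
  exact isCompactOperator_sum _ _ fun τ _ => isCompactOperator_comp M.isCompactOperator_resolvent _ _

theorem finiteDimensional_pencilSpan_dirichletSpace (n : ℕ) (l r : ℝ) :
    FiniteDimensional ℝ (pencilSpan (M.comp (M.dirichletSpace W ω n))
      (Set.Icc (l - r) (l + r))) :=
  finiteDimensional_pencilSpan (M.comp_symm _) (isCompactOperator_comp_dirichletSpace n) _ _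

omit [CompleteSpace D] in
theorem tendsto_sub_restr_stage (x : Fam ω D) :
    Tendsto (fun n => (LinearMap.id - restr (Cell.stage ω n) : Fam ω D →ₗ[ℝ] Fam ω D) x) atTop
      (𝓝 0) := by
  have h := (tendsto_restr x).comp (Cell.tendsto_stage (ω := ω))
  simpa using h.const_sub x

/-- Quasi-modes on the blow-up give free quasi-modes on its stages. -/
theorem exists_hasFreeQuasimodes {V : Submodule ℝ (Fam ω D)} [CompleteSpace V]
    (hV : M.dirichletSpaceInfty W ω ≤ V) (hV' : V ≤ M.neumannSpaceInfty W ω) {l : ℝ}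
    (h : ∀ (k : ℕ) (ε : ℝ), 0 < ε → HasQuasimodes (M.comp V) l ε k) {r : ℝ} (hr : 0 < r) (k : ℕ) :
    ∃ n, M.HasFreeQuasimodes W ω n l r k := by
  set ε := r / (|1 - l| + r) with hε
  have hε0 : 0 < ε := by positivity
  obtain ⟨X, hXV, hfd, hk, hq⟩ :=
    -- One `|F|` is spent on making the truncations vanish on the boundary, the other on passing
    -- from Dirichlet eigenfunctions to free quasi-modes. Truncation at most halves the norms, so
    -- the error becomes `ε / 2`, below the threshold of `finrank_le_of_quasimodes`.
    (hasQuasimodes_comp_iff (by positivity)).1 (h (k + S.F.card + S.F.card) (ε / 4) (by positivity))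
  obtain ⟨n, hn⟩ := (eventually_norm_le_of_tendsto
    (fun n => (LinearMap.id - restr (Cell.stage ω n) : Fam ω D →ₗ[ℝ] Fam ω D))
    tendsto_sub_restr_stage X
    (δ := 1 / 2) (by norm_num)).exists
  refine ⟨n, hasFreeQuasimodes_of_le_finrank n l r k
    (finiteDimensional_pencilSpan_dirichletSpace n l r) ?_⟩
  obtain ⟨R, hR⟩ := exists_boundaryValues M W (ω := ω) n
  have hdim := le_finrank_inf_ker (k := k + S.F.card) X R (by simpa using hk)
  set X' := X ⊓ LinearMap.ker R
  have hfd' : FiniteDimensional ℝ X' := Submodule.finiteDimensional_of_le inf_le_left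
  have hP : ∀ x ∈ X', ‖x‖ ≤ 2 * ‖restr (Cell.stage ω n) x‖ := by
    intro x hx
    have h1 : ‖x - restr (Cell.stage ω n) x‖ ≤ 1 / 2 * ‖x‖ := hn x hx.1
    have h3 := norm_add_le (x - restr (Cell.stage ω n) x) (restr (Cell.stage ω n) x)
    rw [sub_add_cancel] at h3
    linarith
  have hinj := finrank_map_of_injOn X' (restr (Cell.stage ω n)) fun x hx h0 => by
    have h1 := hP x hx
    rw [h0, norm_zero, mul_zero] at h1
    exact norm_le_zero_iff.1 h1
  obtain ⟨X'', hX'', hk', hq'⟩ := (hasQuasimodes_comp_iff (M := M) (V := M.dirichletSpace W ω n)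
    (l := l) (ε := ε / 2) (k := k + S.F.card) (by positivity)).2
    ⟨X'.map (restr (Cell.stage ω n)), by
      rintro _ ⟨x, hx, rfl⟩
      exact hR _ _ _ (hV' (hXV hx.1)) (Set.subset_univ _) hx.2, inferInstance, by rwa [hinj], by
      rintro _ ⟨x, hx, rfl⟩ v hv
      rw [form_restr_left, restr_eq_self
          fun τ hτ => apply_eq_zero hv fun h => hτ (Cell.mem_stage.2 h)]
      refine (hq _ hx.1 v (hV (dirichletSpace_le_dirichletSpaceInfty n hv))).trans ?_
      have h3 : ε / 4 * ‖x‖ ≤ ε / 2 * ‖restr (Cell.stage ω n) x‖ := by nlinarith [hP x hx]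
      exact mul_le_mul_of_nonneg_right h3 (norm_nonneg _)⟩
  exact hk'.trans (finrank_le_of_quasimodes (M.comp_symm _)
    (isCompactOperator_comp_dirichletSpace n) hr (half_lt_self hε0) X'' hq')

end CellModel

/-! ### Indexing the copies of a stage by words -/

namespace Cell

variable {N : ℕ} {ω : ℕ → Fin N}

/-- The letters of `τ` between `n` and `n + m`. -/
def tail (n m : ℕ) (τ : Cell ω) : Fin m → Fin N := fun k => τ.1 (n + k)

/-- The cell with the letters `v` between `n` and `n + m`. -/
def ofTail (ω : ℕ → Fin N) (n : ℕ) {m : ℕ} (v : Fin m → Fin N) : Cell ω :=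
  ⟨fun j => if h : n ≤ j ∧ j < n + m then v ⟨j - n, by omega⟩ else ω j, n + m,
    fun j hj => dif_neg (by omega)⟩

theorem ofTail_mem (n : ℕ) {m : ℕ} (v : Fin m → Fin N) : ofTail ω n v ∈ upTo ω (n + m) :=
  fun j hj => dif_neg (by omega)

theorem ofTail_apply (n : ℕ) {m : ℕ} (v : Fin m → Fin N) (k : Fin m) :
    (ofTail ω n v).1 (n + k) = v k := by
  change dite _ _ _ = _
  rw [dif_pos ⟨by omega, by omega⟩]
  congr 1
  ext
  simp

theorem tail_splice (n m : ℕ) (v : Fin m → Fin N) (τ : Cell ω) :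
    tail n m (splice n (ofTail ω n v) τ) = v := by
  ext1 k
  rw [tail, splice_of_le _ _ (by omega), ofTail_apply]

theorem splice_root_mem (n : ℕ) (τ : Cell ω) : splice n (root ω) τ ∈ upTo ω n :=
  splice_mem le_rfl (fun _ _ => rfl) τ

theorem splice_root_splice (n : ℕ) (v : Cell ω) {τ : Cell ω} (h : τ ∈ upTo ω n) :
    splice n (root ω) (splice n v τ) = τ := by
  refine Subtype.ext (funext fun j => ?_)
  rcases lt_or_ge j n with hj | hj
  · rw [splice_of_lt _ _ hj, splice_of_lt _ _ hj]
  · rw [splice_of_le _ _ hj]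
    exact (h j hj).symm

theorem splice_tail (n m : ℕ) {τ : Cell ω} (h : τ ∈ upTo ω (n + m)) :
    splice n (ofTail ω n (tail n m τ)) (splice n (root ω) τ) = τ := by
  refine Subtype.ext (funext fun j => ?_)
  rcases lt_or_ge j n with hj | hj
  · rw [splice_of_lt _ _ hj, splice_of_lt _ _ hj]
  · rw [splice_of_le _ _ hj]
    rcases lt_or_ge j (n + m) with hj' | hj'
    · obtain ⟨k, rfl⟩ := Nat.exists_eq_add_of_le hj
      exact ofTail_apply n (tail n m τ) ⟨k, by omega⟩
    · rw [ofTail_mem n _ j hj', h j hj']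

/-- A cell of the larger stage is a copy, given by the letters from `n` on, together with a cell of
the stage `n`, given by the letters below `n`. -/
theorem sum_stage_add {A : Type*} [AddCommMonoid A] (n m : ℕ) (f : Cell ω → A) :
    ∑ τ ∈ stage ω (n + m), f τ =
      ∑ v : Fin m → Fin N, ∑ τ ∈ stage ω n, f (splice n (ofTail ω n v) τ) := by
  rw [← Finset.sum_product']
  refine Finset.sum_nbij' (fun τ => (tail n m τ, splice n (root ω) τ))
    (fun q => splice n (ofTail ω n q.1) q.2) ?_ ?_ ?_ ?_ ?_
  · intro τ _
    exact Finset.mem_product.2 ⟨Finset.mem_univ _, mem_stage.2 (splice_root_mem n τ)⟩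
  · intro q _
    exact mem_stage.2 (splice_mem (Nat.le_add_right n m) (ofTail_mem n q.1) _)
  · intro τ hτ
    exact splice_tail n m (mem_stage.1 hτ)
  · intro q hq
    refine Prod.ext (tail_splice n m q.1 q.2) ?_
    exact splice_root_splice n _ (mem_stage.1 (Finset.mem_product.1 hq).2)
  · intro τ hτ
    rw [splice_tail n m (mem_stage.1 hτ)]

end Cell

namespace CellModel

variable {d N : ℕ} {S : SelfSimilarSet d N} {Y D : Type} [MeasurableSpace Y]
  [NormedAddCommGroup D] [InnerProductSpace ℝ D] {M : CellModel S Y D}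
  {W : Weights N} {ω : ℕ → Fin N}

/-! ### Copies of a stage in a larger stage -/

theorem val_splice {n : ℕ} (v : Cell ω) {x x' : Fam ω D} {a : ℝ}
    (h : ∀ τ ∈ Cell.upTo ω n, x (Cell.splice n v τ) = a • x' τ) :
    ∃ c > 0, ∀ τ ∈ Cell.upTo ω n, ∀ y,
      M.val W (Cell.splice n v τ) y x = c * a * M.val W τ y x' := by
  obtain ⟨c, hc, hw⟩ := Cell.exists_weight_splice W n v
  refine ⟨(√c)⁻¹, inv_pos.2 (Real.sqrt_pos.2 hc), fun τ hτ y => ?_⟩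
  rw [val_apply, val_apply, h τ hτ, hw τ hτ, Real.sqrt_mul hc.le, mul_inv, map_smul,
    Pi.smul_apply, smul_eq_mul]
  ring

theorem splice_map_eq_iff {n : ℕ} (v : Cell ω) {τ τ' : Cell ω} (hτ : τ ∈ Cell.upTo ω n)
    (hτ' : τ' ∈ Cell.upTo ω n) (x x' : EuclideanSpace ℝ (Fin d)) :
    (Cell.splice n v τ).map S x = (Cell.splice n v τ').map S x' ↔ τ.map S x = τ'.map S x' := by
  rw [Cell.map_splice S v hτ, Cell.map_splice S v hτ']
  exact (EquivLike.injective (v.map S * (S.iter v.1 n)⁻¹ * (S.blowUp ω n)⁻¹)).eq_iff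

/-- The restriction of a function on a larger stage to the copy of the `n`-th stage given by `v`. -/
theorem patch_splice_mem {n m : ℕ} (hnm : n ≤ m) {v : Cell ω} (hv : v ∈ Cell.upTo ω m)
    {w : Fam ω D} (hw : w ∈ M.neumannSpace W ω m) :
    patch (Cell.stage ω n) (fun τ => w (Cell.splice n v τ)) ∈ M.neumannSpace W ω n := by
  obtain ⟨c, hc, h⟩ := val_splice (M := M) (W := W) (n := n) v (x := w)
    (x' := patch (Cell.stage ω n) fun τ => w (Cell.splice n v τ)) (a := 1)
    fun τ hτ => by rw [patch_of_mem (Cell.mem_stage.2 hτ), one_smul]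
  refine ⟨fun τ hτ => patch_of_notMem (fun h => hτ (Cell.mem_stage.1 h)) _,
    fun τ hτ τ' hτ' y y' he => ?_, fun _ _ _ h => absurd h (Set.notMem_empty _)⟩
  have h1 := val_eq hw (Cell.splice_mem hnm hv τ) (Cell.splice_mem hnm hv τ')
    ((splice_map_eq_iff v hτ hτ' (M.pt y) (M.pt y')).2 he)
  rw [h τ hτ, h τ' hτ'] at h1
  exact mul_left_cancel₀ (by positivity) h1

/-- Copies of multiples of `g` in the copies of the `n`-th stage inside a larger stage. -/
noncomputable def replicate (n m : ℕ) (g : Fam ω D) : ((Fin m → Fin N) → ℝ) →ₗ[ℝ] Fam ω D where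
  toFun c := patch (Cell.stage ω (n + m))
    fun τ => c (Cell.tail n m τ) • g (Cell.splice n (Cell.root ω) τ)
  map_add' c c' := by
    rw [← map_add]
    congr 1
    ext1 τ
    exact add_smul _ _ _
  map_smul' a c := by
    rw [← map_smul]
    congr 1
    ext1 τ
    exact mul_smul _ _ _

theorem replicate_splice {n m : ℕ} (g : Fam ω D) (c : (Fin m → Fin N) → ℝ)
    (v : Fin m → Fin N) {τ : Cell ω} (h : τ ∈ Cell.upTo ω n) :
    replicate n m g c (Cell.splice n (Cell.ofTail ω n v) τ) = c v • g τ := by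
  change patch _ _ _ = _
  rw [patch_of_mem (Cell.mem_stage.2 (Cell.splice_mem (Nat.le_add_right n m)
    (Cell.ofTail_mem n v) τ)), Cell.tail_splice, Cell.splice_root_splice n _ h]

/-- Different copies meet only at their boundary points, where `g` vanishes; so the multiples of `g`
match whatever the coefficients. -/
theorem replicate_mem {n m : ℕ} {g : Fam ω D} (hg : g ∈ M.dirichletSpace W ω n)
    (c : (Fin m → Fin N) → ℝ) : replicate n m g c ∈ M.dirichletSpace W ω (n + m) := by
  have hval : ∀ v : Fin m → Fin N, ∃ a, ∀ τ ∈ Cell.upTo ω n, ∀ y,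
      M.val W (Cell.splice n (Cell.ofTail ω n v) τ) y (replicate n m g c) =
        a * M.val W τ y g := fun v => by
    obtain ⟨b, -, hb⟩ := val_splice (M := M) (W := W) (n := n) (Cell.ofTail ω n v)
      (x := replicate n m g c) (x' := g) fun τ hτ => replicate_splice g c v hτ
    exact ⟨_, hb⟩
  have hzero : ∀ τ ∈ Cell.upTo ω (n + m), ∀ y, S.iter τ.1 n (M.pt y) ∈ S.F →
      M.val W τ y (replicate n m g c) = 0 := by
    intro τ hτ y hy
    obtain ⟨a, ha⟩ := hval (Cell.tail n m τ)
    have h1 := ha _ (Cell.splice_root_mem n τ) y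
    rw [Cell.splice_tail n m hτ] at h1
    rw [h1, val_eq_zero_of_mem hg (Cell.splice_root_mem n τ), mul_zero]
    rw [Cell.map_mem_boundary_iff S (Cell.splice_root_mem n τ), S.iter_congr (τ' := τ.1)]
    · exact hy
    · intro j hj
      rw [Cell.splice_of_lt _ _ hj]
  refine ⟨fun τ hτ => patch_of_notMem (fun h => hτ (Cell.mem_stage.1 h)) _,
    fun τ hτ τ' hτ' y y' he => ?_, fun τ hτ y hy => ?_⟩
  · by_cases ht : Cell.tail n m τ = Cell.tail n m τ'
    · obtain ⟨a, ha⟩ := hval (Cell.tail n m τ)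
      have h1 := ha _ (Cell.splice_root_mem n τ) y
      have h2 := ha _ (Cell.splice_root_mem n τ') y'
      have h3 := splice_map_eq_iff (S := S) (Cell.ofTail ω n (Cell.tail n m τ))
        (Cell.splice_root_mem n τ) (Cell.splice_root_mem n τ') (M.pt y) (M.pt y')
      have h4 : Cell.splice n (Cell.ofTail ω n (Cell.tail n m τ))
          (Cell.splice n (Cell.root ω) τ') = τ' := by rw [ht, Cell.splice_tail n m hτ']
      rw [h4] at h2 h3
      rw [Cell.splice_tail n m hτ] at h1 h3
      rw [h1, h2, val_eq hg (Cell.splice_root_mem n τ) (Cell.splice_root_mem n τ') (h3.1 he)]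
    · obtain ⟨k, hk⟩ := Function.ne_iff.1 ht
      rw [hzero τ hτ y (Cell.iter_mem_F S (Nat.le_add_right n k) hk (M.pt_mem y) (M.pt_mem y') he),
        hzero τ' hτ' y' (Cell.iter_mem_F S (Nat.le_add_right n k) (Ne.symm hk) (M.pt_mem y')
          (M.pt_mem y) he.symm)]
  · refine hzero τ hτ y (S.mem_F_of_iter_mem_F (Nat.le_add_right n m) (M.pt_mem y) ?_)
    exact (Cell.map_mem_boundary_iff S hτ).1 hy

theorem norm_sq_replicate {n m : ℕ} {g : Fam ω D} (hg : ∀ τ ∉ Cell.upTo ω n, g τ = 0)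
    (c : (Fin m → Fin N) → ℝ) : ‖replicate n m g c‖ ^ 2 = (∑ v, c v ^ 2) * ‖g‖ ^ 2 := by
  have h0 : ∀ τ ∉ Cell.stage ω (n + m), replicate n m g c τ = 0 :=
    fun τ hτ => patch_of_notMem hτ _
  rw [norm_sq_eq_sum h0, Cell.sum_stage_add, Finset.sum_mul]
  refine Finset.sum_congr rfl fun v _ => ?_
  rw [norm_sq_eq_sum (C := Cell.stage ω n) fun τ hτ => hg τ fun h => hτ (Cell.mem_stage.2 h),
    Finset.mul_sum]
  refine Finset.sum_congr rfl fun τ hτ => ?_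
  rw [replicate_splice g c v (Cell.mem_stage.1 hτ), norm_smul, mul_pow, Real.norm_eq_abs, sq_abs]

variable [CompleteSpace D]

theorem form_replicate {n m : ℕ} {g : Fam ω D} (hg : ∀ τ ∉ Cell.upTo ω n, g τ = 0)
    (c : (Fin m → Fin N) → ℝ) (l : ℝ) (w : Fam ω D) :
    M.form l (replicate n m g c) w = ∑ v, c v * M.form l g
      (patch (Cell.stage ω n) fun τ => w (Cell.splice n (Cell.ofTail ω n v) τ)) := by
  have h0 : ∀ τ ∉ Cell.stage ω (n + m), replicate n m g c τ = 0 :=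
    fun τ hτ => patch_of_notMem hτ _
  rw [form_eq_sum M l h0, Cell.sum_stage_add]
  refine Finset.sum_congr rfl fun v _ => ?_
  rw [form_eq_sum (C := Cell.stage ω n) M l fun τ hτ => hg τ fun h => hτ (Cell.mem_stage.2 h),
    Finset.mul_sum]
  refine Finset.sum_congr rfl fun τ hτ => ?_
  rw [replicate_splice g c v (Cell.mem_stage.1 hτ), patch_of_mem hτ, map_smul,
    real_inner_smul_left]

/-- A free quasi-mode on a stage can be copied into all the copies of this stage. -/
theorem HasFreeQuasimodes.replicate {n : ℕ} {l ε : ℝ} (hε : 0 ≤ ε)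
    (h : M.HasFreeQuasimodes W ω n l ε 1) (m : ℕ) :
    HasQuasimodes (M.comp (M.dirichletSpace W ω (n + m))) l ε (N ^ m) := by
  obtain ⟨X, hX, hfd, hk, hq⟩ := h
  obtain ⟨g, hg, hg0⟩ : ∃ g ∈ X, g ≠ 0 := by
    refine X.exists_mem_ne_zero_of_ne_bot fun hb => ?_
    rw [hb, finrank_bot] at hk
    omega
  have hsupp : ∀ τ ∉ Cell.upTo ω n, g τ = 0 := fun τ hτ => apply_eq_zero (hX hg) hτ
  have hgn : 0 < ‖g‖ := norm_pos_iff.2 hg0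
  have hnorm := norm_sq_replicate (m := m) hsupp
  refine (hasQuasimodes_comp_iff hε).2 ⟨LinearMap.range (CellModel.replicate n m g), ?_,
    inferInstance, ?_, ?_⟩
  · rintro _ ⟨c, rfl⟩
    exact replicate_mem (hX hg) c
  · rw [LinearMap.finrank_range_of_inj]
    · simp
    · rw [injective_iff_map_eq_zero]
      intro c hc
      have h1 := hnorm c
      rw [hc, norm_zero] at h1
      have h2 : ∑ v, c v ^ 2 = 0 := by
        have : (∑ v, c v ^ 2) * ‖g‖ ^ 2 = 0 := by rw [← h1]; norm_num
        exact (mul_eq_zero.1 this).resolve_right (by positivity)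
      ext1 v
      have h3 := (Finset.sum_eq_zero_iff_of_nonneg fun v _ => sq_nonneg (c v)).1 h2 v
        (Finset.mem_univ v)
      exact pow_eq_zero_iff two_ne_zero |>.1 h3
  · rintro _ ⟨c, rfl⟩ w hw
    set r : (Fin m → Fin N) → Fam ω D := fun v =>
      patch (Cell.stage ω n) fun τ => w (Cell.splice n (Cell.ofTail ω n v) τ) with hr
    have hsum : ∑ v, ‖r v‖ ^ 2 ≤ ‖w‖ ^ 2 := by
      have h1 : ∑ v, ‖r v‖ ^ 2 = ‖restr (Cell.stage ω (n + m)) w‖ ^ 2 := by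
        rw [norm_sq_eq_sum fun τ hτ => restr_of_notMem hτ w, Cell.sum_stage_add]
        refine Finset.sum_congr rfl fun v _ => ?_
        rw [hr, norm_sq_patch]
        refine Finset.sum_congr rfl fun τ _ => ?_
        rw [restr_of_mem (Cell.mem_stage.2 (Cell.splice_mem (Nat.le_add_right n m)
          (Cell.ofTail_mem n v) τ))]
      rw [h1]
      exact pow_le_pow_left₀ (norm_nonneg _) (norm_restr_le _ _) 2
    -- Cauchy–Schwarz over the copies, whose restrictions of `w` have square sum at most `‖w‖ ^ 2`;
    -- the error does not grow with the number of copies.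
    have hcs : ∑ v, |c v| * ‖r v‖ ≤ √(∑ v, c v ^ 2) * ‖w‖ := by
      refine (Real.sum_mul_le_sqrt_mul_sqrt _ _ _).trans ?_
      simp only [sq_abs]
      gcongr
      rw [Real.sqrt_le_left (norm_nonneg _)]
      exact hsum
    have hx : ‖CellModel.replicate n m g c‖ = √(∑ v, c v ^ 2) * ‖g‖ := by
      rw [← Real.sqrt_sq (norm_nonneg (CellModel.replicate n m g c)), hnorm c,
        Real.sqrt_mul (Finset.sum_nonneg fun v _ => sq_nonneg _), Real.sqrt_sq hgn.le]
    rw [form_replicate hsupp, hx]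
    calc |∑ v, c v * M.form l g (r v)| ≤ ∑ v, |c v * M.form l g (r v)| :=
          Finset.abs_sum_le_sum_abs _ _
      _ ≤ ∑ v, ε * ‖g‖ * (|c v| * ‖r v‖) := by
          refine Finset.sum_le_sum fun v _ => ?_
          rw [abs_mul]
          have h1 := hq g hg (r v) (patch_splice_mem (Nat.le_add_right n m)
            (Cell.ofTail_mem n v) (dirichletSpace_le_neumannSpace _ hw))
          calc |c v| * |M.form l g (r v)| ≤ |c v| * (ε * ‖g‖ * ‖r v‖) := by gcongr
            _ = _ := by ring
      _ = ε * ‖g‖ * ∑ v, |c v| * ‖r v‖ := by rw [Finset.mul_sum]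
      _ ≤ ε * ‖g‖ * (√(∑ v, c v ^ 2) * ‖w‖) := by gcongr
      _ = _ := by ring

theorem HasFreeQuasimodes.le_finrank {n : ℕ} {l ε r : ℝ} (hε : 0 ≤ ε) (hr : 0 < r)
    (hεr : ε < r / (|1 - l| + r)) (h : M.HasFreeQuasimodes W ω n l ε 1) (m : ℕ) :
    N ^ m ≤ Module.finrank ℝ (pencilSpan (M.comp (M.dirichletSpace W ω (n + m)))
      (Set.Icc (l - r) (l + r))) := by
  obtain ⟨X, hX, hk, hq⟩ := h.replicate hε m
  exact hk.trans (finrank_le_of_quasimodes (M.comp_symm _)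
    (isCompactOperator_comp_dirichletSpace _) hr hεr X hq)

end CellModel

namespace CellModel

variable {d N : ℕ} {S : SelfSimilarSet d N} {Y D : Type} [MeasurableSpace Y]
  [NormedAddCommGroup D] [InnerProductSpace ℝ D] (M : CellModel S Y D)
  (W : Weights N) {ω : ℕ → Fin N}

/-! ### Corrections at the vertices -/

/-- The point of the reference cell above a vertex. -/
noncomputable def vertex (p : S.F) : Y := (M.exists_pt p p.2).choose

theorem pt_vertex (p : S.F) : M.pt (M.vertex p) = p := (M.exists_pt p p.2).choose_spec

/-- A function on the reference cell with value `1` at the vertex `p` and `0` at the others. -/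
noncomputable def bump (p : S.F) : D := (M.exists_bump p p.2).choose

theorem ev_bump (p : S.F) {y : Y} (hy : M.pt y ∈ S.F) :
    M.ev (M.bump p) y = Set.indicator {(p : EuclideanSpace ℝ (Fin d))} 1 (M.pt y) :=
  (M.exists_bump p p.2).choose_spec y hy

theorem ev_sum_bump (c : S.F → ℝ) {y : Y} (hy : M.pt y ∈ S.F) :
    M.ev (∑ p, c p • M.bump p) y = c ⟨M.pt y, hy⟩ := by
  rw [map_sum, Finset.sum_apply, Finset.sum_eq_single ⟨M.pt y, hy⟩]
  · rw [map_smul, Pi.smul_apply, M.ev_bump _ hy]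
    simp
  · intro p _ hp
    rw [map_smul, Pi.smul_apply, M.ev_bump _ hy, Set.indicator_of_notMem, smul_zero]
    exact fun h => hp (Subtype.ext h.symm)
  · exact fun h => absurd (Finset.mem_univ _) h

open Classical in
/-- The combination of bumps with the values of `f` at the vertices of the cell `τ` in `Z`. -/
noncomputable def corr (Z : Set (EuclideanSpace ℝ (Fin d))) (τ : Cell ω) (f : D) : D :=
  ∑ p : S.F, (if τ.map S p ∈ Z then M.ev f (M.vertex p) else 0) • M.bump p

variable {Z : Set (EuclideanSpace ℝ (Fin d))} {τ : Cell ω}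

open Classical in
theorem ev_corr (f : D) {y : Y} (hy : M.pt y ∈ S.F) :
    M.ev (M.corr Z τ f) y = if τ.map S (M.pt y) ∈ Z then M.ev f y else 0 := by
  have h : M.vertex ⟨M.pt y, hy⟩ = y := M.pt_injective (M.pt_vertex _)
  rw [corr, M.ev_sum_bump _ hy, h]

theorem corr_eq_zero (h : ∀ p ∈ S.F, τ.map S p ∉ Z) (f : D) : M.corr Z τ f = 0 :=
  Finset.sum_eq_zero fun p _ => by rw [if_neg (h p p.2), zero_smul]

theorem exists_norm_corr_le : ∃ C, 0 ≤ C ∧ ∀ (Z : Set (EuclideanSpace ℝ (Fin d))) (τ : Cell ω)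
    (f : D), ‖M.corr Z τ f‖ ≤ C * ‖f‖ := by
  obtain ⟨C, hC⟩ := M.ev_bound
  refine ⟨∑ p, |C| * ‖M.bump p‖, Finset.sum_nonneg fun p _ => by positivity, fun Z τ f => ?_⟩
  rw [Finset.sum_mul]
  refine (norm_sum_le _ _).trans (Finset.sum_le_sum fun p _ => ?_)
  rw [norm_smul, mul_right_comm]
  refine mul_le_mul_of_nonneg_right ?_ (norm_nonneg _)
  split_ifs
  · refine (hC f _).trans ?_
    gcongr
    exact le_abs_self C
  · rw [norm_zero]; positivity

open Classical in
/-- The cells of the `n`-th stage with a vertex in `Z`. -/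
noncomputable def touching (S : SelfSimilarSet d N) (ω : ℕ → Fin N)
    (Z : Set (EuclideanSpace ℝ (Fin d))) (n : ℕ) : Finset (Cell ω) :=
  (Cell.stage ω n).filter fun τ => ∃ p ∈ S.F, τ.map S p ∈ Z

theorem mem_touching {n : ℕ} :
    τ ∈ touching S ω Z n ↔ τ ∈ Cell.stage ω n ∧ ∃ p ∈ S.F, τ.map S p ∈ Z := by
  classical
  exact Finset.mem_filter

/-- The correction of a family which is supported near `Z` and has the same values at the vertices
in `Z`, and zero at the other ones. -/
noncomputable def fix (Z : Set (EuclideanSpace ℝ (Fin d))) (n : ℕ) (x : Fam ω D) : Fam ω D :=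
  patch (Cell.stage ω n) fun τ => M.corr Z τ (x τ)

open Classical in
theorem val_fix {n : ℕ} (hτ : τ ∈ Cell.upTo ω n) (x : Fam ω D) {y : Y} (hy : M.pt y ∈ S.F) :
    M.val W τ y (M.fix Z n x) = if τ.map S (M.pt y) ∈ Z then M.val W τ y x else 0 := by
  rw [val_apply, val_apply, fix, patch_of_mem (Cell.mem_stage.2 hτ), M.ev_corr _ hy]
  split_ifs
  · rfl
  · rw [mul_zero]

theorem fix_apply_of_notMem {n : ℕ} (h : τ ∉ touching S ω Z n) (x : Fam ω D) :
    M.fix Z n x τ = 0 := by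
  by_cases hτ : τ ∈ Cell.stage ω n
  · rw [fix, patch_of_mem hτ]
    refine M.corr_eq_zero (fun p hp hZ => h ?_) _
    exact mem_touching.2 ⟨hτ, p, hp, hZ⟩
  · exact patch_of_notMem hτ _

theorem restr_fix (n : ℕ) (x : Fam ω D) : restr (touching S ω Z n) (M.fix Z n x) = M.fix Z n x :=
  restr_eq_self fun _ hτ => M.fix_apply_of_notMem hτ x

theorem exists_norm_fix_le (ω : ℕ → Fin N) : ∃ C, 0 ≤ C ∧
    ∀ (Z : Set (EuclideanSpace ℝ (Fin d))) (n : ℕ) (x : Fam ω D),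
      ‖M.fix Z n x‖ ≤ C * ‖restr (touching S ω Z n) x‖ := by
  obtain ⟨C, hC0, hC⟩ := M.exists_norm_corr_le (ω := ω)
  refine ⟨C, hC0, fun Z n x => norm_le_of_apply_le hC0 fun τ => ?_⟩
  by_cases h : τ ∈ touching S ω Z n
  · rw [restr_of_mem h, fix, patch_of_mem (mem_touching.1 h).1]
    exact hC _ _ _
  · rw [M.fix_apply_of_notMem h, norm_zero]
    positivity

variable {M W}

theorem fix_mem {n : ℕ} {x : Fam ω D} (hx : x ∈ M.neumannSpace W ω n) :
    M.fix Z n x ∈ M.neumannSpace W ω n := by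
  refine mem_space_of_vertices (fun τ hτ => patch_of_notMem (fun h => hτ (Cell.mem_stage.1 h)) _)
    (fun τ hτ τ' hτ' y y' hy hy' he => ?_) fun _ _ _ h => absurd h (Set.notMem_empty _)
  rw [M.val_fix W hτ x hy, M.val_fix W hτ' x hy', he, val_eq hx hτ hτ' he]

/-- A function on a stage which vanishes at the infinite boundary becomes a function which vanishes
on the boundary when it is corrected at the other boundary points. -/
theorem sub_fix_mem {n : ℕ} {x : Fam ω D} (hx : x ∈ M.neumannSpace W ω n)
    (h : ∀ τ ∈ Cell.upTo ω n, ∀ y, τ.map S (M.pt y) ∈ S.boundaryInfty ω → M.val W τ y x = 0) :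
    x - M.fix (S.boundary ω n \ S.boundaryInfty ω) n x ∈ M.dirichletSpace W ω n := by
  have h1 := Submodule.sub_mem _ hx (fix_mem (Z := S.boundary ω n \ S.boundaryInfty ω) hx)
  refine ⟨h1.1, h1.2.1, fun τ hτ y hy => ?_⟩
  rw [map_sub, M.val_fix W hτ x (Cell.mem_F_of_map_mem_boundary S hτ (M.pt_mem y) hy)]
  split_ifs with hb
  · exact sub_self _
  · rw [sub_zero]
    refine h τ hτ y ?_
    by_contra hn
    exact hb ⟨hy, hn⟩

theorem fix_congr {n : ℕ} {x x' : Fam ω D} (h : ∀ τ ∈ Cell.upTo ω n, x τ = x' τ) :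
    M.fix Z n x = M.fix Z n x' := by
  ext τ
  by_cases hτ : τ ∈ Cell.stage ω n
  · rw [fix, fix, patch_of_mem hτ, patch_of_mem hτ, h τ (Cell.mem_stage.1 hτ)]
  · rw [fix, fix, patch_of_notMem hτ, patch_of_notMem hτ]

/-- Each fixed cell eventually touches the boundary of the stage only in the infinite boundary. -/
theorem tendsto_restr_touching (x : Fam ω D) :
    Tendsto (fun n => restr (touching S ω (S.boundary ω n \ S.boundaryInfty ω) n) x) atTop
      (𝓝 0) := by
  refine tendsto_restr_of_eventually_notMem (fun τ => ?_) x
  filter_upwards [Cell.eventually_boundary S τ] with n hn hτ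
  obtain ⟨-, p, hp, hb, hb'⟩ := mem_touching.1 hτ
  exact hb' (hn p hp hb)

variable [CompleteSpace D]

/-- Eigenfunctions that are small near the boundary of the `n`-th stage, off the infinite boundary,
yield free quasi-modes, if their form with functions with given values at the infinite boundary
can be made small. -/
theorem exists_hasFreeQuasimodes_of_form_eq_zero (M : CellModel S Y D) (W : Weights N)
    (ω : ℕ → Fin N) (l K : ℝ) (hK : 0 ≤ K) {ε : ℝ} (hε : 0 < ε) :
    ∃ δ > 0, ∀ (n : ℕ) (x : Fam ω D), x ∈ M.dirichletSpaceInfty W ω → x ≠ 0 →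
      (∀ v ∈ M.dirichletSpaceInfty W ω, M.form l x v = 0) →
      ‖x - restr (Cell.stage ω n) x‖ ≤ δ * ‖x‖ →
      ‖restr (touching S ω (S.boundary ω n \ S.boundaryInfty ω) n) x‖ ≤ δ * ‖x‖ →
      (∀ v ∈ M.neumannSpace W ω n, ∃ h ∈ M.neumannSpace W ω n,
        (∀ τ ∈ Cell.upTo ω n, ∀ y, τ.map S (M.pt y) ∈ S.boundaryInfty ω →
          M.val W τ y h = M.val W τ y v) ∧ ‖h‖ ≤ K * ‖v‖ ∧ |M.form l x h| ≤ δ * ‖x‖ * ‖v‖) →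
      M.HasFreeQuasimodes W ω n l ε 1 := by
  obtain ⟨C, hC0, hC⟩ := M.exists_norm_fix_le ω
  set κ := 1 + |1 - l| with hκ
  have hκ0 : 0 ≤ κ := by positivity
  set A := 1 + κ * C * (2 + K) with hA
  have hA0 : 0 < A := by positivity
  -- The first bound ensures that truncation and correction leave a fixed part of the norm of `x`.
  -- In the second, `A` collects the errors: `1` from `h`, `κ * C * (1 + K)` from the correction of
  -- the test function and `κ * C` from the correction of `x`, with `κ` a bound of the form.
  refine ⟨min (1 / (4 * (1 + C))) (ε / (4 * A)), by positivity,
    fun n x hx hx0 hform hP hQ hh => ?_⟩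
  set δ := min (1 / (4 * (1 + C))) (ε / (4 * A)) with hδ
  have hδ0 : 0 < δ := by positivity
  have hδ1 : δ * (1 + C) ≤ 1 / 4 := by
    have : δ ≤ 1 / (4 * (1 + C)) := min_le_left _ _
    rw [le_div_iff₀ (by positivity)] at this
    linarith
  have hδ2 : δ * A ≤ ε / 4 := by
    have : δ ≤ ε / (4 * A) := min_le_right _ _
    rw [le_div_iff₀ (by positivity)] at this
    linarith
  set Z := S.boundary ω n \ S.boundaryInfty ω with hZ
  set x' := restr (Cell.stage ω n) x with hx'
  have hx'n : x' ∈ M.neumannSpace W ω n :=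
    restr_stage_mem_space (dirichletSpaceInfty_le_neumannSpaceInfty hx) (Set.subset_univ _)
  set g := x' - M.fix Z n x' with hg
  have hgD : g ∈ M.dirichletSpace W ω n := by
    refine sub_fix_mem hx'n fun τ hτ y hy => ?_
    rw [M.val_congr W (restr_of_mem (Cell.mem_stage.2 hτ) x)]
    exact val_eq_zero_of_mem hx (Set.mem_univ _) hy
  have hfix : M.fix Z n x' = M.fix Z n x :=
    fix_congr fun τ hτ => restr_of_mem (Cell.mem_stage.2 hτ) x
  have hfixn : ‖M.fix Z n x'‖ ≤ C * (δ * ‖x‖) := by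
    rw [hfix]
    exact (hC Z n x).trans (by gcongr)
  have hxn : 0 < ‖x‖ := norm_pos_iff.2 hx0
  have hgn : ‖x‖ ≤ 4 * ‖g‖ := by
    have h1 : ‖x‖ ≤ ‖x - x'‖ + ‖M.fix Z n x'‖ + ‖g‖ := by
      have : x = (x - x') + M.fix Z n x' + g := by rw [hg]; abel
      calc ‖x‖ = ‖(x - x') + M.fix Z n x' + g‖ := by rw [← this]
        _ ≤ _ := norm_add₃_le
    nlinarith
  have hkey : ∀ v ∈ M.neumannSpace W ω n, |M.form l g v| ≤ ε * ‖g‖ * ‖v‖ := by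
    intro v hv
    obtain ⟨h, hhn, hhb, hhK, hhf⟩ := hh v hv
    have hvh : v - h ∈ M.neumannSpace W ω n := Submodule.sub_mem _ hv hhn
    set f := M.fix Z n (v - h) with hf
    have hw : v - h - f ∈ M.dirichletSpace W ω n := sub_fix_mem hvh fun τ hτ y hy => by
      rw [map_sub, hhb τ hτ y hy, sub_self]
    -- The function `v - h - f` vanishes on the boundary of the stage; extended by zero it is an
    -- admissible test function, on which the form with `x` is zero.
    have h1 : M.form l x' v = M.form l x h + M.form l x f := by
      have h2 := hform _ (dirichletSpace_le_dirichletSpaceInfty n hw)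
      rw [form_sub_right, form_sub_right] at h2
      have h3 : M.form l x' v = M.form l x v := by
        rw [hx', form_restr_left, restr_eq_self
          fun τ hτ => apply_eq_zero hv fun h => hτ (Cell.mem_stage.2 h)]
      linarith
    have h4 : |M.form l x f| ≤ κ * (δ * ‖x‖) * (C * ((1 + K) * ‖v‖)) := by
      rw [hf, ← restr_fix, ← form_restr_left]
      refine (abs_form_le M _ _ _).trans ?_
      have h5 : ‖M.fix Z n (v - h)‖ ≤ C * ((1 + K) * ‖v‖) := by
        refine (hC Z n _).trans ?_
        gcongr
        refine (norm_restr_le _ _).trans ((norm_sub_le _ _).trans ?_)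
        linarith
      gcongr
    have h6 : |M.form l (M.fix Z n x') v| ≤ κ * (C * (δ * ‖x‖)) * ‖v‖ := by
      refine (abs_form_le M _ _ _).trans ?_
      gcongr
    have h7 : |M.form l g v| ≤ δ * A * ‖x‖ * ‖v‖ := by
      rw [hg, form_sub_left, h1]
      have h8 := abs_sub (M.form l x h + M.form l x f) (M.form l (M.fix Z n x') v)
      have h9 := abs_add_le (M.form l x h) (M.form l x f)
      have : δ * A * ‖x‖ * ‖v‖ = δ * ‖x‖ * ‖v‖ + κ * (δ * ‖x‖) * (C * ((1 + K) * ‖v‖)) +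
        κ * (C * (δ * ‖x‖)) * ‖v‖ := by rw [hA]; ring
      linarith
    refine h7.trans ?_
    have h10 : δ * A * ‖x‖ ≤ ε * ‖g‖ := by
      calc δ * A * ‖x‖ ≤ ε / 4 * (4 * ‖g‖) := by gcongr
        _ = _ := by ring
    gcongr
  have hg0 : g ≠ 0 := by
    intro h0
    rw [h0, norm_zero] at hgn
    linarith
  refine ⟨Submodule.span ℝ {g}, ?_, inferInstance, ?_, ?_⟩
  · rw [Submodule.span_singleton_le_iff_mem]
    exact hgD
  · rw [finrank_span_singleton hg0]
  · intro y hy v hv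
    obtain ⟨c, rfl⟩ := Submodule.mem_span_singleton.1 hy
    rw [form_smul_left, abs_mul, norm_smul, Real.norm_eq_abs]
    calc |c| * |M.form l g v| ≤ |c| * (ε * ‖g‖ * ‖v‖) := by gcongr; exact hkey v hv
      _ = _ := by ring

theorem form_eq_zero_of_mem_pencilKer {V : Submodule ℝ (Fam ω D)} [CompleteSpace V] {l : ℝ}
    {x : V} (hx : x ∈ pencilKer (M.comp V) l) {v : Fam ω D} (hv : v ∈ V) : M.form l x v = 0 := by
  have h1 : pencil (M.comp V) l x = 0 := hx
  have h2 := M.inner_pencil_comp V l x ⟨v, hv⟩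
  rw [h1, inner_zero_left] at h2
  exact h2.symm

/-- Without infinite boundary, every eigenfunction on the blow-up yields free quasi-modes. -/
theorem exists_hasFreeQuasimodes_of_eigenvalue (hb : S.boundaryInfty ω = ∅) {l : ℝ} {x : Fam ω D}
    (hx : x ∈ M.dirichletSpaceInfty W ω) (hx0 : x ≠ 0)
    (hform : ∀ v ∈ M.dirichletSpaceInfty W ω, M.form l x v = 0) {ε : ℝ} (hε : 0 < ε) :
    ∃ n, M.HasFreeQuasimodes W ω n l ε 1 := by
  obtain ⟨δ, hδ, h⟩ := exists_hasFreeQuasimodes_of_form_eq_zero M W ω l 0 le_rfl hε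
  have hxn : 0 < ‖x‖ := norm_pos_iff.2 hx0
  have h1 := (tendsto_sub_restr_stage x).norm
  have h2 := (tendsto_restr_touching (S := S) x).norm
  rw [norm_zero] at h1 h2
  obtain ⟨n, hn1, hn2⟩ := ((h1.eventually (ge_mem_nhds (by positivity : 0 < δ * ‖x‖))).and
    (h2.eventually (ge_mem_nhds (by positivity : 0 < δ * ‖x‖)))).exists
  refine ⟨n, h n x hx hx0 hform hn1 hn2 fun v hv => ⟨0, Submodule.zero_mem _, ?_, ?_, ?_⟩⟩
  · intro τ _ y hy
    rw [hb] at hy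
    exact absurd hy (Set.notMem_empty _)
  · simp
  · rw [form, inner_zero_right, abs_zero]
    positivity

omit [CompleteSpace D] in
theorem exists_map_vertex_mem_boundaryInfty (M : CellModel S Y D)
    (hb : (S.boundaryInfty ω).Nonempty) :
    ∃ (τ : Cell ω) (y : Y), τ.map S (M.pt y) ∈ S.boundaryInfty ω := by
  obtain ⟨z, hz⟩ := hb
  obtain ⟨n, hn⟩ := (Cell.eventually_mem_boundary S hz).exists
  obtain ⟨τ, -, p, hp, he⟩ := Cell.exists_map_eq S hn
  obtain ⟨y, hy⟩ := M.exists_pt p hp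
  exact ⟨τ, y, by rwa [hy, ← he]⟩

theorem exists_mem_ne_zero_of_two_le_finrank {V : Type*} [AddCommGroup V] [Module ℝ V]
    (G : Submodule ℝ V) [FiniteDimensional ℝ G] (hG : 2 ≤ Module.finrank ℝ G) (f : V →ₗ[ℝ] ℝ) :
    ∃ x ∈ G, x ≠ 0 ∧ f x = 0 := by
  have h1 := le_finrank_inf_ker (k := 1) G f (by simpa using hG)
  obtain ⟨x, hx, hx0⟩ := (G ⊓ LinearMap.ker f).exists_mem_ne_zero_of_ne_bot fun hb => by
    rw [hb, finrank_bot] at h1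
    omega
  exact ⟨x, hx.1, hx0, hx.2⟩

/-- A two-dimensional space of eigenfunctions vanishing at the infinite boundary yields free
quasi-modes. -/
theorem exists_hasFreeQuasimodes_of_two_le_finrank {l : ℝ} (G : Submodule ℝ (Fam ω D))
    [FiniteDimensional ℝ G] (hG : 2 ≤ Module.finrank ℝ G) (hGV : G ≤ M.dirichletSpaceInfty W ω)
    (hform : ∀ x ∈ G, ∀ v ∈ M.dirichletSpaceInfty W ω, M.form l x v = 0) {τ₀ : Cell ω} {y₀ : Y}
    (hb : τ₀.map S (M.pt y₀) ∈ S.boundaryInfty ω) {ε : ℝ} (hε : 0 < ε) :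
    ∃ n, M.HasFreeQuasimodes W ω n l ε 1 := by
  classical
  obtain ⟨C, hC0, hC⟩ := M.exists_norm_fix_le ω
  obtain ⟨δ, hδ, h⟩ := exists_hasFreeQuasimodes_of_form_eq_zero M W ω l C hC0 hε
  -- The smallness has to be uniform on `G`, because `x` is chosen after `n`.
  obtain ⟨n, ⟨hn1, hn2⟩, hn3⟩ := (((eventually_norm_le_of_tendsto
    (fun n => (LinearMap.id - restr (Cell.stage ω n) : Fam ω D →ₗ[ℝ] Fam ω D))
    tendsto_sub_restr_stage G hδ).and (eventually_norm_le_of_tendsto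
    (fun n => (restr (touching S ω (S.boundary ω n \ S.boundaryInfty ω) n) :
      Fam ω D →ₗ[ℝ] Fam ω D)) tendsto_restr_touching G hδ)).and
    (eventually_ge_atTop τ₀.level)).exists
  have hτ₀ : τ₀ ∈ Cell.upTo ω n := Cell.upTo_mono hn3 τ₀.mem_upTo_level
  -- The bump with value `1` at the only point of the infinite boundary. All corrections there are
  -- multiples of `e`, so the single condition `M.form l x e = 0`, a vanishing normal derivative,
  -- makes them harmless; two dimensions suffice for it.
  let e : Fam ω D := patch (Cell.stage ω n) fun τ => ∑ p : S.F,
    (if τ.map S p ∈ S.boundaryInfty ω then √(τ.weight W) else 0) • M.bump p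
  have he : ∀ v ∈ M.neumannSpace W ω n,
      M.fix (S.boundaryInfty ω) n v = M.val W τ₀ y₀ v • e := by
    intro v hv
    ext τ
    rw [lp.coeFn_smul, Pi.smul_apply]
    by_cases hτ : τ ∈ Cell.stage ω n
    · rw [fix, patch_of_mem hτ, patch_of_mem hτ, corr, Finset.smul_sum]
      refine Finset.sum_congr rfl fun p _ => ?_
      rw [smul_smul]
      congr 1
      split_ifs with hp
      · have h1 := Cell.boundaryInfty_subsingleton S hp hb
        rw [← M.pt_vertex p] at h1
        rw [← val_eq hv (Cell.mem_stage.1 hτ) hτ₀ h1, val_apply]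
        have := (sqrt_weight_pos W τ).ne'
        field_simp
      · rw [mul_zero]
    · rw [fix, patch_of_notMem hτ, patch_of_notMem hτ, smul_zero]
  obtain ⟨x, hxG, hx0, hxe⟩ := exists_mem_ne_zero_of_two_le_finrank G hG
    { toFun := fun x => M.form l x e
      map_add' := fun x x' => M.form_add_left l x x' e
      map_smul' := fun c x => M.form_smul_left l c x e }
  refine ⟨n, h n x (hGV hxG) hx0 (hform x hxG) (hn1 x hxG) (hn2 x hxG)
    fun v hv => ⟨M.fix (S.boundaryInfty ω) n v, fix_mem hv, ?_, ?_, ?_⟩⟩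
  · intro τ hτ y hy
    rw [M.val_fix W hτ v (Cell.mem_F_of_map_mem_boundaryInfty S (M.pt_mem y) hy), if_pos hy]
  · refine (hC _ n v).trans ?_
    gcongr
    exact norm_restr_le _ _
  · have h1 : M.form l x e = 0 := hxe
    rw [he v hv, form_smul_right, h1, mul_zero, abs_zero]
    positivity

/-- A two-dimensional eigenspace on the blow-up yields free quasi-modes. -/
theorem exists_hasFreeQuasimodes_of_neumann {l : ℝ} (G : Submodule ℝ (Fam ω D))
    [FiniteDimensional ℝ G] (hG : 2 ≤ Module.finrank ℝ G) (hGV : G ≤ M.neumannSpaceInfty W ω)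
    (hform : ∀ x ∈ G, ∀ v ∈ M.neumannSpaceInfty W ω, M.form l x v = 0)
    (hb : (S.boundaryInfty ω).Nonempty) {ε : ℝ} (hε : 0 < ε) :
    ∃ n, M.HasFreeQuasimodes W ω n l ε 1 := by
  obtain ⟨τ₀, y₀, hy₀⟩ := exists_map_vertex_mem_boundaryInfty M hb
  have hzero : ∀ x ∈ M.neumannSpaceInfty W ω, M.val W τ₀ y₀ x = 0 →
      x ∈ M.dirichletSpaceInfty W ω := fun x hx h0 => by
    refine ⟨hx.1, hx.2.1, fun τ hτ y hy => ?_⟩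
    rw [val_eq hx hτ (Set.mem_univ τ₀) (Cell.boundaryInfty_subsingleton S hy hy₀), h0]
  -- If all of `G` vanishes at the infinite boundary point, the Dirichlet argument applies.
  -- Otherwise there are an `x` in `G` vanishing there and a `g` in `G` which does not, and
  -- multiples of `g` serve to match boundary values.
  by_cases hG0 : ∀ x ∈ G, M.val W τ₀ y₀ x = 0
  · exact exists_hasFreeQuasimodes_of_two_le_finrank (M := M) (W := W) G hG
      (fun x hx => hzero x (hGV hx) (hG0 x hx))
      (fun x hx v hv => hform x hx v (dirichletSpaceInfty_le_neumannSpaceInfty hv)) hy₀ hε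
  push Not at hG0
  obtain ⟨g, hg, hg0⟩ := hG0
  obtain ⟨x, hxG, hx0, hxv⟩ := exists_mem_ne_zero_of_two_le_finrank G hG
    (M.val W τ₀ y₀ : Fam ω D →ₗ[ℝ] ℝ)
  have hxD := hzero x (hGV hxG) hxv
  have hxn : 0 < ‖x‖ := norm_pos_iff.2 hx0
  set c := M.val W τ₀ y₀ g with hc
  set B := ‖M.val W (ω := ω) τ₀ y₀‖ / |c| with hB
  have hB0 : 0 ≤ B := by positivity
  obtain ⟨δ, hδ, h⟩ := exists_hasFreeQuasimodes_of_form_eq_zero M W ω l (B * ‖g‖)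
    (by positivity) hε
  have h1 := (tendsto_sub_restr_stage x).norm
  have h2 := (tendsto_restr_touching (S := S) x).norm
  rw [norm_zero] at h1 h2
  -- The form of `x` with `g` is zero, so with truncations of `g` it tends to zero; `B` bounds the
  -- coefficient needed to match the value of a test function.
  have h3 : Tendsto (fun n => B * |M.form l x (restr (Cell.stage ω n) g)|) atTop (𝓝 0) := by
    have h4 : Tendsto (fun n => restr (Cell.stage ω n) g) atTop (𝓝 g) :=
      (tendsto_restr g).comp (Cell.tendsto_stage (ω := ω))
    have h5 := ((tendsto_const_nhds (x := pencil (M.famResolvent ω) l x)).inner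
      (𝕜 := ℝ) h4).abs.const_mul B
    have h6 : inner ℝ (pencil (M.famResolvent ω) l x) g = 0 := hform x hxG g (hGV hg)
    rw [h6, abs_zero, mul_zero] at h5
    exact h5
  obtain ⟨n, ⟨⟨hn1, hn2⟩, hn3⟩, hn4⟩ :=
    ((((h1.eventually (ge_mem_nhds (by positivity : 0 < δ * ‖x‖))).and
    (h2.eventually (ge_mem_nhds (by positivity : 0 < δ * ‖x‖)))).and
    (h3.eventually (ge_mem_nhds (by positivity : 0 < δ * ‖x‖)))).and
    (eventually_ge_atTop τ₀.level)).exists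
  have hτ₀ : τ₀ ∈ Cell.upTo ω n := Cell.upTo_mono hn4 τ₀.mem_upTo_level
  have hgn := restr_stage_mem_space (n := n) (hGV hg) (Set.subset_univ _)
  refine ⟨n, h n x hxD hx0 (fun v hv => hform x hxG v (dirichletSpaceInfty_le_neumannSpaceInfty hv))
    hn1 hn2 fun v hv => ⟨(M.val W τ₀ y₀ v / c) • restr (Cell.stage ω n) g,
      Submodule.smul_mem _ _ hgn, ?_, ?_, ?_⟩⟩
  · intro τ hτ y hy
    have hz := Cell.boundaryInfty_subsingleton S hy hy₀
    rw [map_smul, val_eq hv hτ hτ₀ hz, val_eq hgn hτ hτ₀ hz,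
      M.val_congr W (restr_of_mem (Cell.mem_stage.2 hτ₀) g), smul_eq_mul, ← hc,
      div_mul_cancel₀ _ hg0]
  all_goals
    have h7 : |M.val W τ₀ y₀ v / c| ≤ B * ‖v‖ := by
      rw [abs_div, hB, div_mul_eq_mul_div]
      gcongr
      exact (M.val W τ₀ y₀).le_opNorm v
  · rw [norm_smul, Real.norm_eq_abs]
    calc _ ≤ B * ‖v‖ * ‖g‖ := by gcongr; exact norm_restr_le _ _
      _ = _ := by ring
  · rw [form_smul_right, abs_mul]
    calc _ ≤ B * ‖v‖ * |M.form l x (restr (Cell.stage ω n) g)| := by gcongr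
      _ = (B * |M.form l x (restr (Cell.stage ω n) g)|) * ‖v‖ := by ring
      _ ≤ _ := by gcongr

end CellModel

/-! ### Test functions -/

/-- A continuous function which is `1` on `[l - r, l + r]` and `0` outside `[l - 2 r, l + 2 r]`. -/
noncomputable def tent (l r x : ℝ) : ℝ := max 0 (min 1 (2 - |x - l| / r))

theorem continuous_tent (l r : ℝ) : Continuous (tent l r) := by
  unfold tent
  fun_prop

theorem tent_nonneg (l r x : ℝ) : 0 ≤ tent l r x := le_max_left _ _

theorem tent_le_indicator {l r : ℝ} (hr : 0 < r) (x : ℝ) :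
    tent l r x ≤ (Set.Icc (l - 2 * r) (l + 2 * r)).indicator 1 x := by
  by_cases hx : x ∈ Set.Icc (l - 2 * r) (l + 2 * r)
  · rw [Set.indicator_of_mem hx]
    exact max_le zero_le_one (min_le_left _ _)
  · rw [Set.indicator_of_notMem hx]
    refine max_le le_rfl ((min_le_right _ _).trans ?_)
    rw [sub_nonpos, le_div_iff₀ hr]
    by_contra! h
    rw [abs_lt] at h
    exact hx ⟨by linarith, by linarith⟩

theorem indicator_le_tent {l r : ℝ} (hr : 0 < r) (x : ℝ) :
    (Set.Icc (l - r) (l + r)).indicator 1 x ≤ tent l r x := by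
  refine Set.indicator_le' (fun x hx => ?_) (fun x _ => tent_nonneg l r x) x
  refine le_max_of_le_right (le_min le_rfl ?_)
  have : |x - l| / r ≤ 1 := by
    rw [div_le_one hr, abs_le]
    exact ⟨by linarith [hx.1], by linarith [hx.2]⟩
  simp only [Pi.one_apply]
  linarith

theorem hasCompactSupport_tent {l r : ℝ} (hr : 0 < r) : HasCompactSupport (tent l r) := by
  refine HasCompactSupport.intro (K := Set.Icc (l - 2 * r) (l + 2 * r)) isCompact_Icc
    fun x hx => ?_
  have h := tent_le_indicator (l := l) hr x
  rw [Set.indicator_of_notMem hx] at h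
  exact le_antisymm h (tent_nonneg l r x)

section

variable {ν : Measure ℝ} {l r : ℝ}

theorem integrable_tent (hr : 0 < r) (hν : ν (Set.Icc (l - 2 * r) (l + 2 * r)) ≠ ⊤) :
    Integrable (tent l r) ν := by
  refine Integrable.mono' (g := (Set.Icc (l - 2 * r) (l + 2 * r)).indicator 1) ?_
    (continuous_tent l r).aestronglyMeasurable (Eventually.of_forall fun x => ?_)
  · exact (integrable_indicator_iff measurableSet_Icc).2 (integrableOn_const hν)
  · rw [Real.norm_of_nonneg (tent_nonneg l r x)]
    exact tent_le_indicator hr x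

theorem integral_tent_le (hr : 0 < r) (hν : ν (Set.Icc (l - 2 * r) (l + 2 * r)) ≠ ⊤) :
    ∫ x, tent l r x ∂ν ≤ ν.real (Set.Icc (l - 2 * r) (l + 2 * r)) := by
  rw [← integral_indicator_one measurableSet_Icc]
  exact integral_mono (integrable_tent hr hν)
    ((integrable_indicator_iff measurableSet_Icc).2 (integrableOn_const hν))
    (tent_le_indicator hr)

theorem le_integral_tent (hr : 0 < r) (hν : ν (Set.Icc (l - 2 * r) (l + 2 * r)) ≠ ⊤) :
    ν.real (Set.Icc (l - r) (l + r)) ≤ ∫ x, tent l r x ∂ν := by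
  rw [← integral_indicator_one measurableSet_Icc]
  refine integral_mono ((integrable_indicator_iff measurableSet_Icc).2 (integrableOn_const ?_))
    (integrable_tent hr hν) (indicator_le_tent hr)
  exact measure_ne_top_of_subset (Set.Icc_subset_Icc (by linarith) (by linarith)) hν

end

namespace CellModel

variable {d N : ℕ} {S : SelfSimilarSet d N} {Y D : Type} [MeasurableSpace Y]
  [NormedAddCommGroup D] [InnerProductSpace ℝ D] [CompleteSpace D] {M : CellModel S Y D}
  {W : Weights N} {ω : ℕ → Fin N} {μ : Measure ℝ}

/-! ### The density of states -/

variable (M W ω μ) in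
/-- `μ` is the limit of the normalized counting measures with Dirichlet condition. -/
def IsDirichletLimit : Prop :=
  ∀ φ : ℝ → ℝ, Continuous φ → HasCompactSupport φ →
    Tendsto (fun n : ℕ => ((N : ℝ) ^ n)⁻¹ *
      ∫ l, φ l ∂(pencilMeasure (M.comp (M.dirichletSpace W ω n)))) atTop (𝓝 (∫ l, φ l ∂μ))

theorem pencilMeasure_dirichlet (n : ℕ) (a b : ℝ) :
    pencilMeasure (M.comp (M.dirichletSpace W ω n)) (Set.Icc a b) =
      Module.finrank ℝ (pencilSpan (M.comp (M.dirichletSpace W ω n)) (Set.Icc a b)) :=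
  pencilMeasure_Icc (M.comp_symm _) (isCompactOperator_comp_dirichletSpace n) a b

theorem pencilMeasure_dirichlet_ne_top (n : ℕ) (a b : ℝ) :
    pencilMeasure (M.comp (M.dirichletSpace W ω n)) (Set.Icc a b) ≠ ⊤ := by
  rw [pencilMeasure_dirichlet]
  exact ENNReal.natCast_ne_top _

theorem real_pencilMeasure_dirichlet (n : ℕ) (a b : ℝ) :
    (pencilMeasure (M.comp (M.dirichletSpace W ω n))).real (Set.Icc a b) =
      Module.finrank ℝ (pencilSpan (M.comp (M.dirichletSpace W ω n)) (Set.Icc a b)) := by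
  rw [Measure.real, pencilMeasure_dirichlet, ENNReal.toReal_natCast]

theorem _root_.FractalBlowUp.Weights.two_le (W : Weights N) : 2 ≤ N := by
  by_contra! h
  interval_cases N
  · have := W.sum_β
    simp at this
  · have h1 := W.sum_β
    have h2 := (W.β_mem 0).2
    simp only [Finset.univ_unique, Fin.default_eq_zero, Finset.sum_singleton] at h1
    exact absurd h1 h2.ne

/-- A free quasi-mode on the stage `n` produces at least `N ^ m` Dirichlet eigenvalues near `l` on
the stage `n + m`; after normalization this leaves mass at least `N ^ (-n)` in the limit. -/
theorem mem_support_of_hasFreeQuasimodes (hμ : IsFiniteMeasureOnCompacts μ)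
    (hlim : M.IsDirichletLimit W ω μ) {l : ℝ}
    (h : ∀ ε > 0, ∃ n, M.HasFreeQuasimodes W ω n l ε 1) : l ∈ μ.support := by
  have hN : (0 : ℝ) < N := by
    have := W.two_le
    positivity
  rw [(nhds_basis_Icc_pos l).mem_measureSupport]
  intro t ht
  obtain ⟨r, hr, rfl⟩ : ∃ r > 0, 2 * r = t := ⟨t / 2, by positivity, by ring⟩
  have hε : 0 < r / (|1 - l| + r) := by positivity
  obtain ⟨n, hn⟩ := h _ (half_pos hε)
  have h1 := hn.le_finrank (half_pos hε).le hr (half_lt_self hε)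
  have h2 : ((N : ℝ) ^ n)⁻¹ ≤ ∫ x, tent l r x ∂μ := by
    refine ge_of_tendsto (hlim _ (continuous_tent l r) (hasCompactSupport_tent hr)) ?_
    filter_upwards [eventually_ge_atTop n] with k hk
    obtain ⟨m, rfl⟩ := Nat.exists_eq_add_of_le hk
    have h3 := le_integral_tent (l := l) hr
      (pencilMeasure_dirichlet_ne_top (M := M) (W := W) (ω := ω) (n + m) _ _)
    rw [real_pencilMeasure_dirichlet] at h3
    have h4 : (N : ℝ) ^ m ≤ _ := le_trans (by exact_mod_cast h1 m) h3
    calc ((N : ℝ) ^ n)⁻¹ = ((N : ℝ) ^ (n + m))⁻¹ * N ^ m := by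
          rw [pow_add]; field_simp
      _ ≤ _ := by gcongr
  have h3 : μ (Set.Icc (l - 2 * r) (l + 2 * r)) ≠ ⊤ := isCompact_Icc.measure_lt_top.ne
  have h4 := h2.trans (integral_tent_le hr h3)
  rw [pos_iff_ne_zero]
  intro h0
  rw [Measure.real, h0] at h4
  have : (0 : ℝ) < ((N : ℝ) ^ n)⁻¹ := by positivity
  simp at h4
  linarith [pow_pos hN n]

/-- Positive mass near `l` means that the number of eigenvalues is at least a fixed multiple of `N ^
n`, which is unbounded since `N ≥ 2`. -/
theorem exists_le_finrank_of_mem_support (hμ : IsFiniteMeasureOnCompacts μ)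
    (hlim : M.IsDirichletLimit W ω μ) {l : ℝ} (hl : l ∈ μ.support) {r : ℝ} (hr : 0 < r) (k : ℕ) :
    ∃ n, k ≤ Module.finrank ℝ (pencilSpan (M.comp (M.dirichletSpace W ω n))
      (Set.Icc (l - r) (l + r))) := by
  obtain ⟨t, ht, rfl⟩ : ∃ t > 0, 2 * t = r := ⟨r / 2, by positivity, by ring⟩
  have h0 : μ (Set.Icc (l - 2 * t) (l + 2 * t)) ≠ ⊤ := isCompact_Icc.measure_lt_top.ne
  have h1 : 0 < μ.real (Set.Icc (l - t) (l + t)) := by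
    refine ENNReal.toReal_pos ?_ isCompact_Icc.measure_lt_top.ne
    exact ((nhds_basis_Icc_pos l).mem_measureSupport.1 hl t ht).ne'
  have h2 := h1.trans_le (le_integral_tent ht h0)
  set a := ∫ x, tent l t x ∂μ
  have hN : (1 : ℝ) < N := by exact_mod_cast W.two_le
  obtain ⟨n, hn1, hn2⟩ := (((hlim _ (continuous_tent l t) (hasCompactSupport_tent ht)).eventually
    (lt_mem_nhds (half_lt_self h2))).and
    ((tendsto_pow_atTop_atTop_of_one_lt hN).eventually_ge_atTop (k / (a / 2)))).exists
  refine ⟨n, ?_⟩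
  have h3 := integral_tent_le (l := l) ht
      (pencilMeasure_dirichlet_ne_top (M := M) (W := W) (ω := ω) n _ _)
  rw [real_pencilMeasure_dirichlet] at h3
  rw [div_le_iff₀ (by positivity)] at hn2
  rw [inv_mul_eq_div, lt_div_iff₀ (by positivity)] at hn1
  have h4 : (k : ℝ) ≤ _ := (hn2.trans (by linarith)).trans h3
  exact_mod_cast h4

section

variable {V : Submodule ℝ (Fam ω D)} [CompleteSpace V] (hV : M.dirichletSpaceInfty W ω ≤ V)
  (hV' : V ≤ M.neumannSpaceInfty W ω) (hμ : IsFiniteMeasureOnCompacts μ)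
  (hlim : M.IsDirichletLimit W ω μ)
include hV hV' hμ hlim

/-- It holds for every space between the Dirichlet and the Neumann one: free quasi-modes do not see
the boundary condition. -/
theorem support_eq_pencilEssSpectrum : μ.support = pencilEssSpectrum (M.comp V) := by
  ext l
  rw [mem_pencilEssSpectrum_iff (M.comp_symm V)]
  constructor
  · intro hl k ε hε
    obtain ⟨n, hn⟩ := exists_le_finrank_of_mem_support hμ hlim hl hε (k + S.F.card)
    exact (hasFreeQuasimodes_of_le_finrank n l ε k
      (finiteDimensional_pencilSpan_dirichletSpace n l ε) hn).hasQuasimodes hε.le hV hV'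
  · intro h
    exact mem_support_of_hasFreeQuasimodes hμ hlim
      fun ε hε => exists_hasFreeQuasimodes hV hV' h hε 1

theorem eigenvalue_of_notMem_support {l : ℝ} (hl : l ∈ pencilSpectrum (M.comp V))
    (hl' : l ∉ μ.support) :
    pencilKer (M.comp V) l ≠ ⊥ ∧ FiniteDimensional ℝ (pencilKer (M.comp V) l) := by
  rw [support_eq_pencilEssSpectrum hV hV' hμ hlim] at hl'
  by_contra h
  exact hl' ⟨hl, fun h' => h h'.2⟩

/-- A spectral point off the support would be an eigenvalue, and without infinite boundary its
eigenfunction yields free quasi-modes, which puts it in the support. -/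
theorem pencilSpectrum_eq_support (hb : S.boundaryInfty ω = ∅) :
    pencilSpectrum (M.comp V) = μ.support := by
  refine Set.Subset.antisymm (fun l hl => ?_) ?_
  · by_contra hl'
    obtain ⟨h1, -⟩ := eigenvalue_of_notMem_support hV hV' hμ hlim hl hl'
    obtain ⟨x, hx, hx0⟩ := Submodule.exists_mem_ne_zero_of_ne_bot h1
    refine hl' (mem_support_of_hasFreeQuasimodes hμ hlim fun ε hε =>
      exists_hasFreeQuasimodes_of_eigenvalue hb (x := x) ?_ ?_ ?_ hε)
    · have h2 := hV' x.2
      rwa [dirichletSpaceInfty, hb]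
    · exact fun h => hx0 (Subtype.ext h)
    · exact fun v hv => form_eq_zero_of_mem_pencilKer hx (hV hv)
  · rw [support_eq_pencilEssSpectrum hV hV' hμ hlim]
    exact fun l hl => hl.1

end

/-- Two independent eigenfunctions would yield free quasi-modes and put `l` in the support. -/
theorem finrank_pencilKer_eq_one (hμ : IsFiniteMeasureOnCompacts μ)
    (hlim : M.IsDirichletLimit W ω μ) (hb : (S.boundaryInfty ω).Nonempty) {l : ℝ}
    (hl' : l ∉ μ.support)
    {V : Submodule ℝ (Fam ω D)} [CompleteSpace V]
    (hV : V = M.dirichletSpaceInfty W ω ∨ V = M.neumannSpaceInfty W ω)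
    (hl : l ∈ pencilSpectrum (M.comp V)) :
    Module.finrank ℝ (pencilKer (M.comp V) l) = 1 := by
  have hV1 : M.dirichletSpaceInfty W ω ≤ V := by
    rcases hV with rfl | rfl
    exacts [le_rfl, dirichletSpaceInfty_le_neumannSpaceInfty]
  have hV2 : V ≤ M.neumannSpaceInfty W ω := by
    rcases hV with rfl | rfl
    exacts [dirichletSpaceInfty_le_neumannSpaceInfty, le_rfl]
  obtain ⟨h1, h2⟩ := eigenvalue_of_notMem_support hV1 hV2 hμ hlim hl hl'
  have h3 : 0 < Module.finrank ℝ (pencilKer (M.comp V) l) := by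
    rw [Module.finrank_pos_iff, Submodule.nontrivial_iff_ne_bot]
    exact h1
  by_contra h4
  refine hl' (mem_support_of_hasFreeQuasimodes hμ hlim fun ε hε => ?_)
  set G := (pencilKer (M.comp V) l).map V.subtype with hG
  have hG2 : 2 ≤ Module.finrank ℝ G := by
    rw [hG, Submodule.finrank_map_subtype_eq]
    omega
  have hGV : G ≤ V := Submodule.map_subtype_le _ _
  have hform : ∀ x ∈ G, ∀ v ∈ V, M.form l x v = 0 := by
    rintro _ ⟨x, hx, rfl⟩ v hv
    exact form_eq_zero_of_mem_pencilKer hx hv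
  rcases hV with rfl | rfl
  · obtain ⟨τ₀, y₀, hy₀⟩ := exists_map_vertex_mem_boundaryInfty M hb
    exact exists_hasFreeQuasimodes_of_two_le_finrank G hG2 hGV hform hy₀ hε
  · exact exists_hasFreeQuasimodes_of_neumann G hG2 hGV hform hb hε

end CellModel

namespace CellModel

variable {d N : ℕ} {S : SelfSimilarSet d N} {Y D : Type} [MeasurableSpace Y]
  [NormedAddCommGroup D] [InnerProductSpace ℝ D] (M : CellModel S Y D)
  (W : Weights N) {ω : ℕ → Fin N}

/-! ### The functions represented by families -/

/-- The parametrization of the cell `τ` by the reference cell. -/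
noncomputable def cellPt (τ : Cell ω) (y : Y) : EuclideanSpace ℝ (Fin d) := τ.map S (M.pt y)

theorem measurableEmbedding_cellPt (τ : Cell ω) : MeasurableEmbedding (M.cellPt τ) :=
  ((τ.map S).toHomeomorph.measurableEmbedding).comp M.pt_emb

/-- The measure on the cell `τ`. -/
noncomputable def cellMeasure (τ : Cell ω) : Measure (EuclideanSpace ℝ (Fin d)) :=
  ENNReal.ofReal (τ.weight W) • M.m.map (M.cellPt τ)

/-- The measure on the union of the cells in `C`. -/
noncomputable def refMeasure (C : Set (Cell ω)) : Measure (EuclideanSpace ℝ (Fin d)) :=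
  Measure.sum fun τ : C => M.cellMeasure W τ.1

theorem refMeasure_upTo (n : ℕ) :
    M.refMeasure W (Cell.upTo ω n) = ∑ τ ∈ Cell.stage ω n, M.cellMeasure W τ := by
  rw [← Cell.coe_stage]
  exact Measure.sum_coe_finset (Cell.stage ω n) (M.cellMeasure W)

theorem refMeasure_univ :
    M.refMeasure W (Set.univ : Set (Cell ω)) = ⨆ n, M.refMeasure W (Cell.upTo ω n) := by
  refine le_antisymm ?_ (iSup_le fun n => ?_)
  · refine Measure.le_iff.2 fun A hA => ?_
    rw [refMeasure, Measure.sum_apply _ hA, tsum_univ (fun τ => M.cellMeasure W τ A)]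
    refine ENNReal.summable.tsum_le_of_sum_le fun s => ?_
    obtain ⟨n, hn⟩ := ((tendsto_atTop.1 (Cell.tendsto_stage (ω := ω))) s).exists
    calc ∑ τ ∈ s, M.cellMeasure W τ A ≤ ∑ τ ∈ Cell.stage ω n, M.cellMeasure W τ A :=
          Finset.sum_le_sum_of_subset hn
      _ = M.refMeasure W (Cell.upTo ω n) A := by
          rw [refMeasure_upTo, Measure.finsetSum_apply]
      _ ≤ _ := (le_iSup (fun n => M.refMeasure W (Cell.upTo ω n)) n) A
  · refine Measure.le_iff.2 fun A hA => ?_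
    rw [refMeasure_upTo, Measure.finsetSum_apply, refMeasure, Measure.sum_apply _ hA,
      tsum_univ (fun τ => M.cellMeasure W τ A)]
    exact ENNReal.sum_le_tsum _

/-- The function `u` on the union of the cells in `C` is represented by the family `x`. -/
def Represents (C : Set (Cell ω)) (x : Fam ω D) (u : EuclideanSpace ℝ (Fin d) → ℝ) : Prop :=
  ∀ τ ∈ C, ∀ y, u (M.cellPt τ y) = M.val W τ y x

variable {M W} {C : Set (Cell ω)} {Z : Set (EuclideanSpace ℝ (Fin d))}

variable (M W C) in
open Classical in
/-- The function represented by a family, extended by zero. -/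
noncomputable def toFunction : Fam ω D →ₗ[ℝ] (EuclideanSpace ℝ (Fin d) → ℝ) where
  toFun x z := if h : ∃ q : C × Y, M.cellPt q.1.1 q.2 = z then
    M.val W h.choose.1.1 h.choose.2 x else 0
  map_add' x x' := by
    ext1 z
    simp only [Pi.add_apply]
    split_ifs
    · exact map_add _ _ _
    · rw [add_zero]
  map_smul' c x := by
    ext1 z
    simp only [Pi.smul_apply]
    split_ifs
    · exact map_smul _ _ _
    · rw [smul_zero]

theorem represents_toFunction {x : Fam ω D} (hx : x ∈ M.space W C Z) :
    M.Represents W C x (M.toFunction W C x) := by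
  intro τ hτ y
  have h : ∃ q : C × Y, M.cellPt q.1.1 q.2 = M.cellPt τ y := ⟨(⟨τ, hτ⟩, y), rfl⟩
  refine (dif_pos h).trans ?_
  exact val_eq hx h.choose.1.2 hτ h.choose_spec

theorem integral_cellMeasure (τ : Cell ω) (g : EuclideanSpace ℝ (Fin d) → ℝ) :
    ∫ z, g z ∂(M.cellMeasure W τ) = τ.weight W * ∫ y, g (M.cellPt τ y) ∂M.m := by
  rw [cellMeasure, integral_smul_measure, (M.measurableEmbedding_cellPt τ).integral_map,
    ENNReal.toReal_ofReal (τ.weight_pos W).le, smul_eq_mul]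

theorem integrable_cellMeasure_iff (τ : Cell ω) (g : EuclideanSpace ℝ (Fin d) → ℝ) :
    Integrable g (M.cellMeasure W τ) ↔ Integrable (fun y => g (M.cellPt τ y)) M.m := by
  rw [cellMeasure, integrable_smul_measure (by simpa using τ.weight_pos W) ENNReal.ofReal_ne_top,
    (M.measurableEmbedding_cellPt τ).integrable_map_iff]
  rfl

theorem weight_mul_val (τ : Cell ω) (y y' : Y) (x x' : Fam ω D) :
    τ.weight W * (M.val W τ y x * M.val W τ y' x') = M.ev (x τ) y * M.ev (x' τ) y' := by
  have h1 := (sqrt_weight_pos W τ).ne'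
  have h2 : τ.weight W = √(τ.weight W) * √(τ.weight W) :=
    (Real.mul_self_sqrt (τ.weight_pos W).le).symm
  rw [val_apply, val_apply]
  nth_rewrite 1 [h2]
  field_simp

section

variable {x x' : Fam ω D} {u u' : EuclideanSpace ℝ (Fin d) → ℝ} (hu : M.Represents W C x u)
  (hu' : M.Represents W C x' u')
include hu hu'

theorem integral_cellMeasure_mul {τ : Cell ω} (hτ : τ ∈ C) :
    ∫ z, u z * u' z ∂(M.cellMeasure W τ) = ∫ y, M.ev (x τ) y * M.ev (x' τ) y ∂M.m := by
  rw [integral_cellMeasure, ← integral_const_mul]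
  refine integral_congr_ae (Eventually.of_forall fun y => ?_)
  simp only [hu τ hτ y, hu' τ hτ y]
  exact weight_mul_val τ y y x x'

theorem integrable_cellMeasure_mul {τ : Cell ω} (hτ : τ ∈ C) :
    Integrable (fun z => u z * u' z) (M.cellMeasure W τ) := by
  rw [integrable_cellMeasure_iff]
  refine ((M.integrable_mul (x τ) (x' τ)).const_mul (τ.weight W)⁻¹).congr
    (Eventually.of_forall fun y => ?_)
  simp only [hu τ hτ y, hu' τ hτ y]
  rw [← weight_mul_val (M := M) (W := W), inv_mul_cancel_left₀ (τ.weight_pos W).ne']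

end

theorem Represents.aestronglyMeasurable {x : Fam ω D} {u : EuclideanSpace ℝ (Fin d) → ℝ}
    (hu : M.Represents W C x u) : AEStronglyMeasurable u (M.refMeasure W C) := by
  rw [refMeasure, aestronglyMeasurable_sum_measure_iff]
  intro τ
  refine AEStronglyMeasurable.smul_measure ?_ _
  rw [(M.measurableEmbedding_cellPt τ.1).aestronglyMeasurable_map_iff]
  have h : u ∘ M.cellPt τ.1 = fun y => M.val W τ.1 y x := funext fun y => hu τ.1 τ.2 y
  rw [h]
  exact ((M.ev_meas (x τ.1)).const_mul _).aestronglyMeasurable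

theorem Represents.memLp {x : Fam ω D} {u : EuclideanSpace ℝ (Fin d) → ℝ}
    (hu : M.Represents W C x u) : MemLp u 2 (M.refMeasure W C) := by
  rw [memLp_two_iff_integrable_sq hu.aestronglyMeasurable]
  refine integrable_sum_measure (fun τ => ?_) ?_
  · simpa only [sq] using integrable_cellMeasure_mul hu hu τ.2
  · refine Summable.of_nonneg_of_le (fun τ => integral_nonneg fun z => norm_nonneg _)
      (fun τ => ?_) ((summable_norm_sq x).subtype C)
    calc ∫ z, ‖u z ^ 2‖ ∂(M.cellMeasure W τ.1) = ∫ z, u z * u z ∂(M.cellMeasure W τ.1) := by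
          refine integral_congr_ae (Eventually.of_forall fun z => ?_)
          simp [sq]
      _ = ∫ y, M.ev (x τ) y ^ 2 ∂M.m := by
          rw [integral_cellMeasure_mul hu hu τ.2]
          simp [sq]
      _ ≤ _ := M.integral_le _

theorem eq_zero_of_represents {x : Fam ω D} (hx : x ∈ M.space W C Z)
    {u : EuclideanSpace ℝ (Fin d) → ℝ} (hu : M.Represents W C x u)
    (h0 : u =ᵐ[M.refMeasure W C] 0) : x = 0 := by
  ext1
  funext τ
  by_cases hτ : τ ∈ C
  · have h1 := Measure.ae_sum_iff.1 h0 ⟨τ, hτ⟩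
    rw [cellMeasure, Measure.ae_ennreal_smul_measure_iff (by simpa using τ.weight_pos W),
      (M.measurableEmbedding_cellPt τ).ae_map_iff] at h1
    refine M.ev_ae _ ?_
    filter_upwards [h1] with y hy
    rw [hu τ hτ y] at hy
    exact (M.val_eq_zero_iff W).1 hy
  · exact apply_eq_zero hx hτ

variable [CompleteSpace D]

/-- On each cell the weight of the measure cancels the two square roots in the values, which leaves
the inner product of the reference cell. -/
theorem integral_mul_eq {x x' : Fam ω D} (hx : x ∈ M.space W C Z)
    {u u' : EuclideanSpace ℝ (Fin d) → ℝ} (hu : M.Represents W C x u)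
    (hu' : M.Represents W C x' u') :
    ∫ z, u z * u' z ∂(M.refMeasure W C) = inner ℝ (M.famResolvent ω x) x' := by
  have h1 : Integrable (fun z => u z * u' z) (M.refMeasure W C) :=
    hu.memLp.integrable_mul hu'.memLp
  have h2 := hasSum_integral_measure h1
  have h3 : HasSum (fun τ : C => ∫ z, u z * u' z ∂(M.cellMeasure W τ.1))
      (inner ℝ (M.famResolvent ω x) x') := by
    have h4 := lp.hasSum_inner (𝕜 := ℝ) (M.famResolvent ω x) x'
    rw [← hasSum_subtype_iff_of_support_subset (s := C)] at h4
    · refine h4.congr_fun ?_ |> fun h => h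
      intro τ
      rw [integral_cellMeasure_mul hu hu' τ.2, ← inner_resolvent]
      rfl
    · intro τ hτ
      by_contra h
      refine hτ ?_
      simp only [famResolvent_apply]
      rw [apply_eq_zero hx h, map_zero, inner_zero_left]
  exact h2.unique h3

variable (M W C Z) in
/-- The functions represented by families, as elements of `L²`. -/
noncomputable def toL2 : M.space W C Z →L[ℝ] Lp ℝ 2 (M.refMeasure W C) :=
  LinearMap.mkContinuous
    { toFun := fun x => (represents_toFunction x.2).memLp.toLp (M.toFunction W C x)
      map_add' := fun x x' => by
        rw [← MemLp.toLp_add]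
        congr 1
        exact map_add _ _ _
      map_smul' := fun c x => by
        rw [RingHom.id_apply, ← MemLp.toLp_const_smul]
        congr 1
        exact map_smul _ _ _ } 1 fun x => by
    rw [one_mul]
    refine le_of_sq_le_sq ?_ (norm_nonneg _)
    rw [← real_inner_self_eq_norm_sq, L2.inner_def]
    have h1 : ∫ z, inner ℝ (((represents_toFunction x.2).memLp.toLp (M.toFunction W C x)) z)
        (((represents_toFunction x.2).memLp.toLp (M.toFunction W C x)) z) ∂(M.refMeasure W C) =
        inner ℝ (M.famResolvent ω x) (x : Fam ω D) := by
      rw [← integral_mul_eq x.2 (represents_toFunction x.2) (represents_toFunction x.2)]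
      refine integral_congr_ae ?_
      filter_upwards [(represents_toFunction x.2).memLp.coeFn_toLp] with z hz
      rw [hz]
      rfl
    refine h1.le.trans ((real_inner_le_norm _ _).trans ?_)
    rw [sq]
    exact mul_le_mul_of_nonneg_right (M.norm_famResolvent_le _) (norm_nonneg _)

theorem coeFn_toL2 (x : M.space W C Z) :
    M.toL2 W C Z x =ᵐ[M.refMeasure W C] M.toFunction W C x :=
  (represents_toFunction x.2).memLp.coeFn_toLp

theorem coeFn_toL2_of_represents {x : M.space W C Z} {u : EuclideanSpace ℝ (Fin d) → ℝ}
    (hu : M.Represents W C x u) : M.toL2 W C Z x =ᵐ[M.refMeasure W C] u := by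
  refine (coeFn_toL2 x).trans ?_
  have h1 : M.Represents W C 0 (M.toFunction W C x - u) := fun τ hτ y => by
    rw [Pi.sub_apply, represents_toFunction x.2 τ hτ y, hu τ hτ y, sub_self, map_zero]
  have h2 : M.toFunction W C x - u =ᵐ[M.refMeasure W C] 0 := by
    rw [EventuallyEq, refMeasure, Measure.ae_sum_iff]
    intro τ
    rw [cellMeasure, Measure.ae_ennreal_smul_measure_iff (by simpa using τ.1.weight_pos W),
      (M.measurableEmbedding_cellPt τ.1).ae_map_iff]
    exact Eventually.of_forall fun y => by rw [h1 τ.1 τ.2 y, map_zero]; rfl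
  filter_upwards [h2] with z hz
  exact sub_eq_zero.1 hz

theorem inner_toL2 (x x' : M.space W C Z) :
    inner ℝ (M.comp (M.space W C Z) x) x' = inner ℝ (M.toL2 W C Z x) (M.toL2 W C Z x') := by
  rw [inner_comp, L2.inner_def,
    ← integral_mul_eq x.2 (represents_toFunction x.2) (represents_toFunction x'.2)]
  refine integral_congr_ae ?_
  filter_upwards [coeFn_toL2 x, coeFn_toL2 x'] with z hz hz'
  rw [hz, hz']
  simp [mul_comm]

theorem injective_toL2 : Function.Injective (M.toL2 W C Z) := by
  rw [injective_iff_map_eq_zero]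
  intro x hx
  refine Subtype.ext (eq_zero_of_represents x.2 (represents_toFunction x.2) ?_)
  refine (coeFn_toL2 x).symm.trans ?_
  rw [hx]
  exact Lp.coeFn_zero _ _ _

variable (M W C Z) in
/-- The energy form `Q` is given by the families which represent functions on the cells in `C`,
vanishing on `Z`. -/
structure IsFormOf (Q : EnergyForm (EuclideanSpace ℝ (Fin d))) : Prop where
  ref_eq : Q.ref = M.refMeasure W C
  mem_dom_iff : ∀ u, u ∈ Q.dom ↔ ∃ x ∈ M.space W C Z, M.Represents W C x u
  energy_eq : ∀ x ∈ M.space W C Z, ∀ x' ∈ M.space W C Z, ∀ u u', M.Represents W C x u →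
    M.Represents W C x' u' → Q.energy u u' = M.form 0 x x'

theorem IsFormOf.exists_isRealization {Q : EnergyForm (EuclideanSpace ℝ (Fin d))}
    (h : M.IsFormOf W C Z Q) : ∃ j : M.space W C Z →L[ℝ] Lp ℝ 2 Q.ref, IsRealization Q j ∧
      ∀ x x', inner ℝ (M.comp (M.space W C Z) x) x' = inner ℝ (j x) (j x') := by
  -- The type `Lp ℝ 2 Q.ref` depends on the measure, so the equality of measures has to be
  -- substituted.
  obtain ⟨ref, dom, energy⟩ := Q
  obtain ⟨h1, h2, h3⟩ := h
  simp only at h1 h2 h3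
  subst h1
  refine ⟨M.toL2 W C Z, ⟨injective_toL2, fun x => ?_, fun u hu => ?_, ?_⟩, inner_toL2⟩
  · exact ⟨_, (h2 _).2 ⟨x, x.2, represents_toFunction x.2⟩, coeFn_toL2 x⟩
  · obtain ⟨x, hx, hxu⟩ := (h2 u).1 hu
    exact ⟨⟨x, hx⟩, coeFn_toL2_of_represents hxu⟩
  · intro x x' u hu u' hu' hxu hxu'
    have key : ∀ (x : M.space W C Z) (u : EuclideanSpace ℝ (Fin d) → ℝ), u ∈ dom →
        M.toL2 W C Z x =ᵐ[M.refMeasure W C] u → M.Represents W C x u := by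
      intro x u hu hxu
      obtain ⟨z, hz, hzu⟩ := (h2 u).1 hu
      have h4 : M.toL2 W C Z x = M.toL2 W C Z ⟨z, hz⟩ :=
        Lp.ext (hxu.trans (coeFn_toL2_of_represents (x := ⟨z, hz⟩) hzu).symm)
      rw [injective_toL2 h4]
      exact hzu
    rw [← inner_toL2, inner_comp]
    have h5 := h3 x x.2 x' x'.2 u u' (key x u hu hxu) (key x' u' hu' hxu')
    simp only
    rw [h5, form, pencil_apply, sub_zero, one_smul, inner_sub_left]
    rfl

end CellModel

/-- The set on which a boundary condition requires functions to vanish. -/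
def BoundaryCondition.zeroSet {E : Type*} : BoundaryCondition → Set E → Set E
  | .neumann, _ => ∅
  | .dirichlet, B => B

theorem BoundaryCondition.holds_iff {E : Type*} (c : BoundaryCondition) (B : Set E) (u : E → ℝ) :
    c.Holds B u ↔ ∀ z ∈ c.zeroSet B, u z = 0 := by
  cases c
  · simp [BoundaryCondition.Holds, BoundaryCondition.zeroSet]
  · rfl

theorem BoundaryCondition.zeroSet_subset {E : Type*} (c : BoundaryCondition) (B : Set E) :
    c.zeroSet B ⊆ B := by
  cases c
  · exact Set.empty_subset _
  · exact subset_rfl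

/-! ### Energy forms given by a cell model -/

namespace CellModel

variable {d N : ℕ} {S : SelfSimilarSet d N} {Y D : Type} [MeasurableSpace Y]
  [NormedAddCommGroup D] [InnerProductSpace ℝ D] {M : CellModel S Y D}
  {W : Weights N} {ω : ℕ → Fin N} {C : Set (Cell ω)} {Z : Set (EuclideanSpace ℝ (Fin d))}

/-- Functions whose restrictions to the cells have square summable norms are represented by
families. -/
theorem exists_represents {u : EuclideanSpace ℝ (Fin d) → ℝ} {f : Cell ω → D}
    (hf : ∀ τ ∈ C, ∀ y, M.ev (f τ) y = u (M.cellPt τ y))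
    (hs : Summable fun τ : C => τ.1.weight W * ‖f τ‖ ^ 2) (hZ : ∀ z ∈ Z, u z = 0) :
    ∃ x ∈ M.space W C Z, M.Represents W C x u := by
  classical
  let g : Cell ω → D := fun τ => if τ ∈ C then √(τ.weight W) • f τ else 0
  have hg : ∀ τ ∈ C, g τ = √(τ.weight W) • f τ := fun τ hτ => if_pos hτ
  have hg' : ∀ τ ∉ C, g τ = 0 := fun τ hτ => if_neg hτ
  have hmem : Memℓp g 2 := by
    refine memℓp_gen ?_
    refine (summable_subtype_iff_indicator
      (f := fun τ : Cell ω => τ.weight W * ‖f τ‖ ^ 2).1 hs).congr fun τ => ?_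
    by_cases hτ : τ ∈ C
    · rw [Set.indicator_of_mem hτ, hg τ hτ, norm_smul, Real.norm_of_nonneg (Real.sqrt_nonneg _)]
      norm_num
      rw [mul_pow, Real.sq_sqrt (τ.weight_pos W).le]
    · rw [Set.indicator_of_notMem hτ, hg' τ hτ]
      simp
  let x : Fam ω D := ⟨g, hmem⟩
  have hx : M.Represents W C x u := by
    intro τ hτ y
    rw [val_apply]
    change _ = _ * M.ev (g τ) y
    rw [hg τ hτ, map_smul, Pi.smul_apply, smul_eq_mul,
      inv_mul_cancel_left₀ (sqrt_weight_pos W τ).ne', hf τ hτ y]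
  refine ⟨x, ⟨hg', fun τ hτ τ' hτ' y y' h => ?_, fun τ hτ y h => ?_⟩, hx⟩
  · rw [← hx τ hτ y, ← hx τ' hτ' y']
    exact congrArg u h
  · rw [← hx τ hτ y]
    exact hZ _ h

theorem Represents.ev_eq {x : Fam ω D} {u : EuclideanSpace ℝ (Fin d) → ℝ}
    (h : M.Represents W C x u) {τ : Cell ω} (hτ : τ ∈ C) (y : Y) :
    M.ev ((√(τ.weight W))⁻¹ • x τ) y = u (M.cellPt τ y) := by
  rw [h τ hτ y, val_apply, map_smul]
  rfl

theorem Represents.eq_zero {x : Fam ω D} {u : EuclideanSpace ℝ (Fin d) → ℝ}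
    (h : M.Represents W C x u) (hx : x ∈ M.space W C Z)
    (hZ : ∀ z ∈ Z, ∃ τ ∈ C, ∃ y, M.cellPt τ y = z) {z : EuclideanSpace ℝ (Fin d)} (hz : z ∈ Z) :
    u z = 0 := by
  obtain ⟨τ, hτ, y, rfl⟩ := hZ z hz
  rw [h τ hτ y]
  exact val_eq_zero_of_mem hx hτ hz

theorem exists_cellPt_of_mem_boundary (M : CellModel S Y D) {n : ℕ}
    {z : EuclideanSpace ℝ (Fin d)} (hz : z ∈ S.boundary ω n) :
    ∃ τ ∈ Cell.upTo ω n, ∃ y, M.cellPt τ y = z := by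
  obtain ⟨τ, hτ, p, hp, he⟩ := Cell.exists_map_eq S hz
  obtain ⟨y, hy⟩ := M.exists_pt p hp
  exact ⟨τ, hτ, y, by rw [cellPt, hy, he]⟩

theorem exists_cellPt_of_mem_boundaryInfty (M : CellModel S Y D)
    {z : EuclideanSpace ℝ (Fin d)} (hz : z ∈ S.boundaryInfty ω) :
    ∃ τ ∈ (Set.univ : Set (Cell ω)), ∃ y, M.cellPt τ y = z := by
  obtain ⟨n, hn⟩ := (Cell.eventually_mem_boundary S hz).exists
  obtain ⟨τ, -, y, hy⟩ := M.exists_cellPt_of_mem_boundary hn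
  exact ⟨τ, Set.mem_univ τ, y, hy⟩

variable (M W ω) in
/-- The forms `E n` are sums of copies of the form `⟨f, g⟩ - ∫ f g` on the cells of the `n`-th
stage. -/
def IsCellSum (E : ℕ → (EuclideanSpace ℝ (Fin d) → ℝ) → (EuclideanSpace ℝ (Fin d) → ℝ) → ℝ) :
    Prop :=
  ∀ (n : ℕ) (u u' : EuclideanSpace ℝ (Fin d) → ℝ) (f f' : Cell ω → D),
    (∀ τ ∈ Cell.upTo ω n, ∀ y, M.ev (f τ) y = u (M.cellPt τ y)) →
    (∀ τ ∈ Cell.upTo ω n, ∀ y, M.ev (f' τ) y = u' (M.cellPt τ y)) →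
    E n u u' = ∑ τ ∈ Cell.stage ω n,
      τ.weight W * (inner ℝ (f τ) (f' τ) - ∫ y, M.ev (f τ) y * M.ev (f' τ) y ∂M.m)

variable [CompleteSpace D]
  {E : ℕ → (EuclideanSpace ℝ (Fin d) → ℝ) → (EuclideanSpace ℝ (Fin d) → ℝ) → ℝ}

/-- At `l = 0` the pencil is the identity minus the resolvent, whose form is the energy: full inner
product minus `L²` inner product. -/
theorem IsCellSum.eq_form (hE : M.IsCellSum W ω E) {n : ℕ} (hC : Cell.upTo ω n ⊆ C)
    {x x' : Fam ω D} {u u' : EuclideanSpace ℝ (Fin d) → ℝ} (hu : M.Represents W C x u)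
    (hu' : M.Represents W C x' u') :
    E n u u' = M.form 0 (FractalBlowUp.restr (Cell.stage ω n) x) x' := by
  rw [hE n u u' (fun τ => (√(τ.weight W))⁻¹ • x τ) (fun τ => (√(τ.weight W))⁻¹ • x' τ)
    (fun τ hτ y => hu.ev_eq (hC hτ) y) (fun τ hτ y => hu'.ev_eq (hC hτ) y),
    form_eq_sum M 0 fun τ hτ => restr_of_notMem hτ x]
  refine Finset.sum_congr rfl fun τ hτ => ?_
  rw [restr_of_mem hτ, ← inner_resolvent, ← inner_sub_left, map_smul, ← smul_sub,
    real_inner_smul_left, real_inner_smul_right, ← mul_assoc, ← mul_assoc, pencil_apply, sub_zero,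
    one_smul]
  have h1 := (sqrt_weight_pos W τ).ne'
  have h2 : τ.weight W * (√(τ.weight W))⁻¹ * (√(τ.weight W))⁻¹ = 1 := by
    nth_rewrite 1 [← Real.mul_self_sqrt (τ.weight_pos W).le]
    field_simp
  rw [h2, one_mul]

theorem IsCellSum.tendsto (hE : M.IsCellSum W ω E)
    {x x' : Fam ω D} {u u' : EuclideanSpace ℝ (Fin d) → ℝ} (hu : M.Represents W Set.univ x u)
    (hu' : M.Represents W Set.univ x' u') :
    Tendsto (fun n => E n u u') atTop (𝓝 (M.form 0 x x')) := by
  have h1 : Tendsto (fun n => FractalBlowUp.restr (Cell.stage ω n) x) atTop (𝓝 x) :=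
    (tendsto_restr x).comp (Cell.tendsto_stage (ω := ω))
  have h2 := (((pencil (M.famResolvent ω) 0).continuous.tendsto x).comp h1).inner (𝕜 := ℝ)
    (tendsto_const_nhds (x := x'))
  exact h2.congr fun n => (hE.eq_form (Set.subset_univ _) hu hu').symm

theorem isFormOf_upTo {n : ℕ} {Q : EnergyForm (EuclideanSpace ℝ (Fin d))}
    (href : Q.ref = M.refMeasure W (Cell.upTo ω n))
    (hdom : ∀ u, u ∈ Q.dom ↔ ∃ x ∈ M.space W (Cell.upTo ω n) Z,
      M.Represents W (Cell.upTo ω n) x u)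
    (hE : M.IsCellSum W ω E) (henergy : Q.energy = E n) :
    M.IsFormOf W (Cell.upTo ω n) Z Q := by
  refine ⟨href, hdom, fun x hx x' hx' u u' hu hu' => ?_⟩
  rw [henergy, hE.eq_form subset_rfl hu hu',
    restr_eq_self fun τ hτ => apply_eq_zero hx fun h => hτ (Cell.mem_stage.2 h)]

theorem isFormOf_univ {Q : EnergyForm (EuclideanSpace ℝ (Fin d))}
    (href : Q.ref = M.refMeasure W (Set.univ : Set (Cell ω)))
    (hdom : ∀ u, u ∈ Q.dom ↔ ∃ x ∈ M.space W (Set.univ : Set (Cell ω)) Z,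
      M.Represents W Set.univ x u)
    (hE : M.IsCellSum W ω E)
    (henergy : Q.energy = fun u v => limUnder atTop fun n => E n u v) :
    M.IsFormOf W (Set.univ : Set (Cell ω)) Z Q := by
  refine ⟨href, hdom, fun x _ x' _ u u' hu hu' => ?_⟩
  rw [henergy]
  exact (hE.tendsto hu hu').limUnder_eq

theorem isDirichletLimit_of_isDensityOfStates {μ : Measure ℝ}
    {Q : ℕ → BoundaryCondition → EnergyForm (EuclideanSpace ℝ (Fin d))}
    (hQ : ∀ n, M.IsFormOf W (Cell.upTo ω n) (S.boundary ω n) (Q n .dirichlet))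
    (hμ : IsDensityOfStates N Q μ) : M.IsDirichletLimit W ω μ := by
  intro φ hφ hφ'
  refine (hμ.2 .dirichlet φ hφ hφ').congr fun n => ?_
  obtain ⟨j, hj, hT⟩ := (hQ n).exists_isRealization
  rw [hj.countingMeasure_eq hT]

/-- The spectra on the blow-up and the density of states of forms given by a cell model. -/
theorem spectrum_of_isDensityOfStates {μ : Measure ℝ}
    {Q : ℕ → BoundaryCondition → EnergyForm (EuclideanSpace ℝ (Fin d))}
    {Q' : BoundaryCondition → EnergyForm (EuclideanSpace ℝ (Fin d))}
    (hQ : ∀ n, M.IsFormOf W (Cell.upTo ω n) (S.boundary ω n) (Q n .dirichlet))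
    (hQ' : ∀ c : BoundaryCondition, M.IsFormOf W (Set.univ : Set (Cell ω))
      (c.zeroSet (S.boundaryInfty ω)) (Q' c))
    (hμ : IsDensityOfStates N Q μ) :
    (S.boundaryInfty ω = ∅ →
      ∀ c, μ.support = (Q' c).spectrum ∧ (Q' c).spectrum = (Q' c).essSpectrum) ∧
    ((S.boundaryInfty ω).Nonempty →
      (∀ c, μ.support = (Q' c).essSpectrum) ∧
      ∀ c, ∀ l ∈ (Q' c).spectrum \ μ.support, (Q' c).IsEigenvalue l →
        Module.finrank ℝ ((Q' c).eigenspace l) = 1) := by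
  have hlim := isDirichletLimit_of_isDensityOfStates hQ hμ
  have hfin := hμ.1
  have hle : ∀ c : BoundaryCondition, M.dirichletSpaceInfty W ω ≤
      M.space W Set.univ (c.zeroSet (S.boundaryInfty ω)) := fun c =>
    space_anti (c.zeroSet_subset _)
  have hle' : ∀ c : BoundaryCondition, M.space W Set.univ (c.zeroSet (S.boundaryInfty ω)) ≤
      M.neumannSpaceInfty W ω := fun c => space_anti (Set.empty_subset _)
  have hess : ∀ c, μ.support = (Q' c).essSpectrum := fun c => by
    obtain ⟨j, hj, hT⟩ := (hQ' c).exists_isRealization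
    rw [hj.essSpectrum_eq hT]
    exact support_eq_pencilEssSpectrum (hle c) (hle' c) hfin hlim
  refine ⟨fun hb c => ?_, fun hb => ⟨hess, fun c l hl _ => ?_⟩⟩
  · have h1 : μ.support = (Q' c).spectrum := by
      obtain ⟨j, hj, hT⟩ := (hQ' c).exists_isRealization
      rw [hj.spectrum_eq hT]
      exact (pencilSpectrum_eq_support (hle c) (hle' c) hfin hlim hb).symm
    exact ⟨h1, h1.symm.trans (hess c)⟩
  · obtain ⟨j, hj, hT⟩ := (hQ' c).exists_isRealization
    rw [hj.finrank_eigenspace hT]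
    refine finrank_pencilKer_eq_one hfin hlim hb hl.2 ?_ ?_
    · cases c
      exacts [Or.inr rfl, Or.inl rfl]
    · rw [← hj.spectrum_eq hT]
      exact hl.1

end CellModel

/-! ### Cells given by words and their weights -/

namespace Cell

variable {d N : ℕ} {ω : ℕ → Fin N}

theorem weight_ofWord (W : Weights N) {n : ℕ} (w : Fin n → Fin N) :
    (ofWord ω w).weight W = (∏ k : Fin n, (W.β (ω k))⁻¹) * ∏ k, W.β (w k) := by
  rw [weight_eq W (ofWord_mem w)]
  simp only [div_eq_inv_mul]
  rw [Finset.prod_mul_distrib, Finset.prod_range]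
  congr 1
  rw [← Finset.prod_range_reflect, Finset.prod_range]
  exact Finset.prod_congr rfl fun k _ => by rw [ofWord_apply]

/-- Here the constancy of `α i * β i` enters: `(β i)⁻¹ = γ α i`, and the powers of `γ` from the
letters of `ω` and of `w` cancel. So one weight serves both energy and measure. -/
theorem weight_ofWord_eq (W : Weights N) {n : ℕ} (w : Fin n → Fin N) :
    (ofWord ω w).weight W = (∏ k : Fin n, W.α (ω k)) * ∏ k, (W.α (w k))⁻¹ := by
  obtain ⟨γ, hγ⟩ := W.proportional
  have h1 : ∀ i, (W.β i)⁻¹ = γ * W.α i := fun i => by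
    have := (W.α_mem i).1.ne'
    rw [← hγ i, mul_inv, mul_comm, mul_inv_cancel_left₀ this]
  have h2 : ∀ i, W.β i = γ⁻¹ * (W.α i)⁻¹ := fun i => by
    rw [← inv_inv (W.β i), h1 i, mul_inv]
  have h3 : ∀ _ : Fin n, γ ≠ 0 := fun k => by
    rw [← hγ (ω k)]
    exact inv_ne_zero (mul_pos (W.α_mem _).1 (W.β_mem _).1).ne'
  rw [weight_ofWord]
  simp only [h1]
  rw [Finset.prod_congr rfl fun k _ => h2 (w k), Finset.prod_mul_distrib, Finset.prod_mul_distrib,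
    mul_mul_mul_comm, ← Finset.prod_mul_distrib, Finset.prod_eq_one, one_mul]
  intro k _
  exact mul_inv_cancel₀ (h3 k)

theorem iter_ofWord (S : SelfSimilarSet d N) {n : ℕ} (w : Fin n → Fin N) :
    S.iter (ofWord ω w).1 n = S.wordMap w := by
  rw [← S.wordMap_eq_iter]
  congr 1
  ext1 k
  exact ofWord_apply w k

theorem map_ofWord (S : SelfSimilarSet d N) {n : ℕ} (w : Fin n → Fin N)
    (x : EuclideanSpace ℝ (Fin d)) :
    (ofWord ω w).map S x = S.blowUp ω n (S.wordMap w x) := by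
  rw [map_apply S (ofWord_mem w), iter_ofWord]

end Cell

/-! ### The lattice case -/

namespace LatticeData

variable {d N : ℕ} {S : SelfSimilarSet d N} (L : LatticeData S)

/-- Summation by parts with the symmetry of `a`; it makes symmetry and positivity of the energy
visible. -/
theorem two_mul_sum_A (f g : S.F → ℝ) :
    2 * ∑ x, L.A f x * g x = ∑ x, ∑ y, L.a x y * ((f x - f y) * (g x - g y)) := by
  have h1 : ∑ x, L.A f x * g x = ∑ x, ∑ y, L.a x y * ((f x - f y) * g x) := by
    refine Finset.sum_congr rfl fun x _ => ?_
    rw [A, neg_mul, Finset.sum_mul, ← Finset.sum_neg_distrib]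
    exact Finset.sum_congr rfl fun y _ => by ring
  have h2 : ∑ x, L.A f x * g x = ∑ x, ∑ y, L.a x y * ((f y - f x) * g y) := by
    rw [h1, Finset.sum_comm]
    refine Finset.sum_congr rfl fun x _ => Finset.sum_congr rfl fun y _ => ?_
    rw [L.a_symm]
  rw [two_mul]
  nth_rewrite 1 [h1]
  rw [h2, ← Finset.sum_add_distrib]
  refine Finset.sum_congr rfl fun x _ => ?_
  rw [← Finset.sum_add_distrib]
  exact Finset.sum_congr rfl fun y _ => by ring

theorem sum_A_comm (f g : S.F → ℝ) : ∑ x, L.A f x * g x = ∑ x, L.A g x * f x := by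
  have h : 2 * ∑ x, L.A f x * g x = 2 * ∑ x, L.A g x * f x := by
    rw [two_mul_sum_A, two_mul_sum_A]
    refine Finset.sum_congr rfl fun x _ => Finset.sum_congr rfl fun y _ => ?_
    ring
  linarith

theorem sum_A_nonneg (f : S.F → ℝ) : 0 ≤ ∑ x, L.A f x * f x := by
  have h : 0 ≤ 2 * ∑ x, L.A f x * f x := by
    rw [two_mul_sum_A]
    exact Finset.sum_nonneg fun x _ => Finset.sum_nonneg fun y _ =>
      mul_nonneg (L.a_nonneg x y) (mul_self_nonneg _)
  linarith

theorem A_add (f g : S.F → ℝ) (x : S.F) : L.A (f + g) x = L.A f x + L.A g x := by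
  rw [A, A, A, ← neg_add, ← Finset.sum_add_distrib]
  congr 1
  exact Finset.sum_congr rfl fun y _ => by simp only [Pi.add_apply]; ring

theorem A_smul (c : ℝ) (f : S.F → ℝ) (x : S.F) : L.A (c • f) x = c * L.A f x := by
  rw [A, A, mul_neg, Finset.mul_sum]
  congr 1
  exact Finset.sum_congr rfl fun y _ => by simp only [Pi.smul_apply, smul_eq_mul]; ring

/-- The sum of the energy and of the `L²` inner product. -/
noncomputable abbrev core : InnerProductSpace.Core ℝ (S.F → ℝ) where
  inner f g := ∑ x, L.A f x * g x + ∑ x, L.b x * (f x * g x)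
  conj_inner_symm f g := by
    simp only [conj_trivial]
    rw [L.sum_A_comm]
    congr 1
    exact Finset.sum_congr rfl fun x _ => by ring
  re_inner_nonneg f := by
    simp only [RCLike.re_to_real]
    exact add_nonneg (L.sum_A_nonneg f) (Finset.sum_nonneg fun x _ =>
      mul_nonneg (L.b_pos x).le (mul_self_nonneg _))
  add_left f g h := by
    simp only [A_add, Pi.add_apply, add_mul, mul_add, Finset.sum_add_distrib]
    ring
  smul_left f g c := by
    simp only [A_smul, Pi.smul_apply, smul_eq_mul, conj_trivial]
    rw [mul_add, Finset.mul_sum, Finset.mul_sum]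
    congr 1
    · exact Finset.sum_congr rfl fun x _ => by ring
    · exact Finset.sum_congr rfl fun x _ => by ring
  definite f hf := by
    have h1 : ∀ x ∈ Finset.univ, 0 ≤ L.b x * (f x * f x) := fun x _ =>
      mul_nonneg (L.b_pos x).le (mul_self_nonneg _)
    have h2 : ∑ x, L.b x * (f x * f x) = 0 := by
      have := L.sum_A_nonneg f
      have h3 := Finset.sum_nonneg h1
      linarith
    funext x
    have h3 := (Finset.sum_eq_zero_iff_of_nonneg h1).1 h2 x (Finset.mem_univ x)
    exact mul_self_eq_zero.1 ((mul_eq_zero.1 h3).resolve_left (L.b_pos x).ne')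

/-- The functions on `F`, with the sum of the energy and of the `L²` inner product. -/
def FunctionSpace (_L : LatticeData S) : Type := S.F → ℝ

noncomputable instance : NormedAddCommGroup L.FunctionSpace :=
  @InnerProductSpace.Core.toNormedAddCommGroup ℝ (S.F → ℝ) _ _ _ L.core

noncomputable instance : InnerProductSpace ℝ L.FunctionSpace :=
  @InnerProductSpace.ofCore ℝ (S.F → ℝ) _ _ _ L.core.toCore

instance : FiniteDimensional ℝ L.FunctionSpace :=
  inferInstanceAs (FiniteDimensional ℝ (S.F → ℝ))

instance : CompleteSpace L.FunctionSpace := FiniteDimensional.complete ℝ _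

theorem inner_eq (f g : L.FunctionSpace) :
    inner ℝ f g = ∑ x, L.A f x * g x + ∑ x, L.b x * (f x * g x) := rfl

/-- The measure `b` on `F`. -/
noncomputable def vertexMeasure : Measure S.F :=
  ∑ p, ENNReal.ofReal (L.b p) • Measure.dirac p

instance : IsFiniteMeasure L.vertexMeasure := by
  refine ⟨?_⟩
  rw [vertexMeasure, Measure.finsetSum_apply]
  refine ENNReal.sum_lt_top.2 fun p _ => ?_
  simp

theorem integral_vertexMeasure (g : S.F → ℝ) :
    ∫ p, g p ∂L.vertexMeasure = ∑ p, L.b p * g p := by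
  rw [vertexMeasure, integral_finsetSum_measure]
  · refine Finset.sum_congr rfl fun p _ => ?_
    rw [integral_smul_measure, integral_dirac, ENNReal.toReal_ofReal (L.b_pos p).le, smul_eq_mul]
  · intro p _
    exact (integrable_dirac (by simp)).smul_measure ENNReal.ofReal_ne_top

/-- The values of a function on `F`. -/
def ev : L.FunctionSpace →ₗ[ℝ] (S.F → ℝ) where
  toFun f := f
  map_add' _ _ := rfl
  map_smul' _ _ := rfl

/-- The cell model of the lattice case. -/
noncomputable def cellModel : CellModel S S.F L.FunctionSpace where
  m := L.vertexMeasure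
  finite := inferInstance
  pt := Subtype.val
  pt_emb := MeasurableEmbedding.subtype_coe S.F.measurableSet
  pt_mem y := S.F_subset y.2
  exists_pt p hp := ⟨⟨p, hp⟩, rfl⟩
  ev := L.ev
  ev_bound := by
    refine ⟨‖LinearMap.toContinuousLinearMap L.ev‖, fun f y => ?_⟩
    exact (norm_le_pi_norm (L.ev f) y).trans
      ((LinearMap.toContinuousLinearMap L.ev).le_opNorm f)
  ev_meas f := measurable_of_countable _
  ev_ae f hf := by
    have h1 : ∫ p, L.ev f p * L.ev f p ∂L.vertexMeasure = 0 := by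
      refine integral_eq_zero_of_ae ?_
      filter_upwards [hf] with p hp
      rw [hp]
      simp
    rw [integral_vertexMeasure] at h1
    funext x
    have h3 := (Finset.sum_eq_zero_iff_of_nonneg fun x _ =>
      mul_nonneg (L.b_pos x).le (mul_self_nonneg _)).1 h1 x (Finset.mem_univ x)
    exact mul_self_eq_zero.1 ((mul_eq_zero.1 h3).resolve_left (L.b_pos x).ne')
  integral_le f := by
    rw [integral_vertexMeasure, ← real_inner_self_eq_norm_sq, inner_eq]
    have h1 := L.sum_A_nonneg f
    have h2 : ∑ p, L.b p * L.ev f p ^ 2 = ∑ x, L.b x * (f x * f x) :=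
      Finset.sum_congr rfl fun x _ => by rw [sq]; rfl
    rw [h2]
    linarith
  exists_bump p hp := by
    classical
    refine ⟨fun q => Set.indicator {p} 1 (q : EuclideanSpace ℝ (Fin d)), fun y _ => rfl⟩

variable (W : Weights N) (ω : ℕ → Fin N)

open Classical in
theorem measure_eq (n : ℕ) : L.measure W ω n = L.cellModel.refMeasure W (Cell.upTo ω n) := by
  rw [CellModel.refMeasure_upTo, Cell.sum_stage, measure]
  refine Finset.sum_congr rfl fun w _ => ?_
  refine Measure.ext fun A hA => ?_
  have hm : Measurable (L.cellModel.cellPt (Cell.ofWord ω w)) :=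
    (L.cellModel.measurableEmbedding_cellPt _).measurable
  rw [CellModel.cellMeasure, Measure.smul_apply, Measure.map_apply hm hA]
  change _ = _ • (L.vertexMeasure _)
  rw [vertexMeasure, Measure.finsetSum_apply, Measure.finsetSum_apply, Finset.smul_sum]
  refine Finset.sum_congr rfl fun p _ => ?_
  rw [Measure.smul_apply, Measure.smul_apply, Measure.dirac_apply' _ hA,
    Measure.dirac_apply' _ (hm hA), smul_eq_mul, smul_eq_mul, smul_eq_mul, ← mul_assoc,
    ← ENNReal.ofReal_mul (Cell.weight_pos W _).le, Cell.weight_ofWord]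
  congr 1
  rw [Set.indicator_apply, Set.indicator_apply]
  have : (L.cellModel.cellPt (Cell.ofWord ω w) p) = S.blowUp ω n (S.wordMap w p) :=
    Cell.map_ofWord S w p
  rw [← this]
  rfl

theorem measureInfty_eq :
    L.measureInfty W ω = L.cellModel.refMeasure W (Set.univ : Set (Cell ω)) := by
  rw [measureInfty, CellModel.refMeasure_univ]
  simp only [measure_eq]

theorem isCellSum : L.cellModel.IsCellSum W ω (L.energy W ω) := by
  intro n u u' f f' hf hf'
  rw [Cell.sum_stage, energy]
  refine Finset.sum_congr rfl fun w _ => ?_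
  rw [Cell.weight_ofWord_eq]
  congr 1
  have h1 : ∀ (u : EuclideanSpace ℝ (Fin d) → ℝ) (f : Cell ω → L.FunctionSpace),
      (∀ τ ∈ Cell.upTo ω n, ∀ y, L.cellModel.ev (f τ) y = u (L.cellModel.cellPt τ y)) →
      f (Cell.ofWord ω w) = fun q : S.F => u (S.blowUp ω n (S.wordMap w q)) := by
    intro u f hf
    funext q
    refine (hf _ (Cell.ofWord_mem w) q).trans ?_
    exact congrArg u (Cell.map_ofWord S w q)
  rw [h1 u f hf, h1 u' f' hf']
  change _ = _ - ∫ _, _ ∂L.vertexMeasure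
  rw [integral_vertexMeasure]
  exact (add_sub_cancel_right _ _).symm

variable {ω} in
-- The reference space is finite-dimensional, so its norm is controlled by the `L²` norm, and square
-- integrability alone makes the energies of the cells summable.
theorem exists_represents_iff {C : Set (Cell ω)} {B : Set (EuclideanSpace ℝ (Fin d))}
    (hB : ∀ z ∈ B, ∃ τ ∈ C, ∃ y, L.cellModel.cellPt τ y = z) (c : BoundaryCondition)
    (u : EuclideanSpace ℝ (Fin d) → ℝ) :
    (MemLp u 2 (L.cellModel.refMeasure W C) ∧ c.Holds B u) ↔
      ∃ x ∈ L.cellModel.space W C (c.zeroSet B), L.cellModel.Represents W C x u := by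
  constructor
  · rintro ⟨hu, hc⟩
    obtain ⟨K, -, hK⟩ := LinearMap.exists_antilipschitzWith
      (L.cellModel.incl : L.FunctionSpace →ₗ[ℝ] Lp ℝ 2 L.cellModel.m) (by
      rw [LinearMap.ker_eq_bot']
      intro f hf
      refine L.cellModel.ev_ae f ((L.cellModel.coeFn_incl f).symm.trans ?_)
      have : L.cellModel.incl f = 0 := hf
      rw [this]
      exact Lp.coeFn_zero _ _ _)
    have hK' : ∀ f : L.FunctionSpace, ‖f‖ ^ 2 ≤ K ^ 2 * ∫ y, L.cellModel.ev f y ^ 2 ∂L.cellModel.m := by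
      intro f
      have h1 : ‖f‖ ≤ K * ‖L.cellModel.incl f‖ := by
        simpa [dist_zero_right] using hK.le_mul_dist f 0
      have h2 := L.cellModel.inner_incl f f
      rw [real_inner_self_eq_norm_sq] at h2
      simp only [← sq] at h2
      rw [← h2, ← mul_pow]
      exact pow_le_pow_left₀ (norm_nonneg _) h1 2
    refine CellModel.exists_represents
      (f := fun τ => (fun p : S.F => u (L.cellModel.cellPt τ p) : L.FunctionSpace))
      (fun τ _ y => rfl) ?_ ((c.holds_iff B u).1 hc)
    have h1 := (memLp_two_iff_integrable_sq hu.1).1 hu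
    have h2 := (hasSum_integral_measure h1).summable.mul_left ((K : ℝ) ^ 2)
    refine Summable.of_nonneg_of_le (fun τ => ?_) (fun τ => ?_) h2
    · have := τ.1.weight_pos W
      positivity
    · rw [CellModel.integral_cellMeasure, mul_left_comm]
      exact mul_le_mul_of_nonneg_left (hK' _) (τ.1.weight_pos W).le
  · rintro ⟨x, hx, hxu⟩
    refine ⟨hxu.memLp, (c.holds_iff B u).2 fun z hz => hxu.eq_zero hx ?_ hz⟩
    exact fun z hz => hB z (c.zeroSet_subset B hz)

theorem isFormOf (n : ℕ) (c : BoundaryCondition) :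
    L.cellModel.IsFormOf W (Cell.upTo ω n) (c.zeroSet (S.boundary ω n)) (L.form W ω n c) := by
  refine CellModel.isFormOf_upTo (L.measure_eq W ω n) (fun u => ?_) (L.isCellSum W ω) rfl
  rw [← L.exists_represents_iff W
    (fun z hz => L.cellModel.exists_cellPt_of_mem_boundary hz) c u, ← measure_eq]
  rfl

theorem isFormOf_infty (c : BoundaryCondition) :
    L.cellModel.IsFormOf W (Set.univ : Set (Cell ω)) (c.zeroSet (S.boundaryInfty ω))
      (L.formInfty W ω c) := by
  refine CellModel.isFormOf_univ (L.measureInfty_eq W ω) (fun u => ?_) (L.isCellSum W ω) rfl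
  rw [← L.exists_represents_iff W
    (fun z hz => L.cellModel.exists_cellPt_of_mem_boundaryInfty hz) c u, ← measureInfty_eq]
  rfl

end LatticeData

/-! ### Words acting on the self-similar set -/

namespace SelfSimilarSet

variable {d N : ℕ} (S : SelfSimilarSet d N)

instance : CompactSpace S.X := isCompact_iff_compactSpace.1 S.isCompact

theorem wordMap_cons {n : ℕ} (i : Fin N) (w : Fin n → Fin N) (x : EuclideanSpace ℝ (Fin d)) :
    S.wordMap (Fin.cons i w : Fin (n + 1) → Fin N) x = S.Ψ i (S.wordMap w x) := by
  rw [wordMap, wordMap, List.ofFn_succ, List.prod_cons]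
  rfl

theorem wordMap_mem : ∀ {n : ℕ} (w : Fin n → Fin N) {x : EuclideanSpace ℝ (Fin d)}, x ∈ S.X →
    S.wordMap w x ∈ S.X := by
  intro n
  induction n with
  | zero => exact fun w x hx => hx
  | succ n ih =>
    intro w x hx
    rw [← Fin.cons_self_tail w, wordMap_cons]
    exact S.map_mem _ (ih _ hx)

/-- `Ψ_{w_1} ∘ ⋯ ∘ Ψ_{w_n}` as a map from `X` to itself. -/
noncomputable def wordCell {n : ℕ} (w : Fin n → Fin N) (x : S.X) : S.X := ⟨S.wordMap w x, S.wordMap_mem w x.2⟩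

theorem wordCell_zero (w : Fin 0 → Fin N) : S.wordCell w = id := rfl

theorem wordCell_cons {n : ℕ} (i : Fin N) (w : Fin n → Fin N) :
    S.wordCell (Fin.cons i w : Fin (n + 1) → Fin N) = S.cellMap i ∘ S.wordCell w :=
  funext fun x => Subtype.ext (S.wordMap_cons i w x)

theorem continuous_cellMap (i : Fin N) : Continuous (S.cellMap i) :=
  ((S.Ψ i).toHomeomorph.continuous.comp continuous_subtype_val).subtype_mk _

theorem exists_cellMap_eq (x : S.X) : ∃ i y, S.cellMap i y = x := by
  have h : (x : EuclideanSpace ℝ (Fin d)) ∈ ⋃ i, S.Ψ i '' S.X := S.self_similar.subset x.2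
  obtain ⟨i, y, hy, he⟩ := Set.mem_iUnion.1 h
  exact ⟨i, ⟨y, hy⟩, Subtype.ext he⟩

theorem exists_wordCell_eq (n : ℕ) : ∀ x : S.X, ∃ (w : Fin n → Fin N) (y : S.X),
    S.wordCell w y = x := by
  induction n with
  | zero => exact fun x => ⟨Fin.elim0, x, rfl⟩
  | succ n ih =>
    intro x
    obtain ⟨i, y, rfl⟩ := S.exists_cellMap_eq x
    obtain ⟨w, z, rfl⟩ := ih y
    exact ⟨Fin.cons i w, z, by rw [wordCell_cons]; rfl⟩

theorem dist_wordCell_le {R : ℝ} (hR : 0 ≤ R)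
    (h : ∀ i x y, dist (S.Ψ i x) (S.Ψ i y) ≤ R * dist x y) {n : ℕ} (w : Fin n → Fin N)
    (x y : S.X) : dist (S.wordCell w x) (S.wordCell w y) ≤ R ^ n * dist x y := by
  induction n with
  | zero => simp [wordCell_zero]
  | succ n ih =>
    rw [← Fin.cons_self_tail w, wordCell_cons]
    refine (h _ _ _).trans ?_
    rw [pow_succ', mul_assoc]
    exact mul_le_mul_of_nonneg_left (ih _) hR

/-- A function is continuous if its restrictions to the cells are. -/
theorem continuous_of_comp_cellMap {f : S.X → ℝ} (h : ∀ i, Continuous (f ∘ S.cellMap i)) :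
    Continuous f := by
  refine continuous_iff_isClosed.2 fun K hK => ?_
  have h1 : f ⁻¹' K = ⋃ i, S.cellMap i '' ((f ∘ S.cellMap i) ⁻¹' K) := by
    ext x
    simp only [Set.mem_iUnion, Set.mem_image, Set.mem_preimage, Function.comp_apply]
    constructor
    · intro hx
      obtain ⟨i, y, rfl⟩ := S.exists_cellMap_eq x
      exact ⟨i, y, hx, rfl⟩
    · rintro ⟨i, y, hy, rfl⟩
      exact hy
  rw [h1]
  exact isClosed_iUnion_of_finite fun i =>
    ((hK.preimage (h i)).isCompact.image (S.continuous_cellMap i)).isClosed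

theorem sum_word_succ {A : Type*} [AddCommMonoid A] {n : ℕ} (f : (Fin (n + 1) → Fin N) → A) :
    ∑ w, f w = ∑ i : Fin N, ∑ w : Fin n → Fin N, f (Fin.cons i w) := by
  rw [← Fintype.sum_prod_type']
  exact (Fintype.sum_equiv (Fin.consEquiv fun _ => Fin N) _ _ fun _ => rfl).symm

end SelfSimilarSet

/-! ### The continuous case: the reference cell -/

namespace SelfSimilarDirichletForm

variable {d N : ℕ} {S : SelfSimilarSet d N} {W : Weights N} (Φ : SelfSimilarDirichletForm S W)

instance : IsProbabilityMeasure Φ.m := Φ.m_prob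

/-! ### Iteration of the self-similarity -/

theorem m_apply {A : Set S.X} (hA : MeasurableSet A) :
    Φ.m A = ∑ i, ENNReal.ofReal (W.β i) * Φ.m (S.cellMap i ⁻¹' A) := by
  conv_lhs => rw [Φ.m_self_similar]
  rw [Measure.finsetSum_apply]
  refine Finset.sum_congr rfl fun i _ => ?_
  rw [Measure.smul_apply, Measure.map_apply (S.continuous_cellMap i).measurable hA, smul_eq_mul]

theorem m_apply_word (n : ℕ) : ∀ {A : Set S.X}, MeasurableSet A →
    Φ.m A = ∑ w : Fin n → Fin N, ENNReal.ofReal (∏ k, W.β (w k)) * Φ.m (S.wordCell w ⁻¹' A) := by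
  induction n with
  | zero => intro A _; simp [S.wordCell_zero]
  | succ n ih =>
    intro A hA
    rw [Φ.m_apply hA, SelfSimilarSet.sum_word_succ]
    refine Finset.sum_congr rfl fun i _ => ?_
    rw [ih ((S.continuous_cellMap i).measurable hA), Finset.mul_sum]
    refine Finset.sum_congr rfl fun w _ => ?_
    rw [← mul_assoc, ← ENNReal.ofReal_mul (W.β_mem i).1.le, Fin.prod_univ_succ, S.wordCell_cons]
    simp only [Fin.cons_zero, Fin.cons_succ]
    rfl

/-- A nonempty open set contains a whole cell of a deep enough level, and that cell has at least the
product of its `β` as mass. -/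
instance : Φ.m.IsOpenPosMeasure := by
  refine ⟨fun U hU ⟨x, hx⟩ => ?_⟩
  obtain ⟨R, hR0, hR1, hR⟩ := S.exists_ratio
  obtain ⟨ε, hε, hball⟩ := Metric.isOpen_iff.1 hU x hx
  obtain ⟨B, hB⟩ := (Metric.isBounded_iff.1 (isCompact_univ (X := S.X)).isBounded)
  have hB0 : 0 ≤ B := dist_nonneg.trans (hB (Set.mem_univ x) (Set.mem_univ x))
  have h1 : Tendsto (fun n => R ^ n * B) atTop (𝓝 0) := by
    simpa using (tendsto_pow_atTop_nhds_zero_of_lt_one hR0 hR1).mul_const B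
  obtain ⟨n, hn⟩ := (h1.eventually (gt_mem_nhds hε)).exists
  obtain ⟨w, y, rfl⟩ := S.exists_wordCell_eq n x
  have h2 : S.wordCell w ⁻¹' U = Set.univ := by
    refine Set.eq_univ_of_forall fun z => hball ?_
    refine (S.dist_wordCell_le hR0 hR w z y).trans_lt (lt_of_le_of_lt ?_ hn)
    exact mul_le_mul_of_nonneg_left (hB (Set.mem_univ z) (Set.mem_univ y)) (by positivity)
  rw [Φ.m_apply_word n hU.measurableSet]
  intro h0
  have h3 := (Finset.sum_eq_zero_iff.1 h0) w (Finset.mem_univ w)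
  rw [h2, measure_univ, mul_one, ENNReal.ofReal_eq_zero] at h3
  exact absurd h3 (not_le.2 (Finset.prod_pos fun k _ => (W.β_mem _).1))

/-- Continuity comes for free: the domain consists of continuous functions, and continuity on the
finitely many closed cells glues. -/
theorem mem_dom_iff_comp (f : S.X → ℝ) : f ∈ Φ.dom ↔ ∀ i, f ∘ S.cellMap i ∈ Φ.dom := by
  constructor
  · exact fun h => (Φ.mem_dom_iff f (Φ.continuous_of_mem f h)).1 h
  · exact fun h => (Φ.mem_dom_iff f
      (S.continuous_of_comp_cellMap fun i => Φ.continuous_of_mem _ (h i))).2 h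

theorem mem_dom_iff_word (n : ℕ) : ∀ f : S.X → ℝ,
    f ∈ Φ.dom ↔ ∀ w : Fin n → Fin N, f ∘ S.wordCell w ∈ Φ.dom := by
  induction n with
  | zero => exact fun f => ⟨fun h w => h, fun h => h Fin.elim0⟩
  | succ n ih =>
    intro f
    rw [Φ.mem_dom_iff_comp]
    constructor
    · intro h w
      rw [← Fin.cons_self_tail w, S.wordCell_cons]
      exact (ih _).1 (h _) _
    · intro h i
      refine (ih _).2 fun w => ?_
      have h1 := h (Fin.cons i w)
      rwa [S.wordCell_cons] at h1

theorem a_add_right {f g h : S.X → ℝ} (hf : f ∈ Φ.dom) (hg : g ∈ Φ.dom) (hh : h ∈ Φ.dom) :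
    Φ.a f (g + h) = Φ.a f g + Φ.a f h := by
  rw [Φ.a_symm _ hf _ (Φ.dom.add_mem hg hh), Φ.a_add _ hg _ hh _ hf, Φ.a_symm _ hg _ hf,
    Φ.a_symm _ hh _ hf]

theorem two_mul_a {f g : S.X → ℝ} (hf : f ∈ Φ.dom) (hg : g ∈ Φ.dom) :
    2 * Φ.a f g = Φ.a (f + g) (f + g) - Φ.a f f - Φ.a g g := by
  have h := Φ.dom.add_mem hf hg
  rw [Φ.a_add _ hf _ hg _ h, Φ.a_add_right hf hf hg, Φ.a_add_right hg hf hg, Φ.a_symm _ hg _ hf]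
  ring

/-- Polarization of the self-similarity of the quadratic form. -/
theorem a_eq_sum {f g : S.X → ℝ} (hf : f ∈ Φ.dom) (hg : g ∈ Φ.dom) :
    Φ.a f g = ∑ i, (W.α i)⁻¹ * Φ.a (f ∘ S.cellMap i) (g ∘ S.cellMap i) := by
  have h : 2 * Φ.a f g = 2 * ∑ i, (W.α i)⁻¹ * Φ.a (f ∘ S.cellMap i) (g ∘ S.cellMap i) := by
    rw [Φ.two_mul_a hf hg, Φ.a_self_similar _ (Φ.dom.add_mem hf hg), Φ.a_self_similar _ hf,
      Φ.a_self_similar _ hg, ← Finset.sum_sub_distrib, ← Finset.sum_sub_distrib, Finset.mul_sum]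
    refine Finset.sum_congr rfl fun i _ => ?_
    rw [mul_left_comm, Φ.two_mul_a ((Φ.mem_dom_iff_comp f).1 hf i) ((Φ.mem_dom_iff_comp g).1 hg i),
      mul_sub, mul_sub]
    rfl
  linarith

theorem a_eq_sum_word (n : ℕ) : ∀ {f g : S.X → ℝ}, f ∈ Φ.dom → g ∈ Φ.dom →
    Φ.a f g = ∑ w : Fin n → Fin N,
      (∏ k, (W.α (w k))⁻¹) * Φ.a (f ∘ S.wordCell w) (g ∘ S.wordCell w) := by
  induction n with
  | zero => intro f g _ _; simp [S.wordCell_zero]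
  | succ n ih =>
    intro f g hf hg
    rw [Φ.a_eq_sum hf hg, SelfSimilarSet.sum_word_succ]
    refine Finset.sum_congr rfl fun i _ => ?_
    rw [ih ((Φ.mem_dom_iff_comp f).1 hf i) ((Φ.mem_dom_iff_comp g).1 hg i), Finset.mul_sum]
    refine Finset.sum_congr rfl fun w _ => ?_
    rw [← mul_assoc, Fin.prod_univ_succ, S.wordCell_cons]
    simp only [Fin.cons_zero, Fin.cons_succ]
    rfl

/-! ### The Hilbert space of the form -/

theorem integrable_of_continuous {f : S.X → ℝ} (hf : Continuous f) : Integrable f Φ.m :=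
  hf.integrable_of_hasCompactSupport (HasCompactSupport.of_compactSpace f)

theorem integrable_mul (f g : Φ.dom) : Integrable (fun x => f.1 x * g.1 x) Φ.m :=
  Φ.integrable_of_continuous
    ((Φ.continuous_of_mem _ f.2).mul (Φ.continuous_of_mem _ g.2))

theorem eq_zero_of_integral {f : S.X → ℝ} (hf : Continuous f)
    (h : ∫ x, f x * f x ∂Φ.m = 0) : f = 0 := by
  have h1 := (integral_eq_zero_iff_of_nonneg (fun x => mul_self_nonneg (f x))
    (Φ.integrable_of_continuous (hf.mul hf))).1 h
  refine (hf.ae_eq_iff_eq Φ.m continuous_zero).1 ?_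
  filter_upwards [h1] with x hx
  exact mul_self_eq_zero.1 hx

/-- The sum of the form and of the `L²` inner product. -/
noncomputable abbrev core : InnerProductSpace.Core ℝ Φ.dom where
  inner f g := Φ.a f g + ∫ x, f.1 x * g.1 x ∂Φ.m
  conj_inner_symm f g := by
    simp only [conj_trivial]
    rw [Φ.a_symm _ f.2 _ g.2]
    simp only [mul_comm]
  re_inner_nonneg f := by
    simp only [RCLike.re_to_real]
    exact add_nonneg (Φ.a_nonneg _ f.2) (integral_nonneg fun x => mul_self_nonneg _)
  add_left f g h := by
    rw [Submodule.coe_add, Φ.a_add _ f.2 _ g.2 _ h.2]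
    simp only [Pi.add_apply, add_mul]
    rw [integral_add (Φ.integrable_mul f h) (Φ.integrable_mul g h)]
    ring
  smul_left f g c := by
    rw [Submodule.coe_smul, Φ.a_smul _ _ f.2 _ g.2]
    simp only [Pi.smul_apply, smul_eq_mul, conj_trivial, mul_assoc]
    rw [integral_const_mul]
    ring
  definite f hf := by
    have h1 := Φ.a_nonneg _ f.2
    have h2 : 0 ≤ ∫ x, f.1 x * f.1 x ∂Φ.m := integral_nonneg fun x => mul_self_nonneg _
    exact Subtype.ext (Φ.eq_zero_of_integral (Φ.continuous_of_mem _ f.2) (by linarith))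

/-- The domain of the form, with the sum of the form and of the `L²` inner product. -/
def FunctionSpace (Φ : SelfSimilarDirichletForm S W) : Type := Φ.dom

noncomputable instance : NormedAddCommGroup Φ.FunctionSpace :=
  @InnerProductSpace.Core.toNormedAddCommGroup ℝ Φ.dom _ _ _ Φ.core

noncomputable instance : InnerProductSpace ℝ Φ.FunctionSpace :=
  @InnerProductSpace.ofCore ℝ Φ.dom _ _ _ Φ.core.toCore

/-- The functions of the domain, as functions. -/
noncomputable def ev : Φ.FunctionSpace →ₗ[ℝ] (S.X → ℝ) where
  toFun f := f.1
  map_add' _ _ := rfl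
  map_smul' _ _ := rfl

theorem ev_mem (f : Φ.FunctionSpace) : Φ.ev f ∈ Φ.dom := f.2

theorem continuous_ev (f : Φ.FunctionSpace) : Continuous (Φ.ev f) := Φ.continuous_of_mem _ f.2

/-- A function of the domain as an element of the Hilbert space. -/
def ofMem {f : S.X → ℝ} (hf : f ∈ Φ.dom) : Φ.FunctionSpace := ⟨f, hf⟩

theorem inner_eq (f g : Φ.FunctionSpace) :
    inner ℝ f g = Φ.a (Φ.ev f) (Φ.ev g) + ∫ x, Φ.ev f x * Φ.ev g x ∂Φ.m := rfl

theorem norm_sq_eq (f : Φ.FunctionSpace) :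
    ‖f‖ ^ 2 = Φ.a (Φ.ev f) (Φ.ev f) + ∫ x, Φ.ev f x ^ 2 ∂Φ.m := by
  rw [← real_inner_self_eq_norm_sq, inner_eq]
  simp only [sq]

theorem integral_sq_le (f : Φ.FunctionSpace) : ∫ x, Φ.ev f x ^ 2 ∂Φ.m ≤ ‖f‖ ^ 2 := by
  rw [norm_sq_eq]
  linarith [Φ.a_nonneg _ (Φ.ev_mem f)]

instance : CompleteSpace Φ.FunctionSpace := by
  refine Metric.complete_of_cauchySeq_tendsto fun u hu => ?_
  have hsub : ∀ f g : Φ.FunctionSpace, ‖f - g‖ ^ 2 =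
      Φ.a (Φ.ev f - Φ.ev g) (Φ.ev f - Φ.ev g) + ∫ x, (Φ.ev f x - Φ.ev g x) ^ 2 ∂Φ.m := by
    intro f g
    rw [norm_sq_eq, map_sub]
    rfl
  obtain ⟨g, hg, hlim⟩ := Φ.closed (fun k => Φ.ev (u k)) (fun k => Φ.ev_mem _) (by
    intro ε hε
    obtain ⟨K, hK⟩ := Metric.cauchySeq_iff.1 hu (√ε) (Real.sqrt_pos.2 hε)
    refine ⟨K, fun j hj k hk => ?_⟩
    have h1 := hK j hj k hk
    rw [dist_eq_norm, Real.lt_sqrt (norm_nonneg _), hsub] at h1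
    exact h1)
  refine ⟨Φ.ofMem hg, ?_⟩
  rw [tendsto_iff_norm_sub_tendsto_zero]
  have h1 : Tendsto (fun k => ‖u k - Φ.ofMem hg‖ ^ 2) atTop (𝓝 0) := by
    simp only [hsub]
    exact hlim
  have h2 := h1.sqrt
  simpa [Real.sqrt_sq (norm_nonneg _)] using h2

/-- The functions of the domain, as continuous functions. -/
noncomputable def toContinuousMap : Φ.FunctionSpace →ₗ[ℝ] C(S.X, ℝ) where
  toFun f := ⟨Φ.ev f, Φ.continuous_ev f⟩
  map_add' _ _ := rfl
  map_smul' _ _ := rfl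

/-- Closed graph theorem: a limit in the form norm and a uniform limit are both `L²` limits, and two
continuous functions that are almost everywhere equal coincide since `m` charges open sets. This
gives the uniform bound on point evaluations. -/
theorem continuous_toContinuousMap : Continuous Φ.toContinuousMap := by
  refine LinearMap.continuous_of_seq_closed_graph _ fun u f g hf hg => ?_
  have h1 : Tendsto (fun k => ∫ x, (Φ.ev (u k) x - Φ.ev f x) ^ 2 ∂Φ.m) atTop (𝓝 0) := by
    refine squeeze_zero (fun k => integral_nonneg fun x => sq_nonneg _)
      (fun k => ?_) (g := fun k => ‖u k - f‖ ^ 2) ?_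
    · have := Φ.integral_sq_le (u k - f)
      rw [map_sub] at this
      exact this
    · have := (tendsto_iff_norm_sub_tendsto_zero.1 hf).pow 2
      simpa using this
  have h2 : Tendsto (fun k => ∫ x, (Φ.ev (u k) x - Φ.ev f x) ^ 2 ∂Φ.m) atTop
      (𝓝 (∫ x, (g x - Φ.ev f x) ^ 2 ∂Φ.m)) := by
    have h3 : Tendsto (fun k => (Φ.toContinuousMap (u k) - Φ.toContinuousMap f) ^ 2) atTop
        (𝓝 ((g - Φ.toContinuousMap f) ^ 2)) := (hg.sub_const _).pow 2
    have h4 := ((ContinuousMap.toLp (E := ℝ) 1 Φ.m ℝ).continuous.tendsto _).comp h3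
    have h5 := (continuous_integral (μ := Φ.m) (G := ℝ)).tendsto _ |>.comp h4
    refine (h5.congr fun k => ?_).trans_eq ?_
    · exact integral_congr_ae (ContinuousMap.coeFn_toLp Φ.m _)
    · exact congrArg _ (integral_congr_ae (ContinuousMap.coeFn_toLp Φ.m _))
  have h3 := tendsto_nhds_unique h2 h1
  have h4 := Φ.eq_zero_of_integral (f := fun x => g x - Φ.ev f x)
    (g.continuous.sub (Φ.continuous_ev f)) (by simpa only [sq] using h3)
  ext x
  exact sub_eq_zero.1 (congrFun h4 x)

/-- The functions of the domain take arbitrary values on `F`. -/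
theorem exists_ev_eq (c : S.F → ℝ) :
    ∃ f : Φ.FunctionSpace, ∀ p : S.F, Φ.ev f ⟨p, S.F_subset p.2⟩ = c p := by
  let R : Φ.FunctionSpace →ₗ[ℝ] (S.F → ℝ) :=
    LinearMap.pi fun p => LinearMap.proj (⟨p, S.F_subset p.2⟩ : S.X) ∘ₗ Φ.ev
  have hdense : ∀ (c : S.F → ℝ) (ε : ℝ), 0 < ε → ∃ f, ‖R f - c‖ < ε := by
    intro c ε hε
    have hemb : Topology.IsClosedEmbedding fun p : S.F => (⟨p, S.F_subset p.2⟩ : S.X) := by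
      refine Topology.IsClosedEmbedding.of_continuous_injective_isClosedMap
        (continuous_of_discreteTopology) (fun p q h => ?_) (fun K _ => (K.toFinite.image _).isClosed)
      exact Subtype.ext (congrArg (fun x : S.X => (x : EuclideanSpace ℝ (Fin d))) h)
    obtain ⟨g, hg⟩ := ContinuousMap.exists_extension hemb
      (⟨c, continuous_of_discreteTopology⟩ : C(S.F, ℝ))
    obtain ⟨f, hf, hfg⟩ := Φ.regular g g.continuous ε hε
    refine ⟨Φ.ofMem hf, (pi_norm_lt_iff hε).2 fun p => ?_⟩
    have h1 : g ⟨p, S.F_subset p.2⟩ = c p := DFunLike.congr_fun hg p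
    have h2 := hfg ⟨p, S.F_subset p.2⟩
    rw [h1] at h2
    exact h2
  -- Regularity only makes the attained values dense, but a dense subspace of a finite-dimensional
  -- space is everything.
  have h1 : LinearMap.range R = ⊤ := by
    rw [← (LinearMap.range R).dense_iff_topologicalClosure_eq_top.1 ?_]
    · exact ((LinearMap.range R).closed_of_finiteDimensional.submodule_topologicalClosure_eq).symm
    · refine Metric.dense_iff.2 fun c ε hε => ?_
      obtain ⟨f, hf⟩ := hdense c ε hε
      exact ⟨R f, by rwa [Metric.mem_ball, dist_eq_norm], f, rfl⟩
  obtain ⟨f, hf⟩ := LinearMap.range_eq_top.1 h1 c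
  exact ⟨f, fun p => congrFun hf p⟩

/-- The cell model of the continuous case. -/
noncomputable def cellModel : CellModel S S.X Φ.FunctionSpace where
  m := Φ.m
  finite := inferInstance
  pt := Subtype.val
  pt_emb := MeasurableEmbedding.subtype_coe S.isCompact.measurableSet
  pt_mem y := y.2
  exists_pt p hp := ⟨⟨p, S.F_subset hp⟩, rfl⟩
  ev := Φ.ev
  ev_bound := by
    let T : Φ.FunctionSpace →L[ℝ] C(S.X, ℝ) := ⟨Φ.toContinuousMap, Φ.continuous_toContinuousMap⟩
    refine ⟨‖T‖, fun f y => ?_⟩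
    exact ((T f).norm_coe_le_norm y).trans (T.le_opNorm f)
  ev_meas f := (Φ.continuous_ev f).measurable
  ev_ae f hf := Subtype.ext
    ((Continuous.ae_eq_iff_eq Φ.m (Φ.continuous_ev f) continuous_zero).1 hf)
  integral_le f := Φ.integral_sq_le f
  exists_bump p hp := by
    classical
    obtain ⟨f, hf⟩ := Φ.exists_ev_eq
      fun q => Set.indicator {p} 1 (q : EuclideanSpace ℝ (Fin d))
    exact ⟨f, fun y hy => hf ⟨y, hy⟩⟩

end SelfSimilarDirichletForm

/-! ### The continuous case: forms on the stages and on the blow-up -/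

namespace SelfSimilarDirichletForm

variable {d N : ℕ} {S : SelfSimilarSet d N} {W : Weights N} (Φ : SelfSimilarDirichletForm S W)
  (ω : ℕ → Fin N)

variable {ω} in
theorem cellPt_ofWord {n : ℕ} (w : Fin n → Fin N) (x : S.X) :
    Φ.cellModel.cellPt (Cell.ofWord ω w) x = S.blowUp ω n (S.wordCell w x) :=
  Cell.map_ofWord S w x

theorem measurable_blowUp (n : ℕ) : Measurable fun x : S.X => S.blowUp ω n x :=
  (S.blowUp ω n).toHomeomorph.continuous.measurable.comp measurable_subtype_coe

theorem measure_eq (n : ℕ) : Φ.measure ω n = Φ.cellModel.refMeasure W (Cell.upTo ω n) := by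
  rw [CellModel.refMeasure_upTo, Cell.sum_stage, measure]
  refine Measure.ext fun A hA => ?_
  rw [Measure.smul_apply, Measure.map_apply (measurable_blowUp ω n) hA, Measure.finsetSum_apply,
    Φ.m_apply_word n (measurable_blowUp ω n hA), Finset.smul_sum]
  refine Finset.sum_congr rfl fun w _ => ?_
  have hm : Measurable (Φ.cellModel.cellPt (Cell.ofWord ω w)) :=
    (Φ.cellModel.measurableEmbedding_cellPt _).measurable
  have hβ : ∀ i, 0 ≤ (W.β i)⁻¹ := fun i => (inv_pos.2 (W.β_mem i).1).le
  rw [CellModel.cellMeasure, Measure.smul_apply, Measure.map_apply hm hA, Cell.weight_ofWord,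
    ENNReal.ofReal_mul (Finset.prod_nonneg fun k _ => hβ _), smul_eq_mul, smul_eq_mul, mul_assoc]
  congr 2
  change _ = Φ.m _
  congr 1
  ext x
  rw [Set.mem_preimage, Set.mem_preimage, Set.mem_preimage, cellPt_ofWord]

theorem measureInfty_eq :
    Φ.measureInfty ω = Φ.cellModel.refMeasure W (Set.univ : Set (Cell ω)) := by
  rw [measureInfty, CellModel.refMeasure_univ]
  simp only [measure_eq]

variable {ω} in
theorem pull_comp_wordCell {n : ℕ} (u : EuclideanSpace ℝ (Fin d) → ℝ) (w : Fin n → Fin N) :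
    S.pull ω n u ∘ S.wordCell w = fun x => u (Φ.cellModel.cellPt (Cell.ofWord ω w) x) :=
  funext fun x => congrArg u (Φ.cellPt_ofWord w x).symm

variable {ω} in
theorem pull_mem_iff {n : ℕ} (u : EuclideanSpace ℝ (Fin d) → ℝ) :
    S.pull ω n u ∈ Φ.dom ↔
      ∀ τ ∈ Cell.upTo ω n, (fun x => u (Φ.cellModel.cellPt τ x)) ∈ Φ.dom := by
  rw [Φ.mem_dom_iff_word n]
  constructor
  · intro h τ hτ
    rw [← Cell.exists_ofWord hτ, ← pull_comp_wordCell]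
    exact h _
  · intro h w
    rw [Φ.pull_comp_wordCell]
    exact h _ (Cell.ofWord_mem w)

theorem isCellSum : Φ.cellModel.IsCellSum W ω (Φ.energy ω) := by
  intro n u u' f f' hf hf'
  have h1 : ∀ (u : EuclideanSpace ℝ (Fin d) → ℝ) (f : Cell ω → Φ.FunctionSpace),
      (∀ τ ∈ Cell.upTo ω n, ∀ y, Φ.cellModel.ev (f τ) y = u (Φ.cellModel.cellPt τ y)) →
      ∀ τ ∈ Cell.upTo ω n, (fun x => u (Φ.cellModel.cellPt τ x)) = Φ.ev (f τ) :=
    fun u f hf τ hτ => funext fun x => (hf τ hτ x).symm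
  have h2 : ∀ (u : EuclideanSpace ℝ (Fin d) → ℝ) (f : Cell ω → Φ.FunctionSpace),
      (∀ τ ∈ Cell.upTo ω n, ∀ y, Φ.cellModel.ev (f τ) y = u (Φ.cellModel.cellPt τ y)) →
      S.pull ω n u ∈ Φ.dom := fun u f hf => (Φ.pull_mem_iff u).2 fun τ hτ => by
    rw [h1 u f hf τ hτ]
    exact Φ.ev_mem _
  rw [Cell.sum_stage, energy, Φ.a_eq_sum_word n (h2 u f hf) (h2 u' f' hf'), Finset.mul_sum]
  refine Finset.sum_congr rfl fun w _ => ?_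
  rw [Cell.weight_ofWord_eq, Φ.pull_comp_wordCell, Φ.pull_comp_wordCell,
    h1 u f hf _ (Cell.ofWord_mem w), h1 u' f' hf' _ (Cell.ofWord_mem w), mul_assoc, inner_eq]
  congr 2
  exact (add_sub_cancel_right _ _).symm

variable {ω} in
theorem pull_mem_of_represents {C : Set (Cell ω)} {n : ℕ} (hC : Cell.upTo ω n ⊆ C)
    {x : Fam ω Φ.FunctionSpace} {u : EuclideanSpace ℝ (Fin d) → ℝ}
    (h : Φ.cellModel.Represents W C x u) : S.pull ω n u ∈ Φ.dom := by
  refine (Φ.pull_mem_iff u).2 fun τ hτ => ?_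
  have h1 : (fun y => u (Φ.cellModel.cellPt τ y)) = Φ.ev ((√(τ.weight W))⁻¹ • x τ) :=
    funext fun y => (h.ev_eq (hC hτ) y).symm
  rw [h1]
  exact Φ.ev_mem _

variable {ω} in
open Classical in
/-- The restriction of `u` to the cell `τ`, as a function on `X`. -/
noncomputable def cellFunction (u : EuclideanSpace ℝ (Fin d) → ℝ) (τ : Cell ω) :
    Φ.FunctionSpace :=
  if h : (fun x => u (Φ.cellModel.cellPt τ x)) ∈ Φ.dom then Φ.ofMem h else 0

variable {ω} in
theorem ev_cellFunction {u : EuclideanSpace ℝ (Fin d) → ℝ} {n : ℕ} (hu : S.pull ω n u ∈ Φ.dom)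
    (τ : Cell ω) (hτ : τ ∈ Cell.upTo ω n) (y : S.X) :
    Φ.cellModel.ev (Φ.cellFunction u τ) y = u (Φ.cellModel.cellPt τ y) := by
  rw [cellFunction, dif_pos ((Φ.pull_mem_iff u).1 hu τ hτ)]
  rfl

theorem isFormOf (n : ℕ) (c : BoundaryCondition) :
    Φ.cellModel.IsFormOf W (Cell.upTo ω n) (c.zeroSet (S.boundary ω n)) (Φ.form ω n c) := by
  refine CellModel.isFormOf_upTo (Φ.measure_eq ω n) (fun u => ?_) (Φ.isCellSum ω) rfl
  constructor
  · rintro ⟨-, hu, hc⟩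
    refine CellModel.exists_represents (Φ.ev_cellFunction hu) ?_ ((c.holds_iff _ u).1 hc)
    rw [← Cell.coe_stage]
    exact (hasSum_fintype _).summable
  · rintro ⟨x, hx, hxu⟩
    refine ⟨?_, Φ.pull_mem_of_represents subset_rfl hxu, (c.holds_iff _ u).2 fun z hz =>
      hxu.eq_zero hx (fun z hz => ?_) hz⟩
    · rw [measure_eq]
      exact hxu.memLp
    · exact Φ.cellModel.exists_cellPt_of_mem_boundary (c.zeroSet_subset _ hz)

variable {ω} in
-- The sum over a stage is the energy of that stage plus an `L²` integral, both bounded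
-- independently of the stage.
theorem summable_cellFunction {u : EuclideanSpace ℝ (Fin d) → ℝ}
    (hL : MemLp u 2 (Φ.measureInfty ω)) (hu : ∀ n, S.pull ω n u ∈ Φ.dom)
    (hb : BddAbove (Set.range fun n => Φ.energy ω n u u)) :
    Summable fun τ : Cell ω => τ.weight W * ‖Φ.cellFunction u τ‖ ^ 2 := by
  obtain ⟨B, hB⟩ := hb
  rw [measureInfty_eq] at hL
  have h1 := (memLp_two_iff_integrable_sq hL.1).1 hL
  have h2 := hasSum_integral_measure h1
  have h3 : ∀ n, ∑ τ ∈ Cell.stage ω n, ∫ z, u z ^ 2 ∂(Φ.cellModel.cellMeasure W τ) ≤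
      ∫ z, u z ^ 2 ∂(Φ.cellModel.refMeasure W (Set.univ : Set (Cell ω))) := by
    intro n
    have h4 := sum_le_hasSum ((Cell.stage ω n).subtype (· ∈ Set.univ))
      (fun τ _ => integral_nonneg fun z => sq_nonneg (u z)) h2
    rw [Finset.sum_subtype_eq_sum_filter (s := Cell.stage ω n) (p := (· ∈ Set.univ))
      (fun τ => ∫ z, u z ^ 2 ∂(Φ.cellModel.cellMeasure W τ))] at h4
    simpa [CellModel.refMeasure] using h4
  have h5 : ∀ τ : Cell ω, 0 ≤ τ.weight W * ‖Φ.cellFunction u τ‖ ^ 2 := fun τ =>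
    mul_nonneg (τ.weight_pos W).le (sq_nonneg _)
  refine summable_of_sum_le h5 (c := B +
    ∫ z, u z ^ 2 ∂(Φ.cellModel.refMeasure W (Set.univ : Set (Cell ω)))) fun s => ?_
  obtain ⟨n, hn⟩ := ((tendsto_atTop.1 (Cell.tendsto_stage (ω := ω))) s).exists
  refine (Finset.sum_le_sum_of_subset_of_nonneg hn fun τ _ _ => h5 τ).trans ?_
  refine le_trans (le_of_eq ?_) (add_le_add (hB ⟨n, rfl⟩) (h3 n))
  simp only
  rw [Φ.isCellSum ω n u u _ _ (Φ.ev_cellFunction (hu n)) (Φ.ev_cellFunction (hu n)),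
    ← Finset.sum_add_distrib]
  refine Finset.sum_congr rfl fun τ hτ => ?_
  rw [CellModel.integral_cellMeasure, ← mul_add, real_inner_self_eq_norm_sq]
  simp only [← Φ.ev_cellFunction (hu n) τ (Cell.mem_stage.1 hτ), sq, sub_add_cancel]

theorem isFormOf_infty (c : BoundaryCondition) :
    Φ.cellModel.IsFormOf W (Set.univ : Set (Cell ω)) (c.zeroSet (S.boundaryInfty ω))
      (Φ.formInfty ω c) := by
  refine CellModel.isFormOf_univ (Φ.measureInfty_eq ω) (fun u => ?_) (Φ.isCellSum ω) rfl
  constructor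
  · rintro ⟨hL, hu, hb, hc⟩
    refine CellModel.exists_represents (f := Φ.cellFunction u) (fun τ _ => ?_) ?_
      ((c.holds_iff _ u).1 hc)
    · obtain ⟨n, hn⟩ := ((tendsto_atTop.1 (Cell.tendsto_stage (ω := ω))) {τ}).exists
      exact Φ.ev_cellFunction (hu n) τ (Cell.mem_stage.1 (hn (Finset.mem_singleton_self τ)))
    · exact (Φ.summable_cellFunction hL hu hb).subtype _
  · rintro ⟨x, hx, hxu⟩
    refine ⟨?_, fun n => Φ.pull_mem_of_represents (Set.subset_univ _) hxu,
      ((Φ.isCellSum ω).tendsto hxu hxu).bddAbove_range, (c.holds_iff _ u).2 fun z hz =>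
      hxu.eq_zero hx (fun z hz => ?_) hz⟩
    · rw [measureInfty_eq]
      exact hxu.memLp
    · exact Φ.cellModel.exists_cellPt_of_mem_boundaryInfty (c.zeroSet_subset _ hz)

end SelfSimilarDirichletForm

/-! ### Void boundary conditions and the proposition -/

theorem BoundaryCondition.holds_empty {E : Type*} (c : BoundaryCondition) (u : E → ℝ) :
    c.Holds ∅ u := by
  cases c
  · trivial
  · exact fun x hx => hx.elim

theorem LatticeData.formInfty_eq {d N : ℕ} {S : SelfSimilarSet d N} (L : LatticeData S)
    (W : Weights N) {ω : ℕ → Fin N} (h : S.boundaryInfty ω = ∅) (c c' : BoundaryCondition) :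
    L.formInfty W ω c = L.formInfty W ω c' := by
  simp only [formInfty, h, BoundaryCondition.holds_empty]

theorem SelfSimilarDirichletForm.formInfty_eq {d N : ℕ} {S : SelfSimilarSet d N} {W : Weights N}
    (Φ : SelfSimilarDirichletForm S W) {ω : ℕ → Fin N} (h : S.boundaryInfty ω = ∅)
    (c c' : BoundaryCondition) : Φ.formInfty ω c = Φ.formInfty ω c' := by
  simp only [formInfty, h, BoundaryCondition.holds_empty]

end FractalBlowUp

theorem proposition1 {d N : ℕ} (S : SelfSimilarSet d N) (W : Weights N) (ω : ℕ → Fin N) :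
    -- the lattice case
    (∀ (L : LatticeData S) (μ : Measure ℝ), IsDensityOfStates N (L.form W ω) μ →
      (S.boundaryInfty ω = ∅ →
        L.formInfty W ω .neumann = L.formInfty W ω .dirichlet ∧
        ∀ c, μ.support = (L.formInfty W ω c).spectrum ∧
          (L.formInfty W ω c).spectrum = (L.formInfty W ω c).essSpectrum) ∧
      ((S.boundaryInfty ω).Nonempty →
        (∀ c, μ.support = (L.formInfty W ω c).essSpectrum) ∧
        ∀ c, ∀ l ∈ (L.formInfty W ω c).spectrum \ μ.support,
          (L.formInfty W ω c).IsEigenvalue l →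
            Module.finrank ℝ ((L.formInfty W ω c).eigenspace l) = 1)) ∧
    -- the continuous case
    (∀ (D : SelfSimilarDirichletForm S W) (μ : Measure ℝ), IsDensityOfStates N (D.form ω) μ →
      (S.boundaryInfty ω = ∅ →
        D.formInfty ω .neumann = D.formInfty ω .dirichlet ∧
        ∀ c, μ.support = (D.formInfty ω c).spectrum ∧
          (D.formInfty ω c).spectrum = (D.formInfty ω c).essSpectrum) ∧
      ((S.boundaryInfty ω).Nonempty →
        (∀ c, μ.support = (D.formInfty ω c).essSpectrum) ∧
        ∀ c, ∀ l ∈ (D.formInfty ω c).spectrum \ μ.support,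
          (D.formInfty ω c).IsEigenvalue l →
            Module.finrank ℝ ((D.formInfty ω c).eigenspace l) = 1)) := by
  constructor
  · intro L μ hμ
    obtain ⟨h1, h2⟩ := CellModel.spectrum_of_isDensityOfStates
      (fun n => L.isFormOf W ω n .dirichlet) (L.isFormOf_infty W ω) hμ
    exact ⟨fun h => ⟨L.formInfty_eq W h _ _, h1 h⟩, h2⟩
  · intro D μ hμ
    obtain ⟨h1, h2⟩ := CellModel.spectrum_of_isDensityOfStates
      (fun n => D.isFormOf ω n .dirichlet) (D.isFormOf_infty ω) hμ
    exact ⟨fun h => ⟨D.formInfty_eq h _ _, h1 h⟩, h2⟩
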